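/- Let $T>0$, $Q(T)=(0,T)\times(0,1)$, $H=L^2(0,1)$ and $X=H^1(0,1)$. Let $h,b\in C^2(\mathbb{R})$ and suppose that there are positive constants $C_{h,1},C_{h,2},C_{b,1},C_{b,2}$ such that on $\mathbb{R}$ (A1) $C_{h,1}\le h'\le C_{h,2}$ and $|h''|\le C_{h,2}$; (A2) $C_{b,1}\le b\le C_{b,2}$ and $|b'|,|b''|\le C_{b,2}$. If $p\in W^{1,2}(0,T;H)\cap L^\infty(Q(T))\cap L^2(0,T;X)$ and $v_0\in X$, then the problem $$\partial_t h(v)=\partial_x\big(\partial_x v+b(v)p\big)\ \text{ in } Q(T),\qquad \partial_x v+b(v)p=0\ \text{ at } x=0,1 \text{ for } t\in(0,T),\qquad v(0,\cdot)=v_0 \ \text{ in } (0,1)$$ has a unique strong solution $v\in W^{1,2}(0,T;H)\cap L^\infty(0,T;X)\cap L^2(0,T;H^2(0,1))$. Here a strong solution is a function $v$ in this class for which the equation holds almost everywhere in $Q(T)$ (with weak derivatives), the flux $\partial_x v+b(v)p$ has zero boundary values at $x=0$ and $x=1$ for almost every $t\in(0,T)$, and the representative of $v$ in $C([0,T];H)$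 equals $v_0$ at $t=0$; uniqueness is up to equality almost everywhere in $Q(T)$. -/

import Mathlib

open MeasureTheory Set
open scoped ENNReal ContDiff

/-- The space `H = L²(0,1)`. -/
abbrev L2Unit : Type := Lp ℝ 2 (volume.restrict (Ioo (0 : ℝ) 1))

/-- `g` is the weak (distributional) derivative of `f` on the open interval `(a, b)`, for
functions with values in a Banach space: `∫ φ' f = - ∫ φ g` for all `φ ∈ C_c^∞(a, b)`. -/
def IsWeakDeriv {E : Type*} [NormedAddCommGroup E] [NormedSpace ℝ E] [CompleteSpace E]
    (a b : ℝ) (f g : ℝ → E) : Prop :=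
  LocallyIntegrableOn f (Ioo a b) ∧ LocallyIntegrableOn g (Ioo a b) ∧
    ∀ φ : ℝ → ℝ, ContDiff ℝ ∞ φ → HasCompactSupport φ → tsupport φ ⊆ Ioo a b →
      ∫ s in Ioo a b, deriv φ s • f s = - ∫ s in Ioo a b, φ s • g s

/-- `w = ∂ₓ u` weakly on `(0,1)`, for `u, w ∈ L²(0,1)`. -/
def IsDx (u w : L2Unit) : Prop :=
  IsWeakDeriv 0 1 (fun x => u x) (fun x => w x)

/-- `u ∈ H¹(0,1)`. -/
def MemH1 (u : L2Unit) : Prop := ∃ w : L2Unit, IsDx u w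

/-- The boundary values (traces) of `u` at `x = 0` and `x = 1` are `α` and `β`: `u` has a
representative that is continuous on `[0,1]` and takes these values at the end points. -/
def HasBoundaryValues (u : L2Unit) (α β : ℝ) : Prop :=
  ∃ g : ℝ → ℝ, ContinuousOn g (Icc 0 1) ∧
    (∀ᵐ x ∂(volume.restrict (Ioo (0 : ℝ) 1)), u x = g x) ∧ g 0 = α ∧ g 1 = β

/-- The Bochner space `L^q(0,T;H)`. -/
def MemLqL2 (T : ℝ) (q : ℝ≥0∞) (v : ℝ → L2Unit) : Prop :=
  MemLp v q (volume.restrict (Ioo 0 T))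

/-- `W^{1,2}(0,T;H)`. -/
def MemW12L2 (T : ℝ) (v : ℝ → L2Unit) : Prop :=
  MemLqL2 T 2 v ∧ ∃ w : ℝ → L2Unit, MemLqL2 T 2 w ∧ IsWeakDeriv 0 T v w

/-- `L^q(0,T;H¹(0,1))`: both `v` and `∂ₓ v` belong to `L^q(0,T;H)`. -/
def MemLqH1 (T : ℝ) (q : ℝ≥0∞) (v : ℝ → L2Unit) : Prop :=
  MemLqL2 T q v ∧ ∃ w : ℝ → L2Unit, MemLqL2 T q w ∧
    ∀ᵐ t ∂(volume.restrict (Ioo 0 T)), IsDx (v t) (w t)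

/-- `L^q(0,T;H²(0,1))`: `v`, `∂ₓ v` and `∂ₓ² v` belong to `L^q(0,T;H)`. -/
def MemLqH2 (T : ℝ) (q : ℝ≥0∞) (v : ℝ → L2Unit) : Prop :=
  MemLqL2 T q v ∧ ∃ w z : ℝ → L2Unit, MemLqL2 T q w ∧ MemLqL2 T q z ∧
    ∀ᵐ t ∂(volume.restrict (Ioo 0 T)), IsDx (v t) (w t) ∧ IsDx (w t) (z t)

/-- `p ∈ L^∞(Q(T))`, `Q(T) = (0,T) × (0,1)`. -/
def MemLinfQ (T : ℝ) (p : ℝ → L2Unit) : Prop :=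
  AEStronglyMeasurable p (volume.restrict (Ioo 0 T)) ∧
    ∃ M : ℝ, ∀ᵐ t ∂(volume.restrict (Ioo 0 T)),
      ∀ᵐ x ∂(volume.restrict (Ioo (0 : ℝ) 1)), |p t x| ≤ M

/-- Assumption (A1) on `h`. -/
def AssumptionA1 (h : ℝ → ℝ) : Prop :=
  ContDiff ℝ 2 h ∧ ∃ c₁ c₂ : ℝ, 0 < c₁ ∧ 0 < c₂ ∧
    ∀ r, c₁ ≤ deriv h r ∧ deriv h r ≤ c₂ ∧ |deriv (deriv h) r| ≤ c₂

/-- Assumption (A2) on `b`. -/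
def AssumptionA2 (b : ℝ → ℝ) : Prop :=
  ContDiff ℝ 2 b ∧ ∃ c₁ c₂ : ℝ, 0 < c₁ ∧ 0 < c₂ ∧
    ∀ r, c₁ ≤ b r ∧ b r ≤ c₂ ∧ |deriv b r| ≤ c₂ ∧ |deriv (deriv b) r| ≤ c₂

/-- `v` is a strong solution on `(0,T)` of
`∂ₜ h(v) = ∂ₓ (∂ₓ v + b(v) p)` a.e. in `Q(T)`, `∂ₓ v + b(v) p = 0` at `x = 0, 1`, `v(0) = v₀`,
in the class `W^{1,2}(0,T;H) ∩ L^∞(0,T;H¹) ∩ L²(0,T;H²)`. -/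
structure IsStrongSolution (T : ℝ) (h b : ℝ → ℝ) (p : ℝ → L2Unit) (v₀ : L2Unit)
    (v : ℝ → L2Unit) : Prop where
  memW12 : MemW12L2 T v
  memLinfH1 : MemLqH1 T ∞ v
  memL2H2 : MemLqH2 T 2 v
  /-- `vx = ∂ₓ v`, `F = ∂ₓ v + b(v) p` is the flux, `Fx = ∂ₓ F`, `hv = h(v)` and
  `hvt = ∂ₜ h(v)`; the last two clauses are the equation and the no-flux condition. -/
  equation : ∃ vx F Fx hv hvt : ℝ → L2Unit,
    (∀ᵐ t ∂(volume.restrict (Ioo 0 T)), IsDx (v t) (vx t)) ∧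
    (∀ᵐ t ∂(volume.restrict (Ioo 0 T)), ∀ᵐ x ∂(volume.restrict (Ioo (0 : ℝ) 1)),
      F t x = vx t x + b (v t x) * p t x) ∧
    (∀ᵐ t ∂(volume.restrict (Ioo 0 T)), IsDx (F t) (Fx t)) ∧
    (∀ᵐ t ∂(volume.restrict (Ioo 0 T)), ∀ᵐ x ∂(volume.restrict (Ioo (0 : ℝ) 1)),
      hv t x = h (v t x)) ∧
    IsWeakDeriv 0 T hv hvt ∧
    (∀ᵐ t ∂(volume.restrict (Ioo 0 T)), ∀ᵐ x ∂(volume.restrict (Ioo (0 : ℝ) 1)),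
      hvt t x = Fx t x) ∧
    (∀ᵐ t ∂(volume.restrict (Ioo 0 T)), HasBoundaryValues (F t) 0 0)
  /-- The representative of `v` in `C([0,T];H)` takes the value `v₀` at `t = 0`. -/
  initial : ∃ vc : ℝ → L2Unit, ContinuousOn vc (Icc 0 T) ∧
    (∀ᵐ t ∂(volume.restrict (Ioo 0 T)), v t = vc t) ∧ vc 0 = v₀

/-! Let `J : H¹ → L²` be the embedding, `D = ∂ₓ`, `N` the superposition with `h`, and `B(t, u) =
b(u) p(t)`. Tested against all of `H¹`, the equation and the no-flux condition together read
`J†(d/dt N(J X)) + D†(D X + B(t, J X)) = 0`. By (A1), `N` is Lipschitz and strongly monotone on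
`L²`. By (A2) and the bound on `p`, `B` is bounded and Lipschitz in `u`, once `p` is truncated
(`clip`) at a level that leaves it unchanged. Time regularity of `p` gives `‖B t u - B s u‖² ≤ (t -
s) (ρ t - ρ s)`.

Existence (`exists_evolution`) is Rothe's method, implicit in `N` and `D` and explicit in `B`. Each
step is a strongly monotone problem (`exists_implicit_step`). Testing with the increment
(`energy_step`) and a discrete Gronwall inequality bound the `H¹` norms and give `∑ ‖v (k+1) - v k‖²
≤ R τ`, so the approximations are 1/2-Hölder in time up to the step size. As `J` is compact, they
converge along an ultrafilter weakly in `H¹` at each time and strongly in `L²`, uniformly in time.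
This suffices for the nonlinear terms, and `D` enters linearly. The weak form then says that the
flux is the primitive in `x` of `∂ₜ h(v)`, which has mean zero (`eq_volterra_of_forall_inner`).
Finally `∂ₓ v = F - b(v) p`, together with the product rule `exists_isDx_mul`, gives the `H²` bound.

Uniqueness is an `H⁻¹` argument. Let `V` be integration from `0`, and let `d = h(v) - h(w)`, which
has mean zero. Then `V d` has the difference of the fluxes as time derivative. The identity `V + V†
= 1 ⊗ 1` (`inner_volterra_add`) turns `(V d, ∂ₓ(v - w))` into `-(d, v - w) ≤ -c ‖v - w‖²`. This term
absorbs the Lipschitz perturbation, and Gronwall gives `V d = 0`.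

Calculus in `x` is reduced to algebra with `V`: an element of `H¹` is a pair (value at `0`,
derivative) in `ℝ × L²`, by `isDx_iff`. -/

theorem intervalIntegrable_of_integrableOn_Ioo {E : Type*} [NormedAddCommGroup E]
    {w : ℝ → E} {a b : ℝ} (hab : a ≤ b) (hw : IntegrableOn w (Ioo a b)) :
    IntervalIntegrable w volume a b := by
  rw [intervalIntegrable_iff_integrableOn_Ioo_of_le hab]; exact hw

/-! ### Absolute continuity and the fundamental theorem of calculus in Banach spaces -/

section AbsolutelyContinuous

variable {E : Type*} [NormedAddCommGroup E] [NormedSpace ℝ E]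

/-- The sums in the definition grow at most by a constant factor. This transfers absolute continuity
from scalar to vector-valued integrals, to translates and norms, and to Lipschitz images. -/
theorem AbsolutelyContinuousOnInterval.of_dist_le {X Y : Type*} [PseudoMetricSpace X]
    [PseudoMetricSpace Y] {f : ℝ → X} {g : ℝ → Y} {a b K : ℝ}
    (hg : AbsolutelyContinuousOnInterval g a b)
    (h : ∀ x ∈ uIcc a b, ∀ y ∈ uIcc a b, dist (f x) (f y) ≤ K * dist (g x) (g y)) :
    AbsolutelyContinuousOnInterval f a b := by
  rw [absolutelyContinuousOnInterval_iff] at hg ⊢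
  intro ε hε
  have hK : 0 < |K| + 1 := by positivity
  obtain ⟨δ, hδ, H⟩ := hg (ε / (|K| + 1)) (by positivity)
  refine ⟨δ, hδ, fun I hI hlt => ?_⟩
  have h1 := H I hI hlt
  have h2 : ∑ i ∈ Finset.range I.1, dist (f (I.2 i).1) (f (I.2 i).2)
      ≤ (|K| + 1) * ∑ i ∈ Finset.range I.1, dist (g (I.2 i).1) (g (I.2 i).2) := by
    rw [Finset.mul_sum]
    refine Finset.sum_le_sum fun i hi => ?_
    have hm := hI.1 i hi
    refine (h _ hm.1 _ hm.2).trans ?_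
    exact mul_le_mul_of_nonneg_right (by linarith [le_abs_self K]) dist_nonneg
  calc _ ≤ _ := h2
    _ < (|K| + 1) * (ε / (|K| + 1)) := by gcongr
    _ = ε := by field_simp

theorem IntervalIntegrable.absolutelyContinuousOnInterval_integral [CompleteSpace E] {f : ℝ → E}
    {a b : ℝ} (hf : IntervalIntegrable f volume a b) :
    AbsolutelyContinuousOnInterval (fun x => ∫ s in a..x, f s) a b := by
  refine AbsolutelyContinuousOnInterval.of_dist_le (K := 1)
    (hf.norm.absolutelyContinuousOnInterval_intervalIntegral (c := a) left_mem_uIcc) ?_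
  intro x hx y hy
  have hi : ∀ z ∈ uIcc a b, IntervalIntegrable f volume a z := fun z hz =>
    hf.mono_set (uIcc_subset_uIcc left_mem_uIcc hz)
  have hi' : ∀ z ∈ uIcc a b, IntervalIntegrable (fun s => ‖f s‖) volume a z := fun z hz =>
    (hi z hz).norm
  rw [dist_eq_norm, dist_eq_norm, intervalIntegral.integral_interval_sub_left (hi x hx) (hi y hy),
    intervalIntegral.integral_interval_sub_left (hi' x hx) (hi' y hy), one_mul, Real.norm_eq_abs]
  exact intervalIntegral.norm_integral_le_abs_integral_norm

/-- Subtracting the primitive of `g` from `G` leaves an absolutely continuous function with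
derivative zero almost everywhere, hence a constant. -/
theorem AbsolutelyContinuousOnInterval.integral_eq_sub_of_ae_hasDerivAt [CompleteSpace E]
    {G g : ℝ → E} {a b : ℝ} (hG : AbsolutelyContinuousOnInterval G a b)
    (hd : ∀ᵐ x, x ∈ uIcc a b → HasDerivAt G (g x) x) (hg : IntervalIntegrable g volume a b) :
    ∫ x in a..b, g x = G b - G a := by
  have h1 : AbsolutelyContinuousOnInterval (fun x => G x - ∫ t in a..x, g t) a b :=
    hG.sub hg.absolutelyContinuousOnInterval_integral
  obtain ⟨C, hC⟩ := h1.const_of_ae_hasDerivAt_zero (by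
    filter_upwards [hd, hg.ae_hasDerivAt_integral] with x hx hx' hm
    have h2 := (hx hm).fun_sub (hx' hm a left_mem_uIcc)
    rwa [sub_self] at h2)
  have ha := hC a left_mem_uIcc
  have hb := hC b right_mem_uIcc
  simp only [intervalIntegral.integral_same, sub_zero] at ha
  rw [← ha] at hb
  rw [← hb]; abel

theorem integrableOn_smul_of_tsupport {a b : ℝ} {f : ℝ → E}
    (hf : LocallyIntegrableOn f (Ioo a b)) {φ : ℝ → ℝ} (hφ : Continuous φ)
    (hc : HasCompactSupport φ) (hs : tsupport φ ⊆ Ioo a b) :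
    IntegrableOn (fun s => φ s • f s) (Ioo a b) := by
  have h1 : IntegrableOn f (tsupport φ) := hf.integrableOn_compact_subset hs hc
  have h2 : IntegrableOn (fun s => φ s • f s) (tsupport φ) :=
    h1.continuousOn_smul hφ.continuousOn hc
  have h3 : Integrable (fun s => φ s • f s) := by
    refine h2.integrable_of_forall_notMem_eq_zero fun x hx => ?_
    rw [image_eq_zero_of_notMem_tsupport hx, zero_smul]
  exact h3.integrableOn

end AbsolutelyContinuous

/-! ### Weak derivatives on an interval -/

section WeakDerivative

variable {E F : Type*} [NormedAddCommGroup E] [NormedSpace ℝ E] [CompleteSpace E]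
  [NormedAddCommGroup F] [NormedSpace ℝ F] [CompleteSpace F]

theorem IsWeakDeriv.congr {a b : ℝ} {f g f' g' : ℝ → E} (h : IsWeakDeriv a b f g)
    (hf : ∀ᵐ t ∂volume.restrict (Ioo a b), f t = f' t)
    (hg : ∀ᵐ t ∂volume.restrict (Ioo a b), g t = g' t) : IsWeakDeriv a b f' g' := by
  obtain ⟨h1, h2, h3⟩ := h
  refine ⟨?_, ?_, fun φ hφ hc hs => ?_⟩
  · rw [locallyIntegrableOn_iff isOpen_Ioo.isLocallyClosed] at h1 ⊢
    intro k hk hkc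
    exact (h1 k hk hkc).congr (ae_restrict_of_ae_restrict_of_subset hk hf)
  · rw [locallyIntegrableOn_iff isOpen_Ioo.isLocallyClosed] at h2 ⊢
    intro k hk hkc
    exact (h2 k hk hkc).congr (ae_restrict_of_ae_restrict_of_subset hk hg)
  · have := h3 φ hφ hc hs
    rw [integral_congr_ae (g := fun s => deriv φ s • f' s),
      integral_congr_ae (f := fun s => φ s • g s) (g := fun s => φ s • g' s)] at this
    · exact this
    · filter_upwards [hg] with t ht; rw [ht]
    · filter_upwards [hf] with t ht; rw [ht]

theorem IsWeakDeriv.sub {a b : ℝ} {f g f' g' : ℝ → E} (h : IsWeakDeriv a b f g)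
    (h' : IsWeakDeriv a b f' g') : IsWeakDeriv a b (fun t => f t - f' t) (fun t => g t - g' t) := by
  refine ⟨h.1.sub h'.1, h.2.1.sub h'.2.1, fun φ hφ hc hs => ?_⟩
  have hs' : tsupport (deriv φ) ⊆ Ioo a b := (tsupport_deriv_subset).trans hs
  have hd : Continuous (deriv φ) := hφ.continuous_deriv (by simp)
  simp only [smul_sub]
  rw [integral_sub (integrableOn_smul_of_tsupport h.1 hd hc.deriv hs')
      (integrableOn_smul_of_tsupport h'.1 hd hc.deriv hs'),
    integral_sub (integrableOn_smul_of_tsupport h.2.1 hφ.continuous hc hs)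
      (integrableOn_smul_of_tsupport h'.2.1 hφ.continuous hc hs),
    h.2.2 φ hφ hc hs, h'.2.2 φ hφ hc hs]
  abel

theorem IsWeakDeriv.map {a b : ℝ} {f g : ℝ → E} (h : IsWeakDeriv a b f g) (A : E →L[ℝ] F) :
    IsWeakDeriv a b (fun t => A (f t)) (fun t => A (g t)) := by
  have key : ∀ {f : ℝ → E}, LocallyIntegrableOn f (Ioo a b) →
      LocallyIntegrableOn (fun t => A (f t)) (Ioo a b) := by
    intro f hf
    rw [locallyIntegrableOn_iff isOpen_Ioo.isLocallyClosed] at hf ⊢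
    intro k hk hkc
    exact A.integrable_comp (hf k hk hkc)
  refine ⟨key h.1, key h.2.1, fun φ hφ hc hs => ?_⟩
  have hs' : tsupport (deriv φ) ⊆ Ioo a b := (tsupport_deriv_subset).trans hs
  have hd : Continuous (deriv φ) := hφ.continuous_deriv (by simp)
  have h1 := A.integral_comp_comm (integrableOn_smul_of_tsupport h.1 hd hc.deriv hs')
  have h2 := A.integral_comp_comm (integrableOn_smul_of_tsupport h.2.1 hφ.continuous hc hs)
  simp only [map_smul] at h1 h2
  rw [h1, h2, h.2.2 φ hφ hc hs, map_neg]

/-- Integration by parts: the product of a test function with the primitive is absolutely continuous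
and vanishes at both ends. -/
theorem isWeakDeriv_integral {a b : ℝ} (hab : a ≤ b) {w : ℝ → E} (hw : IntegrableOn w (Ioo a b))
    (c : E) : IsWeakDeriv a b (fun t => c + ∫ s in a..t, w s) w := by
  have hwi := intervalIntegrable_of_integrableOn_Ioo hab hw
  have hac := hwi.absolutelyContinuousOnInterval_integral
  have hcont : ContinuousOn (fun t => c + ∫ s in a..t, w s) (Icc a b) := by
    have := hac.continuousOn
    rw [uIcc_of_le hab] at this
    exact continuousOn_const.add this
  refine ⟨(hcont.mono Ioo_subset_Icc_self).locallyIntegrableOn measurableSet_Ioo,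
    hw.locallyIntegrableOn, fun φ hφ hc hs => ?_⟩
  have hd : Continuous (deriv φ) := hφ.continuous_deriv (by simp)
  have hφa : φ a = 0 := image_eq_zero_of_notMem_tsupport fun h => (hs h).1.false
  have hφb : φ b = 0 := image_eq_zero_of_notMem_tsupport fun h => (hs h).2.false
  have hφac : AbsolutelyContinuousOnInterval φ a b :=
    (hφ.of_le (by simp)).contDiffOn.absolutelyContinuousOnInterval
  have hcac : AbsolutelyContinuousOnInterval (fun _ : ℝ => c) a b :=
    AbsolutelyContinuousOnInterval.of_dist_le (K := 0) hφac (by simp)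
  have hG : AbsolutelyContinuousOnInterval (fun t => φ t • (c + ∫ s in a..t, w s)) a b :=
    hφac.fun_smul (hcac.fun_add hac)
  have i1 : IntervalIntegrable (fun t => deriv φ t • (c + ∫ s in a..t, w s)) volume a b := by
    apply ContinuousOn.intervalIntegrable
    rw [uIcc_of_le hab]
    exact hd.continuousOn.smul hcont
  have i2 : IntervalIntegrable (fun t => φ t • w t) volume a b :=
    hwi.continuousOn_smul hφ.continuous.continuousOn
  have h1 := hG.integral_eq_sub_of_ae_hasDerivAt
    (g := fun t => φ t • w t + deriv φ t • (c + ∫ s in a..t, w s)) (by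
      filter_upwards [hwi.ae_hasDerivAt_integral] with x hx hm
      have h2 := (hx hm a left_mem_uIcc).const_add c
      exact ((hφ.differentiable (by simp)) x).hasDerivAt.smul h2) (i2.add i1)
  rw [hφa, hφb, zero_smul, zero_smul, sub_zero, intervalIntegral.integral_add i2 i1] at h1
  rw [intervalIntegral.integral_of_le hab, intervalIntegral.integral_of_le hab,
    integral_Ioc_eq_integral_Ioo, integral_Ioc_eq_integral_Ioo] at h1
  exact eq_neg_of_add_eq_zero_right h1

/-- The du Bois-Reymond argument. Fix a bump `η` of integral one. For a test function `ψ`, the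
function `ψ - (∫ ψ) η` has integral zero, so its primitive is again a test function; inserting that
primitive gives `∫ ψ f = (∫ ψ) c` with `c = ∫ η f`. -/
theorem ae_const_of_isWeakDeriv_zero {a b : ℝ} (hab : a < b) {f : ℝ → E}
    (hf : IsWeakDeriv a b f 0) : ∃ c, ∀ᵐ t ∂volume.restrict (Ioo a b), f t = c := by
  obtain ⟨h1, -, h3⟩ := hf
  let x₀ : ℝ := (a + b) / 2
  obtain ⟨η₀, hη0⟩ : ∃ η : ContDiffBump x₀, tsupport η ⊆ Ioo a b := by
    have hr : 0 < (b - a) / 4 := by linarith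
    refine ⟨⟨(b - a) / 8, (b - a) / 4, by linarith, by linarith⟩, ?_⟩
    rw [ContDiffBump.tsupport_eq, Real.closedBall_eq_Icc]
    intro x hx
    simp only [x₀, mem_Icc] at hx
    constructor <;> linarith [hx.1, hx.2]
  let η : ℝ → ℝ := η₀.normed volume
  have hηc : HasCompactSupport η := η₀.hasCompactSupport_normed
  have hηs : tsupport η ⊆ Ioo a b := by
    rw [show tsupport η = tsupport η₀ by
      rw [η₀.tsupport_normed_eq, η₀.tsupport_eq]]
    exact hη0
  have hηd : ContDiff ℝ ∞ η := η₀.contDiff_normed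
  have hηi : ∫ x, η x = 1 := η₀.integral_normed
  refine ⟨∫ s in Ioo a b, η s • f s, ?_⟩
  set c := ∫ s in Ioo a b, η s • f s with hcdef
  have hloc : LocallyIntegrableOn (fun t => f t - c) (Ioo a b) :=
    h1.sub ((locallyIntegrable_const c).locallyIntegrableOn _)
  have hz := isOpen_Ioo.ae_eq_zero_of_integral_contDiff_smul_eq_zero hloc (fun ψ hψ hψc hψs => ?_)
  · rw [ae_restrict_iff' measurableSet_Ioo]
    filter_upwards [hz] with x hx hm using sub_eq_zero.1 (hx hm)
  set m := ∫ x, ψ x with hm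
  let θ : ℝ → ℝ := fun x => ψ x - m * η x
  have hθd : ContDiff ℝ ∞ θ := hψ.sub (contDiff_const.mul hηd)
  have hθcont := hθd.continuous
  have hψint : Integrable ψ := hψ.continuous.integrable_of_hasCompactSupport hψc
  have hηint : Integrable η := hηd.continuous.integrable_of_hasCompactSupport hηc
  -- both test functions vanish outside a compact subinterval
  obtain ⟨α, β, hαβ, hα, hβ, hψ0, hη0'⟩ : ∃ α β, α < β ∧ a < α ∧ β < b ∧
      (∀ x, x ∉ Icc α β → ψ x = 0) ∧ ∀ x, x ∉ Icc α β → η x = 0 := by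
    have hK : IsCompact (tsupport ψ ∪ tsupport η) := IsCompact.union hψc hηc
    -- Adjoining `x₀` makes nonemptiness immediate; the least and greatest points, moved halfway
    -- towards `a` and `b`, then give `α < β`.
    have hne : (tsupport ψ ∪ tsupport η ∪ {x₀}).Nonempty := ⟨x₀, by simp⟩
    have hK' : IsCompact (tsupport ψ ∪ tsupport η ∪ {x₀}) := hK.union isCompact_singleton
    have hsub : tsupport ψ ∪ tsupport η ∪ {x₀} ⊆ Ioo a b := by
      refine union_subset (union_subset hψs hηs) ?_
      rw [singleton_subset_iff]
      constructor <;> simp only [x₀] <;> linarith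
    obtain ⟨p, hp, hp'⟩ := hK'.exists_isLeast hne
    obtain ⟨q, hq, hq'⟩ := hK'.exists_isGreatest hne
    have hpI := hsub hp
    have hqI := hsub hq
    have hpq : p ≤ q := hp' hq
    refine ⟨(a + p) / 2, (q + b) / 2, by linarith [hpI.1, hqI.2], by linarith [hpI.1],
      by linarith [hqI.2], ?_, ?_⟩
    · intro x hx
      refine image_eq_zero_of_notMem_tsupport fun h => hx ?_
      have h1 := hp' (Or.inl (Or.inl h))
      have h2 := hq' (Or.inl (Or.inl h))
      constructor <;> linarith [hpI.1, hqI.2]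
    · intro x hx
      refine image_eq_zero_of_notMem_tsupport fun h => hx ?_
      have h1 := hp' (Or.inl (Or.inr h))
      have h2 := hq' (Or.inl (Or.inr h))
      constructor <;> linarith [hpI.1, hqI.2]
  have hθ0 : ∀ x, x ∉ Icc α β → θ x = 0 := fun x hx => by simp [θ, hψ0 x hx, hη0' x hx]
  have hθi : ∫ x in α..β, θ x = 0 := by
    have h0 : ∫ x, θ x = 0 := by
      simp only [θ]
      rw [integral_sub hψint (hηint.const_mul m), integral_const_mul, hηi, mul_one, hm, sub_self]
    rw [intervalIntegral.integral_of_le hαβ.le, ← integral_Icc_eq_integral_Ioc,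
      setIntegral_eq_integral_of_forall_compl_eq_zero hθ0, h0]
  let φ : ℝ → ℝ := fun x => ∫ s in α..x, θ s
  have hφd : ∀ x, HasDerivAt φ (θ x) x := fun x =>
    hθcont.integral_hasStrictDerivAt α x |>.hasDerivAt
  have hφ' : deriv φ = θ := funext fun x => (hφd x).deriv
  have hφsm : ContDiff ℝ ∞ φ := by
    rw [contDiff_infty_iff_deriv]
    exact ⟨fun x => (hφd x).differentiableAt, by rw [hφ']; exact hθd⟩
  have hφ0 : ∀ x, x ∉ Icc α β → φ x = 0 := by
    intro x hx
    rw [mem_Icc, not_and_or, not_le, not_le] at hx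
    rcases hx with hx | hx
    · simp only [φ]
      rw [intervalIntegral.integral_symm, intervalIntegral.integral_of_le hx.le,
        integral_Ioc_eq_integral_Ioo, setIntegral_eq_zero_of_forall_eq_zero, neg_zero]
      intro y hy
      exact hθ0 y fun h => by linarith [h.1, hy.2]
    · simp only [φ]
      rw [← intervalIntegral.integral_add_adjacent_intervals (b := β)
        (hθcont.intervalIntegrable _ _) (hθcont.intervalIntegrable _ _), hθi, zero_add,
        intervalIntegral.integral_of_le hx.le, setIntegral_eq_zero_of_forall_eq_zero]
      intro y hy
      exact hθ0 y fun h => by linarith [h.2, hy.1]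
  have hφs : tsupport φ ⊆ Icc α β :=
    closure_minimal (fun x hx => by_contra fun h => hx (hφ0 x h)) isClosed_Icc
  have hφc : HasCompactSupport φ := isCompact_Icc.of_isClosed_subset (isClosed_tsupport _) hφs
  have key := h3 φ hφsm hφc (hφs.trans fun x hx => ⟨by linarith [hx.1], by linarith [hx.2]⟩)
  simp only [hφ', Pi.zero_apply, smul_zero, integral_zero, neg_zero] at key
  have iψ : IntegrableOn (fun s => ψ s • f s) (Ioo a b) :=
    integrableOn_smul_of_tsupport h1 hψ.continuous hψc hψs
  have iη : IntegrableOn (fun s => η s • f s) (Ioo a b) :=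
    integrableOn_smul_of_tsupport h1 hηd.continuous hηc hηs
  have e1 : ∫ s in Ioo a b, ψ s • f s = m • c := by
    have : ∀ s, θ s • f s = ψ s • f s - m • (η s • f s) := fun s => by
      simp only [θ, sub_smul, mul_smul]
    simp only [this] at key
    rw [integral_sub iψ (iη.fun_smul m), integral_smul, ← hcdef] at key
    exact sub_eq_zero.1 key
  have e2 : ∫ s in Ioo a b, ψ s • (f s - c) = ∫ s, ψ s • (f s - c) := by
    refine setIntegral_eq_integral_of_forall_compl_eq_zero fun x hx => ?_
    rw [image_eq_zero_of_notMem_tsupport fun h => hx (hψs h), zero_smul]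
  rw [← e2]
  simp only [smul_sub]
  rw [integral_sub iψ (hψint.smul_const c).integrableOn, e1, integral_smul_const,
    setIntegral_eq_integral_of_forall_compl_eq_zero, ← hm, sub_self]
  exact fun x hx => image_eq_zero_of_notMem_tsupport fun h => hx (hψs h)

theorem IsWeakDeriv.exists_eq_integral {a b : ℝ} (hab : a < b) {f g : ℝ → E}
    (h : IsWeakDeriv a b f g) (hg : IntegrableOn g (Ioo a b)) :
    ∃ c, ∀ᵐ t ∂volume.restrict (Ioo a b), f t = c + ∫ s in a..t, g s := by
  have h1 := h.sub (isWeakDeriv_integral hab.le hg 0)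
  obtain ⟨c, hc⟩ := ae_const_of_isWeakDeriv_zero hab
    (h1.congr (g' := 0) (Filter.Eventually.of_forall fun _ => rfl)
      (Filter.Eventually.of_forall fun _ => sub_self _))
  refine ⟨c, ?_⟩
  filter_upwards [hc] with t ht
  rw [← ht]; abel

theorem IsWeakDeriv.ae_eq_zero {a b : ℝ} {g : ℝ → E} (h : IsWeakDeriv a b 0 g) :
    ∀ᵐ t ∂volume.restrict (Ioo a b), g t = 0 := by
  rw [ae_restrict_iff' measurableSet_Ioo]
  refine isOpen_Ioo.ae_eq_zero_of_integral_contDiff_smul_eq_zero h.2.1 fun φ hφ hc hs => ?_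
  have h1 := h.2.2 φ hφ hc hs
  simp only [Pi.zero_apply, smul_zero, integral_zero] at h1
  rw [← setIntegral_eq_integral_of_forall_compl_eq_zero (s := Ioo a b)]
  · simpa using h1.symm
  · intro x hx
    rw [image_eq_zero_of_notMem_tsupport fun h => hx (hs h), zero_smul]

theorem IsWeakDeriv.unique {a b : ℝ} {f g g' : ℝ → E} (h : IsWeakDeriv a b f g)
    (h' : IsWeakDeriv a b f g') : ∀ᵐ t ∂volume.restrict (Ioo a b), g t = g' t := by
  have h1 := (h.sub h').congr (f' := 0) (g' := fun t => g t - g' t)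
    (Filter.Eventually.of_forall fun _ => sub_self _) (Filter.Eventually.of_forall fun _ => rfl)
  filter_upwards [h1.ae_eq_zero] with t ht using sub_eq_zero.1 ht

theorem ae_eq_zero_of_forall_intervalIntegral_eq_zero {a b : ℝ} (hab : a ≤ b) {f : ℝ → E}
    (hf : IntegrableOn f (Ioo a b)) (h : ∀ t ∈ Ioo a b, ∫ s in a..t, f s = 0) :
    ∀ᵐ t ∂volume.restrict (Ioo a b), f t = 0 := by
  refine ((isWeakDeriv_integral hab hf 0).congr (f' := 0) ?_
    (Filter.Eventually.of_forall fun _ => rfl)).ae_eq_zero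
  filter_upwards [ae_restrict_mem measurableSet_Ioo] with t ht
  simp [h t ht]

end WeakDerivative

/-! ### Energy identity, discrete Gronwall inequality and energy estimate -/

theorem IntervalIntegrable.inner_of_continuousOn {H : Type*} [NormedAddCommGroup H]
    [InnerProductSpace ℝ H] {a b : ℝ} {g f : ℝ → H} (hf : IntervalIntegrable f volume a b)
    (hg : ContinuousOn g (uIcc a b)) :
    IntervalIntegrable (fun s => inner ℝ (g s) (f s)) volume a b := by
  obtain ⟨C, hC⟩ := isCompact_uIcc.exists_bound_of_continuousOn hg
  rw [intervalIntegrable_iff] at hf ⊢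
  refine Integrable.mono' (hf.norm.const_mul C) ?_ ?_
  · exact ((hg.mono uIoc_subset_uIcc).aestronglyMeasurable measurableSet_uIoc).inner
      hf.aestronglyMeasurable
  · filter_upwards [ae_restrict_mem measurableSet_uIoc] with s hs
    refine (norm_inner_le_norm _ _).trans ?_
    exact mul_le_mul_of_nonneg_right (hC s (uIoc_subset_uIcc hs)) (norm_nonneg _)

/-- The norm is 1-Lipschitz, so the squared norm of an absolutely continuous curve is absolutely
continuous and the fundamental theorem applies. -/
theorem norm_sq_integral_eq {H : Type*} [NormedAddCommGroup H] [InnerProductSpace ℝ H]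
    [CompleteSpace H] {T : ℝ} (hT : 0 ≤ T) {f : ℝ → H} (hf : IntegrableOn f (Ioo 0 T))
    (c : H) {t : ℝ} (ht : t ∈ Icc 0 T) :
    ‖c + ∫ s in (0 : ℝ)..t, f s‖ ^ 2 =
      ‖c‖ ^ 2 + ∫ s in (0 : ℝ)..t, 2 * inner ℝ (c + ∫ r in (0 : ℝ)..s, f r) (f s) := by
  have hfi : IntervalIntegrable f volume 0 t :=
    (intervalIntegrable_of_integrableOn_Ioo hT hf).mono_set
      (by rw [uIcc_of_le ht.1, uIcc_of_le hT]; exact Icc_subset_Icc_right ht.2)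
  have hac := hfi.absolutelyContinuousOnInterval_integral
  have hac' : AbsolutelyContinuousOnInterval (fun s => c + ∫ r in (0 : ℝ)..s, f r) 0 t :=
    AbsolutelyContinuousOnInterval.of_dist_le (K := 1) hac (by simp)
  have hn : AbsolutelyContinuousOnInterval (fun s => ‖c + ∫ r in (0 : ℝ)..s, f r‖) 0 t :=
    AbsolutelyContinuousOnInterval.of_dist_le (K := 1) hac' (fun x _ y _ => by
      rw [one_mul, Real.dist_eq, dist_eq_norm]; exact abs_norm_sub_norm_le _ _)
  have h2 := (hn.fun_mul hn).integral_eq_sub_of_ae_hasDerivAt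
    (g := fun s => 2 * inner ℝ (c + ∫ r in (0 : ℝ)..s, f r) (f s)) (by
      filter_upwards [hfi.ae_hasDerivAt_integral] with x hx hm
      have h3 := ((hx hm 0 left_mem_uIcc).const_add c).norm_sq
      simpa only [pow_two] using h3) ?_
  · rw [h2]; simp [pow_two]
  · exact (hfi.inner_of_continuousOn hac'.continuousOn).const_mul 2

/-- Induction on energy plus accumulated dissipation. The implicit term is moved to the left, and `C
τ ≤ 1/2` keeps the factor `1 - C τ` invertible with a bound uniform in `τ`. -/
theorem implicit_discrete_gronwall {y s g : ℕ → ℝ} {C τ : ℝ} {n : ℕ} (hy : ∀ k, 0 ≤ y k)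
    (hs : ∀ k, 0 ≤ s k) (hg : ∀ k < n, 0 ≤ g k) (hC : 0 ≤ C) (hτ : 0 ≤ τ) (hCτ : C * τ ≤ 1 / 2)
    (h : ∀ k < n, y (k + 1) + s k ≤ y k + C * τ * y (k + 1) + g k) {k : ℕ} (hk : k ≤ n) :
    y k + ∑ j ∈ Finset.range k, s j
      ≤ Real.exp (2 * C * τ * k) * (y 0 + ∑ j ∈ Finset.range k, g j) := by
  induction k with
  | zero => simp
  | succ k ih =>
    have ih' := ih (by omega)
    have hkn : k < n := by omega
    rw [Finset.sum_range_succ, Finset.sum_range_succ]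
    set P := y k + ∑ j ∈ Finset.range k, s j
    set Q := y (k + 1) + (∑ j ∈ Finset.range k, s j + s k) with hQ
    set G := y 0 + ∑ j ∈ Finset.range k, g j with hG
    have hS : 0 ≤ ∑ j ∈ Finset.range k, s j := Finset.sum_nonneg fun j _ => hs j
    have hx : 0 ≤ C * τ := by positivity
    have hQ0 : 0 ≤ Q := by have := hy (k + 1); have := hs k; positivity
    have hGk : 0 ≤ g k := hg k hkn
    have h1 : Q ≤ P + C * τ * Q + g k := by
      have h2 := h k hkn
      have h3 : C * τ * y (k + 1) ≤ C * τ * Q :=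
        mul_le_mul_of_nonneg_left (by rw [hQ]; linarith [hs k]) hx
      simp only [P, hQ] at *
      linarith
    have h2 : Q ≤ (1 + 2 * (C * τ)) * (P + g k) := by
      have hPg : (1 - C * τ) * Q ≤ P + g k := by linarith
      -- `(1 + 2x)(1 - x) = 1 + x(1 - 2x) ≥ 1` for `0 ≤ x ≤ 1/2`.
      calc Q ≤ (1 + 2 * (C * τ)) * ((1 - C * τ) * Q) := by
            nlinarith [mul_nonneg (mul_nonneg hx (by linarith : (0 : ℝ) ≤ 1 - 2 * (C * τ))) hQ0]
        _ ≤ _ := by gcongr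
    have he : 1 + 2 * (C * τ) ≤ Real.exp (2 * C * τ) := by
      have := Real.add_one_le_exp (2 * C * τ); linarith
    have he1 : 1 ≤ Real.exp (2 * C * τ * k) := Real.one_le_exp (by positivity)
    have hP0 : 0 ≤ P + g k := by
      have := hy k; simp only [P]; positivity
    calc Q ≤ (1 + 2 * (C * τ)) * (P + g k) := h2
      _ ≤ Real.exp (2 * C * τ) * (P + g k) := by gcongr
      _ ≤ Real.exp (2 * C * τ) *
          (Real.exp (2 * C * τ * k) * G + Real.exp (2 * C * τ * k) * g k) := by
          gcongr
          exact le_mul_of_one_le_left hGk he1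
      _ = Real.exp (2 * C * τ * ((k + 1 : ℕ) : ℝ)) * (y 0 + (∑ j ∈ Finset.range k, g j + g k)) := by
          rw [← mul_add, ← mul_assoc, ← Real.exp_add, hG]
          push_cast
          ring_nf

/-- Energy inequality for one implicit Euler step. -/
theorem energy_step {H : Type*} [NormedAddCommGroup H] [InnerProductSpace ℝ H]
    {a a' β β' d : H} {c τ L r M σ q : ℝ} (hc : 0 < c) (hτ : 0 < τ)
    (hq : c * ‖d‖ ^ 2 ≤ q) (heq : q + τ * inner ℝ (a' + β) (a' - a) = 0)
    (hβ' : ‖β'‖ ≤ M) (hL : ‖β' - β‖ ≤ L * ‖d‖ + r) (hr : r ^ 2 ≤ τ * σ) :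
    1 / 2 * ‖a'‖ ^ 2 + inner ℝ β' a' + M ^ 2 + c / (2 * τ) * ‖d‖ ^ 2
      ≤ 1 / 2 * ‖a‖ ^ 2 + inner ℝ β a + M ^ 2
        + (2 * L ^ 2 / c + 2) * τ * (1 / 2 * ‖a'‖ ^ 2 + inner ℝ β' a' + M ^ 2) + σ / 2 := by
  have h1 : c / τ * ‖d‖ ^ 2 + inner ℝ (a' + β) (a' - a) ≤ 0 := by
    have : inner ℝ (a' + β) (a' - a) = - (q / τ) := by
      field_simp; linarith
    rw [this, div_mul_eq_mul_div, ← sub_eq_add_neg, sub_nonpos]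
    gcongr
  have h2 : inner ℝ a' (a' - a) ≥ 1 / 2 * ‖a'‖ ^ 2 - 1 / 2 * ‖a‖ ^ 2 := by
    have h3 : 0 ≤ ‖a' - a‖ ^ 2 := by positivity
    rw [norm_sub_sq_real] at h3
    rw [inner_sub_right, real_inner_self_eq_norm_sq]
    linarith
  -- Summation by parts: the increment of `a` is not controlled, but the increment of `β` is. This
  -- is why the energy contains the mixed term `inner β a`.
  have h4 : inner ℝ β' a' - inner ℝ β a = inner ℝ β (a' - a) + inner ℝ (β' - β) a' := by
    rw [inner_sub_right, inner_sub_left]; ring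
  have h5 : inner ℝ (β' - β) a' ≤ (L * ‖d‖ + r) * ‖a'‖ :=
    (real_inner_le_norm _ _).trans (mul_le_mul_of_nonneg_right hL (norm_nonneg _))
  -- The shift `M ^ 2` makes the energy coercive despite the mixed term.
  have h6 : 1 / 4 * ‖a'‖ ^ 2 ≤ 1 / 2 * ‖a'‖ ^ 2 + inner ℝ β' a' + M ^ 2 := by
    have h7 : -(M * ‖a'‖) ≤ inner ℝ β' a' := by
      have := (abs_le.1 (abs_real_inner_le_norm β' a')).1
      have h8 : ‖β'‖ * ‖a'‖ ≤ M * ‖a'‖ := mul_le_mul_of_nonneg_right hβ' (norm_nonneg _)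
      linarith
    nlinarith [sq_nonneg (‖a'‖ / 2 - M)]
  rw [inner_add_left] at h1
  -- Young's inequality, using up half of the dissipation `c / τ * ‖d‖ ^ 2`; the other half remains
  -- in the conclusion.
  have h7 : L * ‖d‖ * ‖a'‖ ≤ c / (2 * τ) * ‖d‖ ^ 2 + τ * L ^ 2 / (2 * c) * ‖a'‖ ^ 2 := by
    have : 0 ≤ (c * ‖d‖ - τ * L * ‖a'‖) ^ 2 / (2 * c * τ) := by positivity
    have e : (c * ‖d‖ - τ * L * ‖a'‖) ^ 2 / (2 * c * τ)
      = c / (2 * τ) * ‖d‖ ^ 2 + τ * L ^ 2 / (2 * c) * ‖a'‖ ^ 2 - L * ‖d‖ * ‖a'‖ := by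
      field_simp; ring
    linarith
  have h8 : r * ‖a'‖ ≤ σ / 2 + τ / 2 * ‖a'‖ ^ 2 := by
    have h9 : r ^ 2 / (2 * τ) ≤ σ / 2 := by
      rw [div_le_div_iff₀ (by positivity) (by norm_num)]; linarith
    have : 0 ≤ (r - τ * ‖a'‖) ^ 2 / (2 * τ) := by positivity
    have e : (r - τ * ‖a'‖) ^ 2 / (2 * τ) = r ^ 2 / (2 * τ) + τ / 2 * ‖a'‖ ^ 2 - r * ‖a'‖ := by
      field_simp; ring
    linarith
  have h9 : τ * L ^ 2 / (2 * c) * ‖a'‖ ^ 2 + τ / 2 * ‖a'‖ ^ 2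
      = (2 * L ^ 2 / c + 2) * τ * (1 / 4 * ‖a'‖ ^ 2) := by field_simp; ring
  have h10 : (2 * L ^ 2 / c + 2) * τ * (1 / 4 * ‖a'‖ ^ 2)
      ≤ (2 * L ^ 2 / c + 2) * τ * (1 / 2 * ‖a'‖ ^ 2 + inner ℝ β' a' + M ^ 2) := by gcongr
  have h11 : c / τ * ‖d‖ ^ 2 = c / (2 * τ) * ‖d‖ ^ 2 + c / (2 * τ) * ‖d‖ ^ 2 := by
    field_simp; ring
  linarith

/-- Cauchy–Schwarz on the telescoping sum: the discrete form of the 1/2-Hölder bound for a curve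
with square-integrable derivative. -/
theorem norm_sub_sq_le_of_sum_sq {H : Type*} [NormedAddCommGroup H]
    {v : ℕ → H} {S : ℝ} {k l n : ℕ} (hkl : k ≤ l) (hln : l ≤ n)
    (hS : ∑ j ∈ Finset.range n, ‖v (j + 1) - v j‖ ^ 2 ≤ S) :
    ‖v l - v k‖ ^ 2 ≤ (l - k : ℝ) * S := by
  have h1 : ‖v l - v k‖ ≤ ∑ j ∈ Finset.Ico k l, ‖v (j + 1) - v j‖ := by
    rw [← Finset.sum_Ico_sub v hkl]; exact norm_sum_le _ _
  calc ‖v l - v k‖ ^ 2 ≤ (∑ j ∈ Finset.Ico k l, ‖v (j + 1) - v j‖) ^ 2 := by gcongr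
    _ ≤ (Finset.Ico k l).card * ∑ j ∈ Finset.Ico k l, ‖v (j + 1) - v j‖ ^ 2 :=
        sq_sum_le_card_mul_sum_sq
    _ ≤ (l - k : ℝ) * S := by
        rw [Nat.card_Ico, Nat.cast_sub hkl]
        have : (0 : ℝ) ≤ l - k := by rw [sub_nonneg]; exact_mod_cast hkl
        refine mul_le_mul_of_nonneg_left (le_trans ?_ hS) this
        refine Finset.sum_le_sum_of_subset_of_nonneg ?_ fun _ _ _ => by positivity
        intro j hj
        simp only [Finset.mem_Ico, Finset.mem_range] at hj ⊢
        omega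

/-! ### Monotone operators and the implicit Euler scheme -/

section Monotone

variable {W H : Type*} [NormedAddCommGroup W] [InnerProductSpace ℝ W] [CompleteSpace W]
  [NormedAddCommGroup H] [InnerProductSpace ℝ H] [CompleteSpace H]

/-- A Lipschitz and strongly monotone map of a Hilbert space is surjective. -/
theorem exists_eq_of_stronglyMonotone {A : W → W} {α L : ℝ} (hα : 0 < α)
    (hL : ∀ x y, ‖A x - A y‖ ≤ L * ‖x - y‖)
    (hm : ∀ x y, α * ‖x - y‖ ^ 2 ≤ inner ℝ (A x - A y) (x - y)) (f : W) : ∃ x, A x = f := by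
  set L' : ℝ := |L| + α + 1 with hL'
  have hL'p : 0 < L' := by positivity
  have hLL' : ∀ x y, ‖A x - A y‖ ≤ L' * ‖x - y‖ := fun x y =>
    (hL x y).trans (mul_le_mul_of_nonneg_right (by linarith [le_abs_self L]) (norm_nonneg _))
  -- With this `ε` the map `x ↦ x - ε (A x - f)` has squared Lipschitz constant `1 - 2 ε α + ε² L'²
  -- = 1 - ε α`. Enlarging `L` to `L' ≥ α` ensures `ε α ≤ 1`.
  set ε : ℝ := α / L' ^ 2 with hε
  have hεp : 0 < ε := by positivity
  have hε1 : ε * L' ^ 2 = α := by rw [hε]; field_simp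
  have hq : 0 ≤ 1 - ε * α := by
    have : ε * α ≤ 1 := by
      rw [hε, div_mul_eq_mul_div, div_le_one (by positivity)]
      nlinarith [abs_nonneg L]
    linarith
  let k : NNReal := ⟨Real.sqrt (1 - ε * α), Real.sqrt_nonneg _⟩
  have hk : k < 1 := by
    rw [← NNReal.coe_lt_coe]
    change Real.sqrt (1 - ε * α) < 1
    rw [Real.sqrt_lt' one_pos]
    have : 0 < ε * α := by positivity
    linarith
  have hc : ContractingWith k (fun x => x - ε • (A x - f)) := by
    refine ⟨hk, LipschitzWith.of_dist_le_mul fun x y => ?_⟩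
    rw [dist_eq_norm, dist_eq_norm]
    change _ ≤ Real.sqrt (1 - ε * α) * ‖x - y‖
    have h1 : x - ε • (A x - f) - (y - ε • (A y - f)) = (x - y) - ε • (A x - A y) := by
      simp only [smul_sub]; abel
    rw [h1]
    have h2 : ‖(x - y) - ε • (A x - A y)‖ ^ 2 ≤ (1 - ε * α) * ‖x - y‖ ^ 2 := by
      rw [norm_sub_sq_real, inner_smul_right, norm_smul, Real.norm_eq_abs, abs_of_pos hεp,
        real_inner_comm]
      have h3 : ‖A x - A y‖ ^ 2 ≤ L' ^ 2 * ‖x - y‖ ^ 2 := by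
        rw [← mul_pow]; exact pow_le_pow_left₀ (norm_nonneg _) (hLL' x y) 2
      have h4 := hm x y
      calc ‖x - y‖ ^ 2 - 2 * (ε * inner ℝ (A x - A y) (x - y)) + (ε * ‖A x - A y‖) ^ 2
          ≤ ‖x - y‖ ^ 2 - 2 * (ε * (α * ‖x - y‖ ^ 2)) + ε * (ε * (L' ^ 2 * ‖x - y‖ ^ 2)) := by
            rw [mul_pow, pow_two ε, mul_assoc ε ε]; gcongr
        _ = ‖x - y‖ ^ 2 - 2 * (ε * (α * ‖x - y‖ ^ 2)) + ε * ((ε * L' ^ 2) * ‖x - y‖ ^ 2) := by ring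
        _ = _ := by rw [hε1]; ring
    rw [← Real.sqrt_sq (norm_nonneg (x - y)), ← Real.sqrt_mul hq]
    exact Real.le_sqrt_of_sq_le h2
  refine ⟨hc.fixedPoint _, ?_⟩
  have := hc.fixedPoint_isFixedPt
  simp only [Function.IsFixedPt] at this
  have h1 := sub_eq_self.1 this
  rw [smul_eq_zero] at h1
  exact sub_eq_zero.1 (h1.resolve_left hεp.ne')

/-- Solvability of one implicit Euler step. -/
theorem exists_implicit_step (J D : W →L[ℝ] H) {K : ℝ}
    (hK : ∀ x, ‖x‖ ^ 2 ≤ K * (‖J x‖ ^ 2 + ‖D x‖ ^ 2)) {N : H → H} {c L : ℝ} (hc : 0 < c)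
    (hN : ∀ u v, ‖N u - N v‖ ≤ L * ‖u - v‖)
    (hmono : ∀ u v, c * ‖u - v‖ ^ 2 ≤ inner ℝ (N u - N v) (u - v)) {τ : ℝ} (hτ : 0 < τ)
    (g β : H) :
    ∃ x : W, ∀ φ, inner ℝ (N (J x) - g) (J φ) + τ * inner ℝ (D x + β) (D φ) = 0 := by
  have hK' : ∀ x, ‖x‖ ^ 2 ≤ (|K| + 1) * (‖J x‖ ^ 2 + ‖D x‖ ^ 2) := fun x =>
    (hK x).trans (mul_le_mul_of_nonneg_right (by linarith [le_abs_self K]) (by positivity))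
  have hKp : 0 < |K| + 1 := by positivity
  -- The weak problem is the operator equation for `J† N J + τ D† D` on `W`; coercivity follows from
  -- `hK`.
  obtain ⟨x, hx⟩ := exists_eq_of_stronglyMonotone
    (A := fun x => J.adjoint (N (J x)) + τ • D.adjoint (D x)) (α := min c τ / (|K| + 1))
    (L := ‖J.adjoint‖ * (|L| * ‖J‖) + τ * (‖D.adjoint‖ * ‖D‖)) (by positivity)
    (fun x y => by
      have h1 : J.adjoint (N (J x)) + τ • D.adjoint (D x)
          - (J.adjoint (N (J y)) + τ • D.adjoint (D y))
          = J.adjoint (N (J x) - N (J y)) + τ • D.adjoint (D (x - y)) := by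
        simp only [map_sub, smul_sub]; abel
      rw [h1, add_mul]
      refine (norm_add_le _ _).trans (add_le_add ?_ ?_)
      · calc _ ≤ ‖J.adjoint‖ * ‖N (J x) - N (J y)‖ := J.adjoint.le_opNorm _
          _ ≤ ‖J.adjoint‖ * (|L| * ‖J x - J y‖) := by
            gcongr
            exact (hN _ _).trans (mul_le_mul_of_nonneg_right (le_abs_self L) (norm_nonneg _))
          _ ≤ ‖J.adjoint‖ * (|L| * (‖J‖ * ‖x - y‖)) := by
            gcongr
            rw [← map_sub]; exact J.le_opNorm _
          _ = _ := by ring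
      · rw [norm_smul, Real.norm_eq_abs, abs_of_pos hτ]
        calc _ ≤ τ * (‖D.adjoint‖ * (‖D‖ * ‖x - y‖)) := by
              gcongr
              exact (D.adjoint.le_opNorm _).trans
                (mul_le_mul_of_nonneg_left (D.le_opNorm _) (norm_nonneg _))
          _ = _ := by ring)
    (fun x y => by
      have h1 : J.adjoint (N (J x)) + τ • D.adjoint (D x)
          - (J.adjoint (N (J y)) + τ • D.adjoint (D y))
          = J.adjoint (N (J x) - N (J y)) + τ • D.adjoint (D (x - y)) := by
        simp only [map_sub, smul_sub]; abel
      rw [h1, inner_add_left, inner_smul_left, ContinuousLinearMap.adjoint_inner_left,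
        ContinuousLinearMap.adjoint_inner_left, real_inner_self_eq_norm_sq]
      have h2 := hmono (J x) (J y)
      rw [← map_sub] at h2
      have h3 := hK' (x - y)
      simp only [RCLike.conj_to_real]
      rw [div_mul_eq_mul_div, div_le_iff₀ hKp]
      have h4 : min c τ * (‖J (x - y)‖ ^ 2 + ‖D (x - y)‖ ^ 2)
          ≤ inner ℝ (N (J x) - N (J y)) (J (x - y)) + τ * ‖D (x - y)‖ ^ 2 := by
        rw [mul_add]
        refine add_le_add (le_trans ?_ h2) ?_
        · gcongr; exact min_le_left _ _
        · gcongr; exact min_le_right _ _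
      calc min c τ * ‖x - y‖ ^ 2
          ≤ min c τ * ((|K| + 1) * (‖J (x - y)‖ ^ 2 + ‖D (x - y)‖ ^ 2)) := by gcongr
        _ = (min c τ * (‖J (x - y)‖ ^ 2 + ‖D (x - y)‖ ^ 2)) * (|K| + 1) := by ring
        _ ≤ _ := by gcongr)
    (J.adjoint g - τ • D.adjoint β)
  refine ⟨x, fun φ => ?_⟩
  have h1 := congrArg (fun y => inner ℝ y φ) hx
  simp only [inner_add_left, inner_sub_left, inner_smul_left, RCLike.conj_to_real,
    ContinuousLinearMap.adjoint_inner_left] at h1 ⊢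
  linarith

/-- The implicit Euler scheme and its a priori bounds, uniform in the step size. -/
theorem exists_implicit_scheme (J D : W →L[ℝ] H) {K : ℝ}
    (hK : ∀ x, ‖x‖ ^ 2 ≤ K * (‖J x‖ ^ 2 + ‖D x‖ ^ 2)) {N : H → H} {c LN : ℝ} (hc : 0 < c)
    (hN : ∀ u v, ‖N u - N v‖ ≤ LN * ‖u - v‖)
    (hmono : ∀ u v, c * ‖u - v‖ ^ 2 ≤ inner ℝ (N u - N v) (u - v)) {T : ℝ} (hT : 0 < T)
    {B : ℝ → H → H} {L M : ℝ} {ρ : ℝ → ℝ}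
    (hBL : ∀ t ∈ Icc 0 T, ∀ u v, ‖B t u - B t v‖ ≤ L * ‖u - v‖)
    (hBM : ∀ t ∈ Icc 0 T, ∀ u, ‖B t u‖ ≤ M)
    (hBt : ∀ s ∈ Icc 0 T, ∀ t ∈ Icc 0 T, s ≤ t → ∀ u,
      ‖B t u - B s u‖ ^ 2 ≤ (t - s) * (ρ t - ρ s)) (x₀ : W) :
    ∃ (R : ℝ) (n₀ : ℕ), 0 ≤ R ∧ ∀ n : ℕ, n₀ < n → ∃ x : ℕ → W, x 0 = x₀ ∧
      (∀ k ≤ n, ‖x k‖ ≤ R) ∧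
      ∑ k ∈ Finset.range n, ‖J (x (k + 1)) - J (x k)‖ ^ 2 ≤ R * (T / n) ∧
      ∀ k < n, J.adjoint (N (J (x (k + 1))) - N (J (x k)))
        + (T / n) • D.adjoint (D (x (k + 1)) + B (k * (T / n)) (J (x k))) = 0 := by
  -- `C` is the Gronwall constant of `energy_step` and `Y` the initial energy. `P` bounds the energy
  -- plus dissipation, `S * τ` the sum of squared increments, `V` the values `‖J (x k)‖ ^ 2`, and
  -- `Rx` the values `‖x k‖ ^ 2`. None depends on `n`; the threshold `⌈2 * C * T⌉₊` gives `C * τ ≤ 1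
  -- / 2`.
  set C : ℝ := 2 * L ^ 2 / c + 2 with hC
  have hCp : 0 < C := by positivity
  set Y : ℝ := 1 / 2 * ‖D x₀‖ ^ 2 + inner ℝ (B 0 (J x₀)) (D x₀) + M ^ 2 with hY
  set P : ℝ := Real.exp (2 * C * T) * (Y + (ρ T - ρ 0) / 2) with hP
  set S : ℝ := 2 / c * P with hS
  set V : ℝ := 2 * ‖J x₀‖ ^ 2 + 2 * (T * S) with hV
  set Rx : ℝ := |K| * (V + 4 * P) with hRx
  refine ⟨max (Real.sqrt Rx) S, ⌈2 * C * T⌉₊, le_max_of_le_left (Real.sqrt_nonneg _),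
    fun n hn => ?_⟩
  have hnp : (0 : ℝ) < n := by exact_mod_cast (by omega : 0 < n)
  set τ : ℝ := T / n with hτ
  have hτp : 0 < τ := by positivity
  have hnτ : (n : ℝ) * τ = T := by rw [hτ]; field_simp
  have hCτ : C * τ ≤ 1 / 2 := by
    have h1 : 2 * C * T ≤ n := (Nat.le_ceil _).trans (by exact_mod_cast hn.le)
    rw [hτ, mul_div_assoc', div_le_iff₀ hnp]; linarith
  choose f hf using fun (x : W) (t : ℝ) =>
    exists_implicit_step J D hK hc hN hmono hτp (N (J x)) (B t (J x))
  let x : ℕ → W := fun k => Nat.rec x₀ (fun j y => f y (j * τ)) k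
  have hx0 : x 0 = x₀ := rfl
  have hxs : ∀ k, x (k + 1) = f (x k) (k * τ) := fun _ => rfl
  have hxeq : ∀ k φ, inner ℝ (N (J (x (k + 1))) - N (J (x k))) (J φ)
      + τ * inner ℝ (D (x (k + 1)) + B (k * τ) (J (x k))) (D φ) = 0 := fun k φ => by
    rw [hxs]; exact hf _ _ φ
  have hmem : ∀ k : ℕ, k ≤ n → (k : ℝ) * τ ∈ Icc 0 T := fun k hk => by
    refine ⟨by positivity, ?_⟩
    rw [← hnτ]; gcongr
  -- The energy is set to `0` after `n`: the Gronwall lemma asks for nonnegativity at every index,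
  -- while `B` is bounded only at times in `[0, T]`.
  let y : ℕ → ℝ := fun k => if k ≤ n then
    1 / 2 * ‖D (x k)‖ ^ 2 + inner ℝ (B (k * τ) (J (x k))) (D (x k)) + M ^ 2 else 0
  have hyk : ∀ k ≤ n, y k =
    1 / 2 * ‖D (x k)‖ ^ 2 + inner ℝ (B (k * τ) (J (x k))) (D (x k)) + M ^ 2 :=
    fun k hk => if_pos hk
  have hy4 : ∀ k ≤ n, 1 / 4 * ‖D (x k)‖ ^ 2 ≤ y k := fun k hk => by
    rw [hyk k hk]
    have h7 : -(M * ‖D (x k)‖) ≤ inner ℝ (B (k * τ) (J (x k))) (D (x k)) := by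
      have := (abs_le.1 (abs_real_inner_le_norm (B (k * τ) (J (x k))) (D (x k)))).1
      have h8 : ‖B (k * τ) (J (x k))‖ * ‖D (x k)‖ ≤ M * ‖D (x k)‖ :=
        mul_le_mul_of_nonneg_right (hBM _ (hmem k hk) _) (norm_nonneg _)
      linarith
    nlinarith [sq_nonneg (‖D (x k)‖ / 2 - M)]
  have hy0 : ∀ k, 0 ≤ y k := fun k => by
    by_cases hk : k ≤ n
    · exact le_trans (by positivity) (hy4 k hk)
    · simp [y, hk]
  have hσ : ∀ k < n, 0 ≤ τ * (ρ ((k + 1 : ℕ) * τ) - ρ (k * τ)) := fun k hk => by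
    have := hBt _ (hmem k hk.le) _ (hmem (k + 1) hk)
      (mul_le_mul_of_nonneg_right (by push_cast; linarith) hτp.le) 0
    refine le_trans (by positivity) (this.trans_eq ?_)
    push_cast; ring
  have hσ' : ∀ k < n, 0 ≤ ρ ((k + 1 : ℕ) * τ) - ρ (k * τ) := fun k hk =>
    nonneg_of_mul_nonneg_right (hσ k hk) hτp
  have hstep : ∀ k < n, y (k + 1) + c / (2 * τ) * ‖J (x (k + 1)) - J (x k)‖ ^ 2
      ≤ y k + C * τ * y (k + 1) + (ρ ((k + 1 : ℕ) * τ) - ρ (k * τ)) / 2 := by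
    intro k hk
    rw [hyk k hk.le, hyk (k + 1) hk]
    -- The test function is the increment, the discrete counterpart of testing with `∂ₜ v`.
    have e1 := hxeq k (x (k + 1) - x k)
    rw [map_sub, map_sub] at e1
    refine energy_step hc hτp (hmono _ _) e1 (hBM _ (hmem _ hk) _)
      (r := ‖B ((k + 1 : ℕ) * τ) (J (x k)) - B (k * τ) (J (x k))‖) ?_ ?_
    · calc _ = ‖(B ((k + 1 : ℕ) * τ) (J (x (k + 1))) - B ((k + 1 : ℕ) * τ) (J (x k)))
            + (B ((k + 1 : ℕ) * τ) (J (x k)) - B (k * τ) (J (x k)))‖ := by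
            rw [sub_add_sub_cancel]
        _ ≤ _ := (norm_add_le _ _).trans (add_le_add (hBL _ (hmem _ hk) _ _) le_rfl)
    · refine (hBt _ (hmem k hk.le) _ (hmem (k + 1) hk)
        (mul_le_mul_of_nonneg_right (by push_cast; linarith) hτp.le) _).trans_eq ?_
      push_cast; ring
  have hmain : ∀ k ≤ n, y k + ∑ j ∈ Finset.range k, c / (2 * τ) * ‖J (x (j + 1)) - J (x j)‖ ^ 2
      ≤ P := by
    intro k hk
    refine (implicit_discrete_gronwall hy0 (fun j => by positivity)
      (fun j hj => by linarith [hσ' j hj]) hCp.le hτp.le hCτ hstep hk).trans ?_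
    have hy00 : y 0 = Y := by rw [hyk 0 (by omega), hY, hx0]; simp
    have hsum : ∀ m : ℕ, ∑ j ∈ Finset.range m, (ρ ((j + 1 : ℕ) * τ) - ρ (j * τ)) / 2
        = (ρ (m * τ) - ρ 0) / 2 := fun m => by
      rw [← Finset.sum_div, Finset.sum_range_sub (fun j : ℕ => ρ (j * τ))]; simp
    have hle : ∑ j ∈ Finset.range k, (ρ ((j + 1 : ℕ) * τ) - ρ (j * τ)) / 2
        ≤ (ρ T - ρ 0) / 2 := by
      rw [← hnτ, ← hsum n]
      refine Finset.sum_le_sum_of_subset_of_nonneg (Finset.range_mono hk) fun j hj _ => ?_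
      linarith [hσ' j (Finset.mem_range.1 hj)]
    have hge : 0 ≤ ∑ j ∈ Finset.range k, (ρ ((j + 1 : ℕ) * τ) - ρ (j * τ)) / 2 :=
      Finset.sum_nonneg fun j hj => by
        linarith [hσ' j (lt_of_lt_of_le (Finset.mem_range.1 hj) hk)]
    have hkτ : τ * k ≤ T := by rw [mul_comm]; exact (hmem k hk).2
    rw [hP, hy00]
    refine mul_le_mul ?_ (by linarith) (by linarith [hy0 0, hy00]) (Real.exp_nonneg _)
    rw [Real.exp_le_exp, mul_assoc]
    gcongr
  have hsq : ∑ k ∈ Finset.range n, ‖J (x (k + 1)) - J (x k)‖ ^ 2 ≤ S * τ := by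
    have h1 := hmain n le_rfl
    rw [← Finset.mul_sum] at h1
    have h2 : c / (2 * τ) * ∑ k ∈ Finset.range n, ‖J (x (k + 1)) - J (x k)‖ ^ 2 ≤ P := by
      linarith [hy0 n]
    rw [hS]
    have h3 : ∑ k ∈ Finset.range n, ‖J (x (k + 1)) - J (x k)‖ ^ 2 = (2 * τ / c) *
      (c / (2 * τ) * ∑ k ∈ Finset.range n, ‖J (x (k + 1)) - J (x k)‖ ^ 2) := by field_simp
    rw [h3]
    calc _ ≤ 2 * τ / c * P := by gcongr
      _ = _ := by ring
  refine ⟨x, hx0, fun k hk => le_max_of_le_left ?_, hsq.trans ?_, fun k hk => ?_⟩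
  · refine Real.le_sqrt_of_sq_le ((hK (x k)).trans ?_)
    have hS0 : 0 ≤ S * τ := le_trans (Finset.sum_nonneg fun _ _ => by positivity) hsq
    have h1 : ‖D (x k)‖ ^ 2 ≤ 4 * P := by
      have h2 := hmain k hk
      have h3 : 0 ≤ ∑ j ∈ Finset.range k, c / (2 * τ) * ‖J (x (j + 1)) - J (x j)‖ ^ 2 :=
        Finset.sum_nonneg fun _ _ => by positivity
      linarith [hy4 k hk]
    have h2 : ‖J (x k)‖ ^ 2 ≤ V := by
      have h3 := norm_sub_sq_le_of_sum_sq (v := fun j => J (x j)) (Nat.zero_le k) hk hsq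
      simp only [hx0, Nat.cast_zero, sub_zero] at h3
      have h4 : (k : ℝ) * (S * τ) ≤ T * S := by
        rw [← hnτ]
        calc (k : ℝ) * (S * τ) ≤ n * (S * τ) := by gcongr
          _ = _ := by ring
      have h5 : ‖J (x k)‖ ≤ ‖J (x k) - J x₀‖ + ‖J x₀‖ := by
        simpa using norm_add_le (J (x k) - J x₀) (J x₀)
      nlinarith [norm_nonneg (J (x k)), sq_nonneg (‖J (x k) - J x₀‖ - ‖J x₀‖)]
    rw [hRx]
    calc _ ≤ |K| * (‖J (x k)‖ ^ 2 + ‖D (x k)‖ ^ 2) :=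
          mul_le_mul_of_nonneg_right (le_abs_self K) (by positivity)
      _ ≤ _ := by gcongr
  · gcongr; exact le_max_right _ _
  · refine ext_inner_right ℝ fun φ => ?_
    rw [inner_add_left, inner_smul_left, ContinuousLinearMap.adjoint_inner_left,
      ContinuousLinearMap.adjoint_inner_left, inner_zero_left]
    exact hxeq k φ

end Monotone

/-! ### Weak limits along ultrafilters and uniform convergence -/

theorem norm_toLp_sq {H : Type*} [NormedAddCommGroup H] [InnerProductSpace ℝ H] {T : ℝ}
    {w : ℝ → H} (hw : MemLp w 2 (volume.restrict (Ioo 0 T))) :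
    ‖hw.toLp w‖ ^ 2 = ∫ s in Ioo 0 T, ‖w s‖ ^ 2 := by
  rw [← real_inner_self_eq_norm_sq, L2.inner_def]
  refine integral_congr_ae ?_
  filter_upwards [hw.coeFn_toLp] with s hs
  rw [hs, real_inner_self_eq_norm_sq]

section WeakLimits

variable {W H : Type*} [NormedAddCommGroup W] [InnerProductSpace ℝ W] [CompleteSpace W]
  [NormedAddCommGroup H] [InnerProductSpace ℝ H] [CompleteSpace H]

/-- A bounded sequence in a Hilbert space converges weakly along every ultrafilter. -/
theorem exists_weak_limit_ultrafilter {x : ℕ → W} {R : ℝ} (hx : ∀ m, ‖x m‖ ≤ R)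
    (U : Ultrafilter ℕ) :
    ∃ y, ‖y‖ ≤ R ∧ ∀ ψ, Filter.Tendsto (fun m => inner ℝ (x m) ψ) U (nhds (inner ℝ y ψ)) := by
  let f : ℕ → WeakDual ℝ W := fun m =>
    StrongDual.toWeakDual (InnerProductSpace.toDual ℝ W (x m))
  have hK := WeakDual.isCompact_closedBall (𝕜 := ℝ) (E := W) 0 R
  obtain ⟨g, hg, hle⟩ := hK.ultrafilter_le_nhds (U.map f) (by
    rw [Filter.le_principal_iff, Ultrafilter.mem_coe, Ultrafilter.mem_map]
    refine Filter.univ_mem' fun m => ?_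
    change _ ∈ Metric.closedBall _ _
    rw [mem_closedBall_zero_iff]
    change ‖InnerProductSpace.toDual ℝ W (x m)‖ ≤ R
    rw [LinearIsometryEquiv.norm_map]; exact hx m)
  have hg' : ‖WeakDual.toStrongDual g‖ ≤ R := by
    rw [← mem_closedBall_zero_iff]; exact hg
  refine ⟨(InnerProductSpace.toDual ℝ W).symm (WeakDual.toStrongDual g), ?_, fun ψ => ?_⟩
  · rw [LinearIsometryEquiv.norm_map]; exact hg'
  · have h1 : Filter.Tendsto f U (nhds g) := hle
    have h2 := ((WeakDual.eval_continuous (𝕜 := ℝ) ψ).tendsto g).comp h1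
    have h3 : inner ℝ ((InnerProductSpace.toDual ℝ W).symm (WeakDual.toStrongDual g)) ψ
        = (WeakDual.toStrongDual g) ψ := InnerProductSpace.toDual_symm_apply
    rw [h3]
    exact h2

/-- `J` maps bounded weakly convergent sequences to strongly convergent ones (along every
ultrafilter on the indices). -/
def MapsWeakToStrong (J : W →L[ℝ] H) : Prop :=
  ∀ (U : Ultrafilter ℕ) (x : ℕ → W) (R : ℝ) (y : W), (∀ m, ‖x m‖ ≤ R) →
    (∀ ψ, Filter.Tendsto (fun m => inner ℝ (x m) ψ) U (nhds (inner ℝ y ψ))) →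
    Filter.Tendsto (fun m => J (x m)) U (nhds (J y))

/-- Functions with derivatives bounded in `L²(0,T;H)` have limits with derivative in
`L²(0,T;H)`. -/
theorem exists_memLp_integral_eq_of_tendsto {T R : ℝ} {w : ℕ → ℝ → H}
    (hw : ∀ m, MemLp (w m) 2 (volume.restrict (Ioo 0 T)))
    (hR : ∀ m, ∫ s in Ioo 0 T, ‖w m s‖ ^ 2 ≤ R) {U : Ultrafilter ℕ} {g : ℝ → H}
    (hg : ∀ t ∈ Icc 0 T, Filter.Tendsto (fun m => ∫ s in (0 : ℝ)..t, w m s) U (nhds (g t))) :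
    ∃ v : ℝ → H, MemLp v 2 (volume.restrict (Ioo 0 T)) ∧
      ∀ t ∈ Icc 0 T, ∫ s in (0 : ℝ)..t, v s = g t := by
  obtain ⟨y, -, hy⟩ := exists_weak_limit_ultrafilter (x := fun m => (hw m).toLp (w m))
    (R := Real.sqrt R) (fun m => Real.le_sqrt_of_sq_le (by rw [norm_toLp_sq]; exact hR m)) U
  refine ⟨y, Lp.memLp y, fun t ht => ?_⟩
  -- Pairing with `ψ` times the indicator of `(0, t)` evaluates the primitive at `t`, so weak
  -- convergence of the derivatives identifies the primitive of the limit.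
  have key : ∀ (f : Lp H 2 (volume.restrict (Ioo 0 T))) (ψ : H),
      inner ℝ f (indicatorConstLp 2 (measurableSet_Ioo : MeasurableSet (Ioo 0 t))
        (measure_ne_top _ _) ψ) = inner ℝ (∫ s in (0 : ℝ)..t, f s) ψ := by
    intro f ψ
    rw [real_inner_comm, L2.inner_indicatorConstLp_eq_inner_setIntegral, real_inner_comm,
      Measure.restrict_restrict measurableSet_Ioo, intervalIntegral.integral_of_le ht.1,
      integral_Ioc_eq_integral_Ioo, inter_eq_left.2 (Ioo_subset_Ioo_right ht.2)]
  refine ext_inner_right ℝ fun ψ => ?_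
  have h1 := hy (indicatorConstLp 2 (measurableSet_Ioo : MeasurableSet (Ioo 0 t))
        (measure_ne_top _ _) ψ)
  simp only [key] at h1
  have h2 : ∀ m, ∫ s in (0 : ℝ)..t, (hw m).toLp (w m) s = ∫ s in (0 : ℝ)..t, w m s := fun m => by
    rw [intervalIntegral.integral_of_le ht.1, intervalIntegral.integral_of_le ht.1,
      integral_Ioc_eq_integral_Ioo, integral_Ioc_eq_integral_Ioo]
    exact integral_congr_ae
      (ae_restrict_of_ae_restrict_of_subset (Ioo_subset_Ioo_right ht.2) (hw m).coeFn_toLp)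
  simp only [h2] at h1
  exact tendsto_nhds_unique h1 ((hg t ht).inner tendsto_const_nhds)

end WeakLimits

theorem tendsto_intervalIntegral_of_uniform {E ι : Type*} [NormedAddCommGroup E] [NormedSpace ℝ E]
    {l : Filter ι} {f : ι → ℝ → E} {g : ℝ → E} {t : ℝ} (ht : 0 ≤ t)
    (hf : ∀ m, IntervalIntegrable (f m) volume 0 t) (hg : IntervalIntegrable g volume 0 t)
    (h : ∀ ε > 0, ∀ᶠ m in l, ∀ s ∈ Ioc 0 t, ‖f m s - g s‖ ≤ ε) :
    Filter.Tendsto (fun m => ∫ s in (0 : ℝ)..t, f m s) l (nhds (∫ s in (0 : ℝ)..t, g s)) := by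
  rw [Metric.tendsto_nhds]
  intro ε hε
  filter_upwards [h (ε / (t + 1)) (by positivity)] with m hm
  rw [dist_eq_norm, ← intervalIntegral.integral_sub (hf m) hg]
  have h1 := intervalIntegral.norm_integral_le_of_norm_le_const (a := 0) (b := t)
    (f := fun s => f m s - g s) (C := ε / (t + 1)) (by rw [uIoc_of_le ht]; exact hm)
  refine h1.trans_lt ?_
  rw [sub_zero, abs_of_nonneg ht, div_mul_eq_mul_div, div_lt_iff₀ (by positivity)]
  nlinarith

/-- Pointwise convergence of asymptotically equicontinuous functions on `[0,T]` is uniform. -/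
theorem eventually_forall_norm_sub_lt {E : Type*} [NormedAddCommGroup E] {l : Filter ℕ}
    {T R : ℝ} (hR : 0 ≤ R) {τ : ℕ → ℝ} (hτ : Filter.Tendsto τ l (nhds 0))
    {f : ℕ → ℝ → E} {g : ℝ → E}
    (hf : ∀ m, ∀ t ∈ Icc 0 T, ∀ s ∈ Icc 0 T, ‖f m t - f m s‖ ^ 2 ≤ R * (|t - s| + τ m))
    (hg : ∀ t ∈ Icc 0 T, ∀ s ∈ Icc 0 T, ‖g t - g s‖ ^ 2 ≤ R * |t - s|)
    (hl : ∀ t ∈ Icc 0 T, Filter.Tendsto (fun m => f m t) l (nhds (g t))) {ε : ℝ} (hε : 0 < ε) :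
    ∀ᶠ m in l, ∀ t ∈ Icc 0 T, ‖f m t - g t‖ < ε := by
  -- The factor 2 leaves room for both `|t - s| < δ` and `τ m < δ`; `R + 1` avoids division by zero.
  set δ : ℝ := (ε / 3) ^ 2 / (2 * (R + 1)) with hδ
  have hδp : 0 < δ := by positivity
  have hRδ : R * (2 * δ) < (ε / 3) ^ 2 := by
    rw [hδ]
    have : R * (2 * ((ε / 3) ^ 2 / (2 * (R + 1)))) = (ε / 3) ^ 2 * (R / (R + 1)) := by field_simp
    rw [this]
    refine mul_lt_of_lt_one_right (by positivity) ?_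
    rw [div_lt_one (by positivity)]; linarith
  obtain ⟨S, hSs, hSf, hS⟩ := (isCompact_Icc (a := (0 : ℝ)) (b := T)).finite_cover_balls hδp
  have h1 : ∀ᶠ m in l, ∀ s ∈ S, ‖f m s - g s‖ < ε / 3 := by
    rw [Filter.eventually_all_finite hSf]
    intro s hs
    have := (Metric.tendsto_nhds.1 (hl s (hSs hs))) (ε / 3) (by positivity)
    simpa only [dist_eq_norm] using this
  have h2 : ∀ᶠ m in l, τ m < δ := hτ.eventually (gt_mem_nhds hδp)
  filter_upwards [h1, h2] with m hm1 hm2 t ht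
  obtain ⟨s, hs, hts⟩ : ∃ s ∈ S, t ∈ Metric.ball s δ := by simpa using hS ht
  rw [Metric.mem_ball, Real.dist_eq] at hts
  have e1 : ‖f m t - f m s‖ < ε / 3 := by
    refine lt_of_pow_lt_pow_left₀ 2 (by positivity) ((hf m t ht s (hSs hs)).trans_lt ?_)
    refine lt_of_le_of_lt ?_ hRδ
    gcongr; linarith
  have e2 : ‖g s - g t‖ < ε / 3 := by
    refine lt_of_pow_lt_pow_left₀ 2 (by positivity) ((hg s (hSs hs) t ht).trans_lt ?_)
    refine lt_of_le_of_lt ?_ hRδ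
    rw [abs_sub_comm]
    gcongr; linarith
  calc ‖f m t - g t‖ = ‖(f m t - f m s) + (f m s - g s) + (g s - g t)‖ := by abel_nf
    _ ≤ ‖f m t - f m s‖ + ‖f m s - g s‖ + ‖g s - g t‖ := norm_add₃_le
    _ < ε := by linarith [hm1 s hs]

/-! ### Step functions on a uniform time grid -/

section StepFunctions

variable {E : Type*}

/-- The step function with value `a k` on the interval `((k - 1) τ, k τ]`. -/
noncomputable def stepFun (τ : ℝ) (a : ℕ → E) (t : ℝ) : E := a ⌈t / τ⌉₊

theorem exists_grid_interval {τ t : ℝ} (hτ : 0 < τ) {n : ℕ} (ht : t ∈ Ioc 0 (n * τ)) :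
    ∃ j < n, j * τ < t ∧ t ≤ (j + 1) * τ ∧ ⌈t / τ⌉₊ = j + 1 := by
  have h1 : 0 < t / τ := div_pos ht.1 hτ
  have h2 : 0 < ⌈t / τ⌉₊ := Nat.ceil_pos.2 h1
  obtain ⟨j, hj⟩ := Nat.exists_eq_succ_of_ne_zero h2.ne'
  have h3 : ⌈t / τ⌉₊ ≤ n := Nat.ceil_le.2 (by rw [div_le_iff₀ hτ]; exact ht.2)
  refine ⟨j, by omega, ?_, ?_, hj⟩
  · have := Nat.lt_ceil.1 (by omega : j < ⌈t / τ⌉₊)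
    rwa [lt_div_iff₀ hτ] at this
  · have := Nat.le_ceil (t / τ)
    rw [hj, div_le_iff₀ hτ] at this
    push_cast at this; exact this

theorem ceil_div_le {τ t : ℝ} (hτ : 0 < τ) {n : ℕ} (ht : t ≤ n * τ) : ⌈t / τ⌉₊ ≤ n :=
  Nat.ceil_le.2 (by rw [div_le_iff₀ hτ]; exact ht)

theorem stepFun_eq {τ : ℝ} (hτ : 0 < τ) (a : ℕ → E) {j : ℕ} {t : ℝ}
    (ht : t ∈ Ioc (j * τ) ((j + 1) * τ)) : stepFun τ a t = a (j + 1) := by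
  have : ⌈t / τ⌉₊ = j + 1 := by
    rw [Nat.ceil_eq_iff (by omega)]
    constructor
    · rw [lt_div_iff₀ hτ]; simpa using ht.1
    · rw [div_le_iff₀ hτ]; simpa using ht.2
  rw [stepFun, this]

variable [NormedAddCommGroup E]

theorem stronglyMeasurable_stepFun (τ : ℝ) (a : ℕ → E) : StronglyMeasurable (stepFun τ a) := by
  have h1 : StronglyMeasurable a := StronglyMeasurable.of_discrete
  exact h1.comp_measurable (Nat.measurable_ceil.comp (measurable_id.div_const τ))

theorem exists_bound_stepFun {τ : ℝ} (hτ : 0 < τ) (a : ℕ → E) (n : ℕ) :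
    ∃ C, ∀ t ≤ n * τ, ‖stepFun τ a t‖ ≤ C := by
  refine ⟨∑ k ∈ Finset.range (n + 1), ‖a k‖, fun t ht => ?_⟩
  exact Finset.single_le_sum (f := fun k => ‖a k‖) (fun _ _ => norm_nonneg _)
    (Finset.mem_range.2 (Nat.lt_succ_of_le (ceil_div_le hτ ht)))

theorem memLp_stepFun {τ : ℝ} (hτ : 0 < τ) (a : ℕ → E) (n : ℕ) (p : ℝ≥0∞) :
    MemLp (stepFun τ a) p (volume.restrict (Ioo 0 (n * τ))) := by
  obtain ⟨C, hC⟩ := exists_bound_stepFun hτ a n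
  refine MemLp.of_bound (stronglyMeasurable_stepFun τ a).aestronglyMeasurable C ?_
  filter_upwards [ae_restrict_mem measurableSet_Ioo] with t ht using hC t ht.2.le

theorem intervalIntegrable_stepFun {τ : ℝ} (hτ : 0 < τ) (a : ℕ → E) {t : ℝ} (ht : 0 ≤ t) :
    IntervalIntegrable (stepFun τ a) volume 0 t := by
  have h1 : t ≤ ⌈t / τ⌉₊ * τ := by rw [← div_le_iff₀ hτ]; exact Nat.le_ceil _
  refine intervalIntegrable_of_integrableOn_Ioo ht ?_
  exact ((memLp_stepFun hτ a ⌈t / τ⌉₊ 1).integrable le_rfl).mono_measure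
    (Measure.restrict_mono (Ioo_subset_Ioo_right h1) le_rfl)

variable [NormedSpace ℝ E] [CompleteSpace E]

theorem integral_stepFun {τ : ℝ} (hτ : 0 < τ) (a : ℕ → E) {j : ℕ} {t : ℝ}
    (ht : t ∈ Icc (j * τ) ((j + 1) * τ)) :
    ∫ s in (0 : ℝ)..t, stepFun τ a s
      = τ • ∑ i ∈ Finset.range j, a (i + 1) + (t - j * τ) • a (j + 1) := by
  have key : ∀ (i : ℕ) (r : ℝ), r ∈ Icc (i * τ) ((i + 1) * τ) →
      ∫ s in (i * τ)..r, stepFun τ a s = (r - i * τ) • a (i + 1) := by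
    intro i r hr
    rw [← intervalIntegral.integral_const]
    refine intervalIntegral.integral_congr_ae (Filter.Eventually.of_forall fun s hs => ?_)
    rw [uIoc_of_le hr.1] at hs
    exact stepFun_eq hτ a ⟨hs.1, hs.2.trans hr.2⟩
  have hii : ∀ {x y : ℝ}, 0 ≤ x → 0 ≤ y → IntervalIntegrable (stepFun τ a) volume x y :=
    fun hx hy => (intervalIntegrable_stepFun hτ a hx).symm.trans
      (intervalIntegrable_stepFun hτ a hy)
  have hgrid : ∫ s in (0 : ℝ)..(j * τ), stepFun τ a s = τ • ∑ i ∈ Finset.range j, a (i + 1) := by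
    have h1 := intervalIntegral.sum_integral_adjacent_intervals (f := stepFun τ a)
      (a := fun i : ℕ => (i : ℝ) * τ) (n := j) (μ := volume)
      (fun i _ => hii (by positivity) (by positivity))
    simp only [Nat.cast_zero, zero_mul] at h1
    rw [← h1, Finset.smul_sum]
    refine Finset.sum_congr rfl fun i _ => ?_
    rw [key i _ ⟨by push_cast; nlinarith, by push_cast; exact le_rfl⟩]
    congr 1
    push_cast; ring
  have h0 : (0 : ℝ) ≤ j * τ := by positivity
  rw [← intervalIntegral.integral_add_adjacent_intervals (b := j * τ) (hii le_rfl h0)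
    (hii h0 (h0.trans ht.1)), hgrid, key j t ht]

/-- The step function of slopes of `v` is the derivative of `v` up to one increment. -/
theorem norm_integral_slope_sub_le {τ : ℝ} (hτ : 0 < τ) (v : ℕ → E) {n : ℕ} {S : ℝ}
    (hS : ∑ j ∈ Finset.range n, ‖v (j + 1) - v j‖ ^ 2 ≤ S) {t : ℝ} (ht : t ∈ Icc 0 (n * τ)) :
    ‖(∫ s in (0 : ℝ)..t, stepFun τ (fun k => τ⁻¹ • (v k - v (k - 1))) s)
      - (stepFun τ v t - v 0)‖ ≤ Real.sqrt S := by
  rcases ht.1.eq_or_lt with rfl | h0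
  · simp [stepFun, Real.sqrt_nonneg]
  obtain ⟨j, hj, h1, h2, h3⟩ := exists_grid_interval hτ ⟨h0, ht.2⟩
  rw [integral_stepFun hτ _ ⟨h1.le, h2⟩, stepFun_eq hτ v ⟨h1, h2⟩]
  simp only [Nat.add_sub_cancel]
  rw [← Finset.smul_sum, Finset.sum_range_sub, smul_smul, mul_inv_cancel₀ hτ.ne', one_smul,
    smul_smul]
  have h4 : v j - v 0 + ((t - j * τ) * τ⁻¹) • (v (j + 1) - v j) - (v (j + 1) - v 0)
      = ((t - j * τ) * τ⁻¹ - 1) • (v (j + 1) - v j) := by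
    rw [sub_smul, one_smul]; abel
  rw [h4, norm_smul]
  have h5 : ‖(t - j * τ) * τ⁻¹ - 1‖ ≤ 1 := by
    rw [Real.norm_eq_abs, abs_le, ← div_eq_mul_inv]
    have h6 : 0 ≤ (t - j * τ) / τ := div_nonneg (by linarith) hτ.le
    have h7 : (t - j * τ) / τ ≤ 1 := by rw [div_le_one hτ]; linarith
    constructor <;> linarith
  have h6 : ‖v (j + 1) - v j‖ ≤ Real.sqrt S := by
    refine Real.le_sqrt_of_sq_le (le_trans ?_ hS)
    exact Finset.single_le_sum (f := fun j => ‖v (j + 1) - v j‖ ^ 2)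
      (fun _ _ => by positivity) (Finset.mem_range.2 hj)
  calc _ ≤ 1 * ‖v (j + 1) - v j‖ := by gcongr
    _ ≤ _ := by rwa [one_mul]

end StepFunctions

theorem integral_norm_sq_slope_le {E : Type*} [NormedAddCommGroup E] [NormedSpace ℝ E]
    {τ : ℝ} (hτ : 0 < τ) (v : ℕ → E) {n : ℕ} {S : ℝ}
    (hS : ∑ j ∈ Finset.range n, ‖v (j + 1) - v j‖ ^ 2 ≤ S * τ) :
    ∫ s in Ioo 0 (n * τ), ‖stepFun τ (fun k => τ⁻¹ • (v k - v (k - 1))) s‖ ^ 2 ≤ S := by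
  have h1 := integral_stepFun hτ (fun k => ‖τ⁻¹ • (v k - v (k - 1))‖ ^ 2) (j := n) (t := n * τ)
    ⟨le_rfl, by nlinarith⟩
  rw [intervalIntegral.integral_of_le (by positivity), integral_Ioc_eq_integral_Ioo] at h1
  simp only [stepFun, sub_self, zero_mul, add_zero, Nat.add_sub_cancel, norm_smul, mul_pow,
    smul_eq_mul] at h1 ⊢
  rw [h1, ← Finset.mul_sum, norm_inv, Real.norm_eq_abs, abs_of_pos hτ]
  calc τ * (τ⁻¹ ^ 2 * ∑ j ∈ Finset.range n, ‖v (j + 1) - v j‖ ^ 2)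
      ≤ τ * (τ⁻¹ ^ 2 * (S * τ)) := by gcongr
    _ = S := by field_simp

/-! ### The abstract evolution equation -/

/-- The left side of the modulus inequality is a square, which forces the increments of `ρ` to be
nonnegative. -/
theorem monotone_modulus {H : Type*} [NormedAddCommGroup H] {T : ℝ}
    {B : ℝ → H → H} {ρ : ℝ → ℝ}
    (hBt : ∀ s ∈ Icc 0 T, ∀ t ∈ Icc 0 T, s ≤ t → ∀ u,
      ‖B t u - B s u‖ ^ 2 ≤ (t - s) * (ρ t - ρ s)) : MonotoneOn ρ (Icc 0 T) := by
  intro s hs t ht hst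
  rcases hst.eq_or_lt with rfl | hlt
  · exact le_rfl
  have h1 := (sq_nonneg _).trans (hBt s hs t ht hst 0)
  have h2 := nonneg_of_mul_nonneg_right h1 (sub_pos.2 hlt)
  linarith

theorem norm_sub_sq_le_of_modulus {H : Type*} [NormedAddCommGroup H] {T : ℝ}
    {B : ℝ → H → H} {ρ : ℝ → ℝ}
    (hBt : ∀ s ∈ Icc 0 T, ∀ t ∈ Icc 0 T, s ≤ t → ∀ u,
      ‖B t u - B s u‖ ^ 2 ≤ (t - s) * (ρ t - ρ s)) {s t : ℝ} (hs : s ∈ Icc 0 T)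
    (ht : t ∈ Icc 0 T) (u : H) : ‖B t u - B s u‖ ^ 2 ≤ |t - s| * (ρ T - ρ 0) := by
  have hρ := monotone_modulus hBt
  have h0 : (0 : ℝ) ∈ Icc 0 T := ⟨le_rfl, hs.1.trans hs.2⟩
  have hT : T ∈ Icc 0 T := ⟨h0.2, le_rfl⟩
  wlog hst : s ≤ t generalizing s t
  · rw [norm_sub_rev, abs_sub_comm]
    exact this ht hs (le_of_not_ge hst)
  refine (hBt s hs t ht hst u).trans ?_
  rw [abs_of_nonneg (sub_nonneg.2 hst)]
  have h1 := hρ ht hT ht.2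
  have h2 := hρ h0 hs hs.1
  exact mul_le_mul_of_nonneg_left (by linarith) (sub_nonneg.2 hst)

section Evolution

variable {W H : Type*} [NormedAddCommGroup W] [InnerProductSpace ℝ W] [CompleteSpace W]
  [NormedAddCommGroup H] [InnerProductSpace ℝ H] [CompleteSpace H]

/-- Solvability of `d/dt N(J X) + D†(D X + B(t, J X)) = 0`, `X(0) = x₀`, for a strongly monotone
Lipschitz map `N`, a compact embedding `J` and a bounded Lipschitz perturbation `B`. -/
theorem exists_evolution [SecondCountableTopology W] (J D : W →L[ℝ] H)
    (hJc : MapsWeakToStrong J) (hJi : Function.Injective J) {K : ℝ}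
    (hK : ∀ x, ‖x‖ ^ 2 ≤ K * (‖J x‖ ^ 2 + ‖D x‖ ^ 2)) {N : H → H} {c LN : ℝ} (hc : 0 < c)
    (hN : ∀ u v, ‖N u - N v‖ ≤ LN * ‖u - v‖)
    (hmono : ∀ u v, c * ‖u - v‖ ^ 2 ≤ inner ℝ (N u - N v) (u - v)) {T : ℝ} (hT : 0 < T)
    {B : ℝ → H → H} {L M : ℝ} {ρ : ℝ → ℝ}
    (hBL : ∀ t ∈ Icc 0 T, ∀ u v, ‖B t u - B t v‖ ≤ L * ‖u - v‖)
    (hBM : ∀ t ∈ Icc 0 T, ∀ u, ‖B t u‖ ≤ M)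
    (hBt : ∀ s ∈ Icc 0 T, ∀ t ∈ Icc 0 T, s ≤ t → ∀ u,
      ‖B t u - B s u‖ ^ 2 ≤ (t - s) * (ρ t - ρ s)) (x₀ : W) :
    ∃ (X : ℝ → W) (w z : ℝ → H) (R : ℝ), X 0 = x₀ ∧ (∀ t ∈ Icc 0 T, ‖X t‖ ≤ R) ∧
      AEStronglyMeasurable X (volume.restrict (Ioo 0 T)) ∧
      ContinuousOn (fun t => J (X t)) (Icc 0 T) ∧
      MemLp w 2 (volume.restrict (Ioo 0 T)) ∧ MemLp z 2 (volume.restrict (Ioo 0 T)) ∧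
      (∀ t ∈ Icc 0 T, J (X t) = J x₀ + ∫ s in (0 : ℝ)..t, w s) ∧
      (∀ t ∈ Icc 0 T, N (J (X t)) = N (J x₀) + ∫ s in (0 : ℝ)..t, z s) ∧
      ∀ᵐ t ∂volume.restrict (Ioo 0 T), ∀ φ,
        inner ℝ (z t) (J φ) + inner ℝ (D (X t) + B t (J (X t))) (D φ) = 0 := by
  obtain ⟨R, n₀, hR0, hscheme⟩ := exists_implicit_scheme J D hK hc hN hmono hT hBL hBM hBt x₀
  choose x hx0 hxR hxS hxeq using fun m : ℕ => hscheme (n₀ + 1 + m) (by omega)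
  set n : ℕ → ℕ := fun m => n₀ + 1 + m with hn
  set τ : ℕ → ℝ := fun m => T / n m with hτdef
  have hnp : ∀ m, (0 : ℝ) < n m := fun m => by
    simp only [hn]; exact_mod_cast (by omega : 0 < n₀ + 1 + m)
  have hτp : ∀ m, 0 < τ m := fun m => div_pos hT (hnp m)
  have hnτ : ∀ m, (n m : ℝ) * τ m = T := fun m => by
    simp only [hτdef]; exact mul_div_cancel₀ T (hnp m).ne'
  have hτ0 : Filter.Tendsto τ Filter.atTop (nhds 0) := by
    have h1 : Filter.Tendsto n Filter.atTop Filter.atTop :=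
      Filter.tendsto_atTop_mono (fun m => (by simp only [hn]; omega : m ≤ n m)) Filter.tendsto_id
    exact tendsto_const_nhds.div_atTop (tendsto_natCast_atTop_atTop.comp h1)
  -- One ultrafilter replaces the choice of subsequences: bounded sequences converge weakly along it
  -- at all times at once, with no diagonal argument.
  let U : Ultrafilter ℕ := Filter.hyperfilter ℕ
  have hU : (U : Filter ℕ) ≤ Filter.atTop := Nat.hyperfilter_le_atTop
  have hτU : Filter.Tendsto τ U (nhds 0) := hτ0.mono_left hU
  set Xm : ℕ → ℝ → W := fun m => stepFun (τ m) (x m) with hXm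
  set v : ℕ → ℕ → H := fun m k => J (x m k) with hv
  have hvX : ∀ m t, stepFun (τ m) (v m) t = J (Xm m t) := fun _ _ => rfl
  have hIcc : ∀ m {t}, t ∈ Icc 0 T → t ∈ Icc 0 ((n m : ℝ) * τ m) := fun m t ht => by rwa [hnτ]
  have hXR : ∀ m, ∀ t ∈ Icc 0 T, ‖Xm m t‖ ≤ R := fun m t ht =>
    hxR m _ (ceil_div_le (hτp m) (hIcc m ht).2)
  have hweak : ∀ t, ∃ y : W, t ∈ Icc 0 T → ‖y‖ ≤ R ∧
      ∀ ψ, Filter.Tendsto (fun m => inner ℝ (Xm m t) ψ) U (nhds (inner ℝ y ψ)) := by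
    intro t
    by_cases ht : t ∈ Icc 0 T
    · obtain ⟨y, hy⟩ := exists_weak_limit_ultrafilter (fun m => hXR m t ht) U
      exact ⟨y, fun _ => hy⟩
    · exact ⟨0, fun h => absurd h ht⟩
  choose X hX using hweak
  have hXbd : ∀ t ∈ Icc 0 T, ‖X t‖ ≤ R := fun t ht => (hX t ht).1
  have hstrong : ∀ t ∈ Icc 0 T, Filter.Tendsto (fun m => J (Xm m t)) U (nhds (J (X t))) :=
    fun t ht => hJc U _ R _ (fun m => hXR m t ht) (hX t ht).2
  have h0mem : (0 : ℝ) ∈ Icc 0 T := ⟨le_rfl, hT.le⟩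
  have hX0 : X 0 = x₀ := by
    refine ext_inner_right ℝ fun ψ => ?_
    have h1 := (hX 0 h0mem).2 ψ
    have h2 : ∀ m, Xm m 0 = x₀ := fun m => by simp [hXm, stepFun, hx0]
    simp only [h2] at h1
    exact tendsto_nhds_unique h1 tendsto_const_nhds
  -- The squared distance is at most `R τ` times the number of grid steps between `s` and `t`;
  -- rounding up costs at most one further step, hence the extra `τ m`.
  have hequi : ∀ m, ∀ t ∈ Icc 0 T, ∀ s ∈ Icc 0 T,
      ‖J (Xm m t) - J (Xm m s)‖ ^ 2 ≤ R * (|t - s| + τ m) := by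
    intro m t ht s hs
    wlog hst : s ≤ t generalizing s t
    · rw [norm_sub_rev, abs_sub_comm]
      exact this s hs t ht (le_of_not_ge hst)
    have hkl : ⌈s / τ m⌉₊ ≤ ⌈t / τ m⌉₊ :=
      Nat.ceil_le_ceil ((div_le_div_iff_of_pos_right (hτp m)).2 hst)
    have h1 := norm_sub_sq_le_of_sum_sq (v := v m) hkl
      (ceil_div_le (hτp m) (hIcc m ht).2) (hxS m)
    refine h1.trans ?_
    have h2 : ((⌈t / τ m⌉₊ : ℝ) - ⌈s / τ m⌉₊) * τ m ≤ |t - s| + τ m := by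
      have h3 := Nat.le_ceil (s / τ m)
      have h4 := (Nat.ceil_lt_add_one (div_nonneg ht.1 (hτp m).le)).le
      rw [div_le_iff₀ (hτp m)] at h3
      have h5 : (⌈t / τ m⌉₊ : ℝ) * τ m ≤ t + τ m := by
        calc _ ≤ (t / τ m + 1) * τ m := by gcongr
          _ = _ := by rw [add_mul, div_mul_cancel₀ _ (hτp m).ne', one_mul]
      rw [abs_of_nonneg (sub_nonneg.2 hst), sub_mul]
      linarith
    calc _ = R * (((⌈t / τ m⌉₊ : ℝ) - ⌈s / τ m⌉₊) * τ m) := by ring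
      _ ≤ _ := by gcongr
  have hequiX : ∀ t ∈ Icc 0 T, ∀ s ∈ Icc 0 T, ‖J (X t) - J (X s)‖ ^ 2 ≤ R * |t - s| := by
    intro t ht s hs
    have h1 := (((hstrong t ht).sub (hstrong s hs)).norm).pow 2
    have h2 : Filter.Tendsto (fun m => R * (|t - s| + τ m)) U (nhds (R * (|t - s| + 0))) :=
      (tendsto_const_nhds.add hτU).const_mul R
    rw [add_zero] at h2
    exact le_of_tendsto_of_tendsto' h1 h2 fun m => hequi m t ht s hs
  have hunif : ∀ ε > 0, ∀ᶠ m in (U : Filter ℕ), ∀ t ∈ Icc 0 T, ‖J (Xm m t) - J (X t)‖ < ε :=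
    fun ε hε => eventually_forall_norm_sub_lt hR0 hτU hequi hequiX hstrong hε
  -- continuity in time
  have hsq0 : ∀ {A : ℝ} {t : ℝ}, Filter.Tendsto (fun s => Real.sqrt (A * |s - t|))
      (nhdsWithin t (Icc 0 T)) (nhds 0) := by
    intro A t
    have : Continuous fun s => Real.sqrt (A * |s - t|) := by fun_prop
    have h1 := this.tendsto t
    simp only [sub_self, abs_zero, mul_zero, Real.sqrt_zero] at h1
    exact h1.mono_left nhdsWithin_le_nhds
  have hcont : ContinuousOn (fun t => J (X t)) (Icc 0 T) := by
    intro t ht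
    rw [ContinuousWithinAt, tendsto_iff_norm_sub_tendsto_zero]
    refine squeeze_zero' (Filter.Eventually.of_forall fun _ => norm_nonneg _) ?_ (hsq0 (A := R))
    filter_upwards [self_mem_nhdsWithin] with s hs
    exact Real.le_sqrt_of_sq_le (hequiX s hs t ht)
  have hBcont : ContinuousOn (fun t => B t (J (X t))) (Icc 0 T) := by
    intro t ht
    rw [ContinuousWithinAt, tendsto_iff_norm_sub_tendsto_zero]
    have h1 : Filter.Tendsto (fun s => L * ‖J (X s) - J (X t)‖
        + Real.sqrt ((ρ T - ρ 0) * |s - t|)) (nhdsWithin t (Icc 0 T)) (nhds 0) := by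
      have h2 := (tendsto_iff_norm_sub_tendsto_zero.1 (hcont t ht)).const_mul L
      simpa using h2.add (hsq0 (A := ρ T - ρ 0) (t := t))
    refine squeeze_zero' (Filter.Eventually.of_forall fun _ => norm_nonneg _) ?_ h1
    filter_upwards [self_mem_nhdsWithin] with s hs
    calc ‖B s (J (X s)) - B t (J (X t))‖
        = ‖(B s (J (X s)) - B s (J (X t))) + (B s (J (X t)) - B t (J (X t)))‖ := by
          rw [sub_add_sub_cancel]
      _ ≤ _ := (norm_add_le _ _).trans (add_le_add (hBL s hs _ _) (Real.le_sqrt_of_sq_le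
          ((norm_sub_sq_le_of_modulus hBt ht hs _).trans_eq (mul_comm _ _))))
  -- measurability
  have hXmeas : AEStronglyMeasurable X (volume.restrict (Ioo 0 T)) := by
    borelize W
    borelize H
    -- Lusin–Souslin: a continuous injection of a Polish space is a measurable embedding, so `X`
    -- inherits measurability from the continuous curve `J X`.
    have hemb : MeasurableEmbedding J := J.continuous.measurableEmbedding hJi
    have h1 : AEMeasurable (fun t => J (X t)) (volume.restrict (Ioo 0 T)) :=
      (hcont.mono Ioo_subset_Icc_self).aemeasurable measurableSet_Ioo
    exact (hemb.aemeasurable_comp_iff.1 h1).aestronglyMeasurable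
  have hXint : ∀ t ∈ Icc 0 T, IntervalIntegrable X volume 0 t := by
    intro t ht
    refine intervalIntegrable_of_integrableOn_Ioo ht.1 ?_
    refine IntegrableOn.mono_set (t := Ioo 0 T) ?_ (Ioo_subset_Ioo_right ht.2)
    refine (MemLp.of_bound (p := 1) hXmeas R ?_).integrable le_rfl
    filter_upwards [ae_restrict_mem measurableSet_Ioo] with s hs
    exact hXbd s (Ioo_subset_Icc_self hs)
  have hcontint : ∀ {f : ℝ → H}, ContinuousOn f (Icc 0 T) → ∀ t ∈ Icc 0 T,
      IntervalIntegrable f volume 0 t := fun hf t ht => by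
    refine ContinuousOn.intervalIntegrable (hf.mono ?_)
    rw [uIcc_of_le ht.1]; exact Icc_subset_Icc_right ht.2
  have hsqτ : ∀ A : ℝ, Filter.Tendsto (fun m => Real.sqrt (A * τ m)) U (nhds 0) := fun A => by
    have h1 := ((hτU.const_mul A).sqrt)
    simpa using h1
  -- time derivatives
  have hderiv : ∀ (a : ℕ → ℕ → H) (g : ℝ → H) (S : ℝ),
      (∀ m, ∑ k ∈ Finset.range (n m), ‖a m (k + 1) - a m k‖ ^ 2 ≤ S * τ m) →
      (∀ t ∈ Icc 0 T, Filter.Tendsto (fun m => stepFun (τ m) (a m) t - a m 0) U (nhds (g t))) →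
      (∀ t ∈ Icc 0 T, Filter.Tendsto (fun m => ∫ s in (0 : ℝ)..t,
        stepFun (τ m) (fun k => (τ m)⁻¹ • (a m k - a m (k - 1))) s) U (nhds (g t))) ∧
      ∃ w : ℝ → H, MemLp w 2 (volume.restrict (Ioo 0 T)) ∧
        ∀ t ∈ Icc 0 T, ∫ s in (0 : ℝ)..t, w s = g t := by
    intro a g S hS hg
    have h1 : ∀ t ∈ Icc 0 T, Filter.Tendsto (fun m => ∫ s in (0 : ℝ)..t,
        stepFun (τ m) (fun k => (τ m)⁻¹ • (a m k - a m (k - 1))) s) U (nhds (g t)) := by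
      intro t ht
      have h2 : Filter.Tendsto (fun m => (∫ s in (0 : ℝ)..t,
          stepFun (τ m) (fun k => (τ m)⁻¹ • (a m k - a m (k - 1))) s)
          - (stepFun (τ m) (a m) t - a m 0)) U (nhds 0) :=
        squeeze_zero_norm (fun m => norm_integral_slope_sub_le (hτp m) (a m) (hS m) (hIcc m ht))
          (hsqτ S)
      simpa using h2.add (hg t ht)
    refine ⟨h1, exists_memLp_integral_eq_of_tendsto (R := S) (fun m => ?_) (fun m => ?_) h1⟩
    · have := memLp_stepFun (hτp m) (fun k => (τ m)⁻¹ • (a m k - a m (k - 1))) (n m) 2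
      rwa [hnτ] at this
    · have := integral_norm_sq_slope_le (hτp m) (a m) (hS m)
      rwa [hnτ] at this
  obtain ⟨-, w, hw, hwX⟩ := hderiv v (fun t => J (X t) - J x₀) R hxS (fun t ht => by
    simp only [hv, hx0]
    exact (hstrong t ht).sub tendsto_const_nhds)
  have hNcont : Continuous N :=
    (LipschitzWith.of_dist_le_mul (K := ⟨|LN|, abs_nonneg _⟩) fun u v => by
      rw [dist_eq_norm, dist_eq_norm]
      exact (hN u v).trans
        (mul_le_mul_of_nonneg_right (le_abs_self LN) (norm_nonneg _))).continuous
  obtain ⟨hztend, z, hz, hzX⟩ := hderiv (fun m k => N (v m k))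
    (fun t => N (J (X t)) - N (J x₀)) (LN ^ 2 * R) (fun m => by
      calc _ ≤ ∑ k ∈ Finset.range (n m), LN ^ 2 * ‖v m (k + 1) - v m k‖ ^ 2 := by
            refine Finset.sum_le_sum fun k _ => ?_
            rw [← mul_pow]
            exact pow_le_pow_left₀ (norm_nonneg _) (hN _ _) 2
        _ ≤ LN ^ 2 * (R * τ m) := by
            rw [← Finset.mul_sum]
            exact mul_le_mul_of_nonneg_left (hxS m) (sq_nonneg _)
        _ = _ := by ring) (fun t ht => by
      have h1 := ((hNcont.tendsto _).comp (hstrong t ht)).sub_const (N (J x₀))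
      refine h1.congr fun m => ?_
      simp only [hv, hx0]; rfl)
  -- the integrated equation of the scheme
  set Bm : ℕ → ℝ → H := fun m =>
    stepFun (τ m) (fun k => B ((k - 1 : ℕ) * τ m) (v m (k - 1))) with hBm
  set Zm : ℕ → ℝ → H := fun m =>
    stepFun (τ m) (fun k => (τ m)⁻¹ • (N (v m k) - N (v m (k - 1)))) with hZm
  have hscheq : ∀ m, ∀ t ∈ Ioc 0 T,
      J.adjoint (Zm m t) + D.adjoint (D (Xm m t) + Bm m t) = 0 := by
    intro m t ht
    obtain ⟨j, hj, h1, h2, -⟩ := exists_grid_interval (hτp m) (n := n m) (by rwa [hnτ])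
    have ht' : t ∈ Ioc (j * τ m) ((j + 1) * τ m) := ⟨h1, h2⟩
    simp only [hZm, hBm, hXm, stepFun_eq (hτp m) _ ht', Nat.add_sub_cancel]
    have h3 := congrArg (fun y => (τ m)⁻¹ • y) (hxeq m j hj)
    simp only [smul_add, smul_zero] at h3
    rw [← map_smul, smul_smul, inv_mul_cancel₀ (hτp m).ne', one_smul] at h3
    exact h3
  -- The scheme is integrated in time because the slopes `Zm` are controlled in the limit only
  -- through their primitives.
  have hint : ∀ m (φ : W), ∀ t ∈ Icc 0 T,
      inner ℝ (∫ s in (0 : ℝ)..t, Zm m s) (J φ) + (inner ℝ (∫ s in (0 : ℝ)..t, Xm m s)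
        (D.adjoint (D φ)) + inner ℝ (∫ s in (0 : ℝ)..t, Bm m s) (D φ)) = 0 := by
    intro m φ t ht
    have iZ : IntervalIntegrable (Zm m) volume 0 t := intervalIntegrable_stepFun (hτp m) _ ht.1
    have iX : IntervalIntegrable (Xm m) volume 0 t := intervalIntegrable_stepFun (hτp m) _ ht.1
    have iB : IntervalIntegrable (Bm m) volume 0 t := intervalIntegrable_stepFun (hτp m) _ ht.1
    have e1 := (J.adjoint).intervalIntegral_comp_comm iZ
    have e2 := (D.adjoint ∘L D).intervalIntegral_comp_comm iX
    have e3 := (D.adjoint).intervalIntegral_comp_comm iB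
    have i1 : IntervalIntegrable (fun s => J.adjoint (Zm m s)) volume 0 t :=
      ⟨J.adjoint.integrable_comp iZ.1, J.adjoint.integrable_comp iZ.2⟩
    have i2 : IntervalIntegrable (fun s => (D.adjoint ∘L D) (Xm m s)) volume 0 t :=
      ⟨(D.adjoint ∘L D).integrable_comp iX.1, (D.adjoint ∘L D).integrable_comp iX.2⟩
    have i3 : IntervalIntegrable (fun s => D.adjoint (Bm m s)) volume 0 t :=
      ⟨D.adjoint.integrable_comp iB.1, D.adjoint.integrable_comp iB.2⟩
    have e4 : ∫ s in (0 : ℝ)..t, (J.adjoint (Zm m s) + ((D.adjoint ∘L D) (Xm m s)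
        + D.adjoint (Bm m s))) = 0 := by
      rw [intervalIntegral.integral_of_le ht.1]
      refine setIntegral_eq_zero_of_forall_eq_zero fun s hs => ?_
      rw [← hscheq m s ⟨hs.1, hs.2.trans ht.2⟩, map_add]; rfl
    rw [intervalIntegral.integral_add i1 (i2.add i3), intervalIntegral.integral_add i2 i3, e1, e2,
      e3] at e4
    have e5 := congrArg (fun y => inner ℝ y φ) e4
    simpa only [inner_add_left, ContinuousLinearMap.adjoint_inner_left, inner_zero_left,
      ContinuousLinearMap.comp_apply, ContinuousLinearMap.adjoint_inner_right] using e5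
  -- passage to the limit
  have hBtend : ∀ t ∈ Icc 0 T, Filter.Tendsto (fun m => ∫ s in (0 : ℝ)..t, Bm m s) U
      (nhds (∫ s in (0 : ℝ)..t, B s (J (X s)))) := by
    intro t ht
    refine tendsto_intervalIntegral_of_uniform ht.1
      (fun m => intervalIntegrable_stepFun (hτp m) _ ht.1) (hcontint hBcont t ht) fun ε hε => ?_
    have hL1 : 0 < |L| + 1 := by positivity
    have h1 := hunif (ε / (3 * (|L| + 1))) (by positivity)
    have h2 : ∀ᶠ m in (U : Filter ℕ), Real.sqrt (R * τ m) < ε / (3 * (|L| + 1)) :=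
      (hsqτ R).eventually (gt_mem_nhds (by positivity))
    have h3 : ∀ᶠ m in (U : Filter ℕ), Real.sqrt ((ρ T - ρ 0) * τ m) < ε / 3 :=
      (hsqτ _).eventually (gt_mem_nhds (by positivity))
    filter_upwards [h1, h2, h3] with m g1 g2 g3 s hs
    have hsI : s ∈ Ioc 0 T := ⟨hs.1, hs.2.trans ht.2⟩
    obtain ⟨j, hj, l1, l2, -⟩ := exists_grid_interval (hτp m) (n := n m) (by rwa [hnτ])
    have hs' : s ∈ Ioc (j * τ m) ((j + 1) * τ m) := ⟨l1, l2⟩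
    have hjI : (j : ℝ) * τ m ∈ Icc 0 T :=
      ⟨mul_nonneg (Nat.cast_nonneg _) (hτp m).le, by linarith [hsI.2]⟩
    have hsIcc : s ∈ Icc 0 T := Ioc_subset_Icc_self hsI
    simp only [hBm, stepFun_eq (hτp m) _ hs', Nat.add_sub_cancel]
    have k1 := g1 s hsIcc
    rw [← hvX, stepFun_eq (hτp m) _ hs'] at k1
    have k2 : ‖v m j - v m (j + 1)‖ ≤ Real.sqrt (R * τ m) := by
      rw [norm_sub_rev]
      refine Real.le_sqrt_of_sq_le (le_trans ?_ (hxS m))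
      exact Finset.single_le_sum (f := fun j => ‖v m (j + 1) - v m j‖ ^ 2)
        (fun _ _ => by positivity) (Finset.mem_range.2 hj)
    have k3 : ‖v m j - J (X s)‖ ≤ 2 * (ε / (3 * (|L| + 1))) := by
      calc _ = ‖(v m j - v m (j + 1)) + (v m (j + 1) - J (X s))‖ := by rw [sub_add_sub_cancel]
        _ ≤ _ := (norm_add_le _ _).trans (by linarith)
    have k4 : ‖B (j * τ m) (J (X s)) - B s (J (X s))‖ ≤ Real.sqrt ((ρ T - ρ 0) * τ m) := by
      rw [norm_sub_rev]
      refine Real.le_sqrt_of_sq_le ((norm_sub_sq_le_of_modulus hBt hjI hsIcc _).trans ?_)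
      rw [mul_comm]
      have hρ0 : 0 ≤ ρ T - ρ 0 :=
        sub_nonneg.2 (monotone_modulus hBt h0mem ⟨hT.le, le_rfl⟩ hT.le)
      refine mul_le_mul_of_nonneg_left ?_ hρ0
      rw [abs_of_nonneg (by linarith)]; linarith
    calc ‖B (j * τ m) (v m j) - B s (J (X s))‖
        = ‖(B (j * τ m) (v m j) - B (j * τ m) (J (X s)))
          + (B (j * τ m) (J (X s)) - B s (J (X s)))‖ := by rw [sub_add_sub_cancel]
      _ ≤ (|L| + 1) * (2 * (ε / (3 * (|L| + 1)))) + ε / 3 := by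
          refine (norm_add_le _ _).trans (add_le_add ((hBL _ hjI _ _).trans ?_) (k4.trans g3.le))
          exact mul_le_mul (by linarith [le_abs_self L]) k3 (norm_nonneg _) hL1.le
      _ = ε := by field_simp; ring
  have hXtend : ∀ t ∈ Icc 0 T, ∀ ψ, Filter.Tendsto
      (fun m => inner ℝ (∫ s in (0 : ℝ)..t, Xm m s) ψ) U
      (nhds (inner ℝ (∫ s in (0 : ℝ)..t, X s) ψ)) := by
    intro t ht
    have hbd : ∀ m, ‖∫ s in (0 : ℝ)..t, Xm m s‖ ≤ R * T := fun m => by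
      have h1 := intervalIntegral.norm_integral_le_of_norm_le_const (a := 0) (b := t) (f := Xm m)
        (C := R) (by
          rw [uIoc_of_le ht.1]
          exact fun s hs => hXR m s ⟨hs.1.le, hs.2.trans ht.2⟩)
      rw [sub_zero, abs_of_nonneg ht.1] at h1
      exact h1.trans (mul_le_mul_of_nonneg_left ht.2 hR0)
    obtain ⟨Y, -, hY⟩ := exists_weak_limit_ultrafilter hbd U
    -- The weak limit `Y` of the time integrals is identified after applying `J`, where uniform
    -- convergence is available; injectivity of `J` then gives `Y = ∫ X`.
    have h1 := hJc U _ _ _ hbd hY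
    have h2 : Filter.Tendsto (fun m => J (∫ s in (0 : ℝ)..t, Xm m s)) U
        (nhds (J (∫ s in (0 : ℝ)..t, X s))) := by
      rw [← J.intervalIntegral_comp_comm (hXint t ht)]
      have h3 : ∀ m, J (∫ s in (0 : ℝ)..t, Xm m s) = ∫ s in (0 : ℝ)..t, J (Xm m s) := fun m =>
        (J.intervalIntegral_comp_comm (intervalIntegrable_stepFun (hτp m) _ ht.1)).symm
      simp only [h3]
      refine tendsto_intervalIntegral_of_uniform ht.1
        (fun m => intervalIntegrable_stepFun (hτp m) (v m) ht.1) (hcontint hcont t ht)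
        fun ε hε => ?_
      filter_upwards [hunif ε hε] with m hm s hs
      exact (hm s ⟨hs.1.le, hs.2.trans ht.2⟩).le
    rwa [hJi (tendsto_nhds_unique h1 h2)] at hY
  have hlim : ∀ (φ : W), ∀ t ∈ Icc 0 T,
      inner ℝ (∫ s in (0 : ℝ)..t, z s) (J φ) + (inner ℝ (∫ s in (0 : ℝ)..t, X s)
        (D.adjoint (D φ)) + inner ℝ (∫ s in (0 : ℝ)..t, B s (J (X s))) (D φ)) = 0 := by
    intro φ t ht
    have h1 := ((hztend t ht).inner (tendsto_const_nhds (x := J φ))).add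
      ((hXtend t ht (D.adjoint (D φ))).add ((hBtend t ht).inner (tendsto_const_nhds (x := D φ))))
    rw [hzX t ht]
    refine tendsto_nhds_unique h1 ?_
    refine tendsto_const_nhds.congr fun m => ?_
    exact (hint m φ t ht).symm
  refine ⟨X, w, z, R, hX0, hXbd, hXmeas, hcont, hw, hz, fun t ht => ?_, fun t ht => ?_, ?_⟩
  · rw [hwX t ht]; abel
  · rw [hzX t ht]; abel
  have hzint : ∀ t ∈ Icc 0 T, IntervalIntegrable z volume 0 t := fun t ht => by
    refine intervalIntegrable_of_integrableOn_Ioo ht.1 ?_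
    exact IntegrableOn.mono_set (t := Ioo 0 T) (hz.integrable (by norm_num))
      (Ioo_subset_Ioo_right ht.2)
  have hTm : T ∈ Icc 0 T := ⟨hT.le, le_rfl⟩
  have hTi : ∀ t ∈ Icc 0 T,
      IntervalIntegrable (fun s => J.adjoint (z s)) volume 0 t ∧
      IntervalIntegrable (fun s => (D.adjoint ∘L D) (X s)) volume 0 t ∧
      IntervalIntegrable (fun s => D.adjoint (B s (J (X s)))) volume 0 t := fun t ht =>
    ⟨⟨J.adjoint.integrable_comp (hzint t ht).1, J.adjoint.integrable_comp (hzint t ht).2⟩,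
      ⟨(D.adjoint ∘L D).integrable_comp (hXint t ht).1,
        (D.adjoint ∘L D).integrable_comp (hXint t ht).2⟩,
      ⟨D.adjoint.integrable_comp (hcontint hBcont t ht).1,
        D.adjoint.integrable_comp (hcontint hBcont t ht).2⟩⟩
  -- Working with the `W`-valued integrand, rather than with each `φ` separately, yields one null
  -- set valid for all `φ`.
  have hae := ae_eq_zero_of_forall_intervalIntegral_eq_zero hT.le
    (f := fun s => J.adjoint (z s) + ((D.adjoint ∘L D) (X s) + D.adjoint (B s (J (X s))))) ?_ ?_
  · filter_upwards [hae] with t ht φ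
    have e5 := congrArg (fun y => inner ℝ y φ) ht
    simpa only [inner_add_left, ContinuousLinearMap.adjoint_inner_left, inner_zero_left,
      ContinuousLinearMap.comp_apply] using e5
  · obtain ⟨i1, i2, i3⟩ := hTi T hTm
    exact (intervalIntegrable_iff_integrableOn_Ioo_of_le hT.le).1 (i1.add (i2.add i3))
  · intro t ht'
    have ht := Ioo_subset_Icc_self ht'
    obtain ⟨i1, i2, i3⟩ := hTi t ht
    rw [intervalIntegral.integral_add i1 (i2.add i3), intervalIntegral.integral_add i2 i3,
      (J.adjoint).intervalIntegral_comp_comm (hzint t ht),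
      (D.adjoint ∘L D).intervalIntegral_comp_comm (hXint t ht),
      (D.adjoint).intervalIntegral_comp_comm (hcontint hBcont t ht)]
    refine ext_inner_right ℝ fun φ => ?_
    simpa only [inner_add_left, ContinuousLinearMap.adjoint_inner_left, inner_zero_left,
      ContinuousLinearMap.comp_apply, ContinuousLinearMap.adjoint_inner_right] using hlim φ t ht

end Evolution

/-! ### The Volterra operator and the Sobolev space `H¹(0,1)` -/

section Volterra

theorem integrable_L2Unit (w : L2Unit) : IntegrableOn w (Ioo (0 : ℝ) 1) :=
  (Lp.memLp w).integrable (by norm_num)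

theorem intervalIntegrable_L2Unit (w : L2Unit) {x y : ℝ} (hx : x ∈ Icc (0 : ℝ) 1)
    (hy : y ∈ Icc (0 : ℝ) 1) : IntervalIntegrable w volume x y :=
  (intervalIntegrable_of_integrableOn_Ioo zero_le_one (integrable_L2Unit w)).mono_set
    (by rw [uIcc_of_le zero_le_one]; exact uIcc_subset_Icc hx hy)

theorem intervalIntegral_congr_L2Unit {u w : ℝ → ℝ}
    (h : ∀ᵐ s ∂volume.restrict (Ioo (0 : ℝ) 1), u s = w s) {x y : ℝ} (hx : x ∈ Icc (0 : ℝ) 1)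
    (hy : y ∈ Icc (0 : ℝ) 1) : ∫ s in x..y, u s = ∫ s in x..y, w s := by
  refine intervalIntegral.integral_congr_ae_restrict ?_
  refine ae_restrict_of_ae_restrict_of_subset (t := Icc 0 1)
    (uIoc_subset_uIcc.trans (uIcc_subset_Icc hx hy)) ?_
  rwa [Measure.restrict_congr_set Ioo_ae_eq_Icc] at h

theorem integral_eq_inner_indicator (w : L2Unit) {x y : ℝ} (hx : 0 ≤ x) (hxy : x ≤ y)
    (hy : y ≤ 1) : ∫ s in x..y, w s = inner ℝ (indicatorConstLp 2
      (measurableSet_Ioo : MeasurableSet (Ioo x y)) (measure_ne_top _ _) (1 : ℝ) : L2Unit) w := by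
  rw [L2.inner_indicatorConstLp_one, Measure.restrict_restrict measurableSet_Ioo,
    inter_eq_left.2 (Ioo_subset_Ioo hx hy), intervalIntegral.integral_of_le hxy,
    integral_Ioc_eq_integral_Ioo]

/-- Cauchy–Schwarz against the indicator of the interval. It makes primitives of `L²` functions
1/2-Hölder. -/
theorem abs_integral_L2Unit_sq_le (w : L2Unit) {x y : ℝ} (hx : x ∈ Icc (0 : ℝ) 1)
    (hy : y ∈ Icc (0 : ℝ) 1) : |∫ s in x..y, w s| ^ 2 ≤ ‖w‖ ^ 2 * |y - x| := by
  wlog hxy : x ≤ y generalizing x y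
  · rw [intervalIntegral.integral_symm, abs_neg, abs_sub_comm]
    exact this hy hx (le_of_not_ge hxy)
  rw [integral_eq_inner_indicator w hx.1 hxy hy.2, abs_of_nonneg (sub_nonneg.2 hxy)]
  have h1 := abs_real_inner_le_norm (indicatorConstLp 2
      (measurableSet_Ioo : MeasurableSet (Ioo x y)) (measure_ne_top _ _) (1 : ℝ) : L2Unit) w
  have h2 : ‖(indicatorConstLp 2 (measurableSet_Ioo : MeasurableSet (Ioo x y))
      (measure_ne_top (volume.restrict (Ioo (0 : ℝ) 1)) _) (1 : ℝ) : L2Unit)‖ ^ 2 = y - x := by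
    rw [norm_indicatorConstLp (by norm_num) (by norm_num), norm_one, one_mul, measureReal_def,
      Measure.restrict_apply measurableSet_Ioo, inter_eq_left.2 (Ioo_subset_Ioo hx.1 hy.2),
      Real.volume_Ioo, ENNReal.toReal_ofReal (sub_nonneg.2 hxy), ENNReal.toReal_ofNat,
      ← Real.sqrt_eq_rpow, Real.sq_sqrt (sub_nonneg.2 hxy)]
  calc _ ≤ (_ * ‖w‖) ^ 2 := pow_le_pow_left₀ (abs_nonneg _) h1 2
    _ = _ := by rw [mul_pow, h2, mul_comm]

theorem continuousOn_integral_L2Unit (w : L2Unit) :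
    ContinuousOn (fun x => ∫ s in (0 : ℝ)..x, w s) (Icc 0 1) := by
  have h1 := (intervalIntegrable_L2Unit w (x := 0) (y := 1) (by simp)
    (by simp)).absolutelyContinuousOnInterval_integral.continuousOn
  rwa [uIcc_of_le zero_le_one] at h1

theorem memLp_of_continuousOn {g : ℝ → ℝ} (hg : ContinuousOn g (Icc 0 1)) :
    MemLp g 2 (volume.restrict (Ioo (0 : ℝ) 1)) := by
  obtain ⟨C, hC⟩ := isCompact_Icc.exists_bound_of_continuousOn hg
  refine MemLp.of_bound
    ((hg.mono Ioo_subset_Icc_self).aestronglyMeasurable measurableSet_Ioo) C ?_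
  filter_upwards [ae_restrict_mem measurableSet_Ioo] with x hx using hC x (Ioo_subset_Icc_self hx)

theorem norm_L2Unit_le {u : L2Unit} {C : ℝ} (hC : 0 ≤ C)
    (h : ∀ᵐ x ∂volume.restrict (Ioo (0 : ℝ) 1), |u x| ≤ C) : ‖u‖ ≤ C := by
  have h1 := Lp.norm_le_of_ae_bound (f := u) hC h
  have h2 : measureUnivNNReal (volume.restrict (Ioo (0 : ℝ) 1)) = 1 := by
    rw [measureUnivNNReal, Measure.restrict_apply_univ, Real.volume_Ioo]; simp
  rwa [h2, NNReal.coe_one, Real.one_rpow, one_mul] at h1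

/-- The constant function `1`. -/
noncomputable def oneL2 : L2Unit := Lp.const 2 _ (1 : ℝ)

theorem oneL2_ae : ∀ᵐ x ∂volume.restrict (Ioo (0 : ℝ) 1), oneL2 x = 1 :=
  Lp.coeFn_const 2 _ (1 : ℝ)

/-- The Volterra operator `(V w)(x) = ∫₀ˣ w` on `L²(0,1)`. -/
noncomputable def volterra : L2Unit →L[ℝ] L2Unit :=
  LinearMap.mkContinuous
    { toFun := fun w => (memLp_of_continuousOn (continuousOn_integral_L2Unit w)).toLp _
      map_add' := fun u w => by
        rw [← MemLp.toLp_add, MemLp.toLp_eq_toLp_iff]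
        filter_upwards [ae_restrict_mem measurableSet_Ioo] with x hx
        have hx' := Ioo_subset_Icc_self hx
        rw [Pi.add_apply, ← intervalIntegral.integral_add
          (intervalIntegrable_L2Unit u (by simp) hx') (intervalIntegrable_L2Unit w (by simp) hx')]
        exact intervalIntegral_congr_L2Unit (Lp.coeFn_add u w) (by simp) hx'
      map_smul' := fun c u => by
        rw [← MemLp.toLp_const_smul, MemLp.toLp_eq_toLp_iff]
        filter_upwards [ae_restrict_mem measurableSet_Ioo] with x hx
        have hx' := Ioo_subset_Icc_self hx
        rw [Pi.smul_apply, RingHom.id_apply, ← intervalIntegral.integral_smul]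
        exact intervalIntegral_congr_L2Unit (Lp.coeFn_smul c u) (by simp) hx' } 1 (fun w => by
    rw [one_mul]
    refine norm_L2Unit_le (norm_nonneg _) ?_
    filter_upwards [MemLp.coeFn_toLp (memLp_of_continuousOn (continuousOn_integral_L2Unit w)),
      ae_restrict_mem measurableSet_Ioo] with x hx hm
    refine (congrArg abs hx).trans_le ?_
    refine abs_le_of_sq_le_sq' ?_ (norm_nonneg _) |> abs_le.2
    have h1 := abs_integral_L2Unit_sq_le w (x := 0) (y := x) (by simp) (Ioo_subset_Icc_self hm)
    rw [sq_abs] at h1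
    refine h1.trans (mul_le_of_le_one_right (by positivity) ?_)
    rw [sub_zero, abs_of_pos hm.1]; exact hm.2.le)

theorem volterra_ae (w : L2Unit) : ∀ᵐ x ∂volume.restrict (Ioo (0 : ℝ) 1),
    volterra w x = ∫ s in (0 : ℝ)..x, w s :=
  MemLp.coeFn_toLp (memLp_of_continuousOn (continuousOn_integral_L2Unit w))

theorem inner_L2Unit (u w : L2Unit) : inner ℝ u w = ∫ x in (0 : ℝ)..1, u x * w x := by
  rw [L2.inner_def, intervalIntegral.integral_of_le zero_le_one, integral_Ioc_eq_integral_Ioo]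
  refine integral_congr_ae (Filter.Eventually.of_forall fun x => ?_)
  simp [mul_comm]

theorem inner_oneL2 (w : L2Unit) : inner ℝ w oneL2 = ∫ x in (0 : ℝ)..1, w x := by
  rw [inner_L2Unit]
  refine intervalIntegral_congr_L2Unit ?_ (by simp) (by simp)
  filter_upwards [oneL2_ae] with x hx
  rw [hx, mul_one]

theorem norm_oneL2 : ‖oneL2‖ = 1 := by
  have h1 : ‖oneL2‖ ^ 2 = 1 := by
    rw [← real_inner_self_eq_norm_sq, inner_oneL2,
      intervalIntegral_congr_L2Unit oneL2_ae (by simp) (by simp)]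
    simp
  rw [← Real.sqrt_sq (norm_nonneg oneL2), h1, Real.sqrt_one]

/-- `V + V† = 1 ⊗ 1`. -/
theorem inner_volterra_add (w z : L2Unit) :
    inner ℝ (volterra w) z + inner ℝ w (volterra z) = inner ℝ w oneL2 * inner ℝ z oneL2 := by
  have hw := intervalIntegrable_L2Unit w (x := 0) (y := 1) (by simp) (by simp)
  have hz := intervalIntegrable_L2Unit z (x := 0) (y := 1) (by simp) (by simp)
  have e1 : inner ℝ (volterra w) z = ∫ x in (0 : ℝ)..1, (∫ s in (0 : ℝ)..x, w s) * z x := by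
    rw [inner_L2Unit]
    refine intervalIntegral_congr_L2Unit ?_ (by simp) (by simp)
    filter_upwards [volterra_ae w] with x hx; rw [hx]
  have e2 : inner ℝ w (volterra z) = ∫ x in (0 : ℝ)..1, w x * (∫ s in (0 : ℝ)..x, z s) := by
    rw [inner_L2Unit]
    refine intervalIntegral_congr_L2Unit ?_ (by simp) (by simp)
    filter_upwards [volterra_ae z] with x hx; rw [hx]
  have hwa := hw.absolutelyContinuousOnInterval_integral
  have hza := hz.absolutelyContinuousOnInterval_integral
  have i1 : IntervalIntegrable (fun x => (∫ s in (0 : ℝ)..x, w s) * z x) volume 0 1 :=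
    hz.continuousOn_mul hwa.continuousOn
  have i2 : IntervalIntegrable (fun x => w x * ∫ s in (0 : ℝ)..x, z s) volume 0 1 :=
    hw.mul_continuousOn hza.continuousOn
  -- The sum of the integrands is the derivative of the product of the two primitives, which
  -- vanishes at `0`.
  rw [e1, e2, inner_oneL2, inner_oneL2, ← intervalIntegral.integral_add i1 i2,
    (hwa.fun_mul hza).integral_eq_sub_of_ae_hasDerivAt
      (g := fun x => (∫ s in (0 : ℝ)..x, w s) * z x + w x * ∫ s in (0 : ℝ)..x, z s) ?_ (i1.add i2)]
  · simp
  · filter_upwards [hw.ae_hasDerivAt_integral, hz.ae_hasDerivAt_integral] with x h1 h2 hm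
    have h3 := (h1 hm 0 (by simp)).mul (h2 hm 0 (by simp))
    rwa [add_comm] at h3

/-- A function with an integrable weak derivative is a constant plus the primitive of that
derivative, and conversely. This replaces distributional arguments in `x` by algebra. -/
theorem isDx_iff {u w : L2Unit} : IsDx u w ↔ ∃ c : ℝ, u = c • oneL2 + volterra w := by
  have key : ∀ c : ℝ, ∀ᵐ x ∂volume.restrict (Ioo (0 : ℝ) 1),
      (c • oneL2 + volterra w : L2Unit) x = c + ∫ s in (0 : ℝ)..x, w s := by
    intro c
    filter_upwards [Lp.coeFn_add (c • oneL2) (volterra w), Lp.coeFn_smul c oneL2, oneL2_ae,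
      volterra_ae w] with x h1 h2 h3 h4
    rw [h1, Pi.add_apply, h2, Pi.smul_apply, h3, h4, smul_eq_mul, mul_one]
  constructor
  · intro h
    obtain ⟨c, hc⟩ := IsWeakDeriv.exists_eq_integral zero_lt_one h (integrable_L2Unit w)
    refine ⟨c, Lp.ext ?_⟩
    filter_upwards [hc, key c] with x h1 h2
    rw [h1, h2]
  · rintro ⟨c, rfl⟩
    refine (isWeakDeriv_integral zero_le_one (integrable_L2Unit w) c).congr ?_
      (Filter.Eventually.of_forall fun _ => rfl)
    filter_upwards [key c] with x hx using hx.symm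

theorem IsDx.unique {u w w' : L2Unit} (h : IsDx u w) (h' : IsDx u w') : w = w' :=
  Lp.ext (IsWeakDeriv.unique h h')

theorem IsDx.sub {u u' w w' : L2Unit} (h : IsDx u w) (h' : IsDx u' w') :
    IsDx (u - u') (w - w') := by
  rw [isDx_iff] at *
  obtain ⟨c, rfl⟩ := h
  obtain ⟨c', rfl⟩ := h'
  exact ⟨c - c', by rw [sub_smul, map_sub]; abel⟩

/-- A Hilbert space parametrizing `H¹(0,1)`: the value at `0` and the derivative. -/
abbrev H1Unit : Type := WithLp 2 (ℝ × L2Unit)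

/-- The derivative `H¹(0,1) → L²(0,1)`. -/
noncomputable def H1Unit.dx : H1Unit →L[ℝ] L2Unit := WithLp.sndL 2 ℝ ℝ L2Unit

/-- The embedding `H¹(0,1) → L²(0,1)`. -/
noncomputable def H1Unit.toL2 : H1Unit →L[ℝ] L2Unit :=
  (WithLp.fstL 2 ℝ ℝ L2Unit).smulRight oneL2 + volterra ∘L H1Unit.dx

theorem H1Unit.toL2_apply (x : H1Unit) : H1Unit.toL2 x = x.fst • oneL2 + volterra x.snd := rfl

theorem H1Unit.dx_apply (x : H1Unit) : H1Unit.dx x = x.snd := rfl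

theorem H1Unit.isDx (x : H1Unit) : IsDx (H1Unit.toL2 x) (H1Unit.dx x) :=
  isDx_iff.2 ⟨x.fst, rfl⟩

theorem IsDx.exists_H1Unit {u w : L2Unit} (h : IsDx u w) :
    ∃ x : H1Unit, H1Unit.toL2 x = u ∧ H1Unit.dx x = w := by
  obtain ⟨c, rfl⟩ := isDx_iff.1 h
  exact ⟨WithLp.toLp 2 (c, w), rfl, rfl⟩

theorem H1Unit.toL2_injective : Function.Injective H1Unit.toL2 := by
  intro x y hxy
  have h1 := H1Unit.isDx x
  rw [hxy] at h1
  have h2 : x.snd = y.snd := h1.unique (H1Unit.isDx y)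
  rw [H1Unit.toL2_apply, H1Unit.toL2_apply, h2, add_left_inj] at hxy
  have h3 : x.fst = y.fst := by
    have h4 := sub_eq_zero.2 hxy
    rw [← sub_smul, smul_eq_zero] at h4
    refine sub_eq_zero.1 (h4.resolve_right fun h => ?_)
    have := norm_oneL2
    rw [h, norm_zero] at this
    exact zero_ne_one this
  exact WithLp.ofLp_injective 2 (Prod.ext h3 h2)

/-- The value at `0` is recovered from `x.fst • 1 = u - V u'` and `‖1‖ = 1`. This makes the
parametrizing norm controlled by the usual `H¹` norm, as the evolution theorem requires. -/
theorem H1Unit.norm_sq_le (x : H1Unit) :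
    ‖x‖ ^ 2 ≤ (3 + 2 * ‖volterra‖ ^ 2) * (‖H1Unit.toL2 x‖ ^ 2 + ‖H1Unit.dx x‖ ^ 2) := by
  rw [WithLp.prod_norm_sq_eq_of_L2, H1Unit.dx_apply]
  have h1 : ‖x.fst‖ ≤ ‖H1Unit.toL2 x‖ + ‖volterra‖ * ‖x.snd‖ := by
    have h2 : x.fst • oneL2 = H1Unit.toL2 x - volterra x.snd := by
      rw [H1Unit.toL2_apply]; abel
    have h3 : ‖x.fst • oneL2‖ = ‖x.fst‖ := by rw [norm_smul, norm_oneL2, mul_one]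
    rw [← h3, h2]
    exact (norm_sub_le _ _).trans (add_le_add le_rfl (volterra.le_opNorm _))
  have h4 : ‖x.fst‖ ^ 2 ≤ 2 * ‖H1Unit.toL2 x‖ ^ 2 + 2 * (‖volterra‖ * ‖x.snd‖) ^ 2 := by
    nlinarith [norm_nonneg x.fst, sq_nonneg (‖H1Unit.toL2 x‖ - ‖volterra‖ * ‖x.snd‖)]
  have h5 : 0 ≤ ‖volterra‖ ^ 2 * ‖H1Unit.toL2 x‖ ^ 2 := by positivity
  rw [mul_pow] at h4
  nlinarith [sq_nonneg ‖H1Unit.toL2 x‖, sq_nonneg ‖x.snd‖]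

instance : SecondCountableTopology L2Unit := by
  have : Fact ((2 : ℝ≥0∞) ≠ ⊤) := ⟨by norm_num⟩
  exact Lp.SecondCountableTopology

/-- Weak convergence tested on indicators gives pointwise convergence of the primitives. They are
uniformly 1/2-Hölder, so the convergence is uniform, hence strong in `L²`. -/
theorem mapsWeakToStrong_volterra : MapsWeakToStrong volterra := by
  intro U x R y hx hy
  have hR : 0 ≤ R := (norm_nonneg _).trans (hx 0)
  -- Weak lower semicontinuity of the norm, obtained by testing with `y` itself.
  have hyR : ‖y‖ ≤ R := by
    by_contra! hlt
    have h1 := hy y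
    have h2 : ∀ m, inner ℝ (x m) y ≤ R * ‖y‖ := fun m =>
      (real_inner_le_norm _ _).trans (mul_le_mul_of_nonneg_right (hx m) (norm_nonneg _))
    have h3 := le_of_tendsto' h1 h2
    rw [real_inner_self_eq_norm_sq] at h3
    nlinarith [norm_nonneg y]
  have hH : ∀ (w : L2Unit), ‖w‖ ≤ R → ∀ t ∈ Icc (0 : ℝ) 1, ∀ s ∈ Icc (0 : ℝ) 1,
      ‖(∫ r in (0 : ℝ)..t, w r) - ∫ r in (0 : ℝ)..s, w r‖ ^ 2 ≤ R ^ 2 * |t - s| := by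
    intro w hw t ht s hs
    rw [intervalIntegral.integral_interval_sub_left (intervalIntegrable_L2Unit w (by simp) ht)
      (intervalIntegrable_L2Unit w (by simp) hs)]
    refine (abs_integral_L2Unit_sq_le w hs ht).trans ?_
    gcongr
  rw [Metric.tendsto_nhds]
  intro ε hε
  have h1 := eventually_forall_norm_sub_lt (l := U) (T := 1) (R := R ^ 2) (by positivity)
    (τ := fun _ => 0) tendsto_const_nhds (f := fun m t => ∫ r in (0 : ℝ)..t, x m r)
    (g := fun t => ∫ r in (0 : ℝ)..t, y r)
    (fun m t ht s hs => by rw [add_zero]; exact hH _ (hx m) t ht s hs) (hH y hyR)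
    (fun t ht => by
      simp only [integral_eq_inner_indicator _ le_rfl ht.1 ht.2]
      rw [real_inner_comm]
      exact (hy _).congr fun m => real_inner_comm _ _) (half_pos hε)
  filter_upwards [h1] with m hm
  rw [dist_eq_norm]
  refine (norm_L2Unit_le (half_pos hε).le ?_).trans_lt (half_lt_self hε)
  filter_upwards [Lp.coeFn_sub (volterra (x m)) (volterra y), volterra_ae (x m), volterra_ae y,
    ae_restrict_mem measurableSet_Ioo] with t e1 e2 e3 ht
  rw [e1, Pi.sub_apply, e2, e3]
  exact (hm t (Ioo_subset_Icc_self ht)).le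

/-- The value at `0` is a scalar coordinate, for which weak convergence is convergence; the
derivative passes through the compact operator `V`. -/
theorem H1Unit.mapsWeakToStrong_toL2 : MapsWeakToStrong H1Unit.toL2 := by
  intro U x R y hx hy
  simp only [H1Unit.toL2_apply]
  refine Filter.Tendsto.add (Filter.Tendsto.smul_const ?_ _)
    (mapsWeakToStrong_volterra U _ R _ (fun m => ?_) fun ψ => ?_)
  · have h1 := hy (WithLp.toLp 2 ((1 : ℝ), (0 : L2Unit)))
    simpa [WithLp.prod_inner_apply] using h1
  · refine le_trans ?_ (hx m)
    refine le_of_sq_le_sq ?_ (norm_nonneg _)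
    rw [WithLp.prod_norm_sq_eq_of_L2]
    exact le_add_of_nonneg_left (sq_nonneg _)
  · have h1 := hy (WithLp.toLp 2 ((0 : ℝ), ψ))
    simpa [WithLp.prod_inner_apply] using h1

/-- The weak form of `∂ₓ F = z` with no-flux boundary conditions. -/
theorem eq_volterra_of_forall_inner {F z : L2Unit}
    (h : ∀ φ : H1Unit, inner ℝ z (H1Unit.toL2 φ) + inner ℝ F (H1Unit.dx φ) = 0) :
    inner ℝ z oneL2 = 0 ∧ F = volterra z := by
  have h1 : inner ℝ z oneL2 = 0 := by
    have h2 := h (WithLp.toLp 2 ((1 : ℝ), (0 : L2Unit)))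
    simpa [H1Unit.toL2_apply, H1Unit.dx_apply] using h2
  refine ⟨h1, ext_inner_right ℝ fun w => ?_⟩
  have h2 := h (WithLp.toLp 2 ((0 : ℝ), w))
  rw [H1Unit.toL2_apply, H1Unit.dx_apply, show (WithLp.toLp 2 ((0 : ℝ), w)).fst = 0 from rfl,
    show (WithLp.toLp 2 ((0 : ℝ), w)).snd = w from rfl, zero_smul, zero_add] at h2
  -- Constants as test functions gave mean zero, so `V† z = -V z`; hence testing with primitives `V
  -- w` gives `(F, w) = (V z, w)`.
  have h3 := inner_volterra_add z w
  rw [h1, zero_mul] at h3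
  linarith

theorem hasBoundaryValues_volterra {z : L2Unit} (hz : inner ℝ z oneL2 = 0) :
    HasBoundaryValues (volterra z) 0 0 :=
  ⟨_, continuousOn_integral_L2Unit z, volterra_ae z, by simp, by rw [← inner_oneL2, hz]⟩

/-- Two continuous representatives agree on all of `[0, 1]`: the value at `0` kills the constant,
and the value at `1` is then the mean of `z`. -/
theorem IsDx.eq_volterra_of_hasBoundaryValues {F z : L2Unit} (h : IsDx F z)
    (hb : HasBoundaryValues F 0 0) : inner ℝ z oneL2 = 0 ∧ F = volterra z := by
  obtain ⟨c, hc⟩ := isDx_iff.1 h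
  obtain ⟨g, hg, hFg, h0, h1⟩ := hb
  have hG : ContinuousOn (fun x => c + ∫ s in (0 : ℝ)..x, z s) (Icc 0 1) :=
    continuousOn_const.add (continuousOn_integral_L2Unit z)
  have hae : g =ᵐ[volume.restrict (Icc (0 : ℝ) 1)] fun x => c + ∫ s in (0 : ℝ)..x, z s := by
    rw [← Measure.restrict_congr_set Ioo_ae_eq_Icc]
    filter_upwards [hFg, Lp.coeFn_add (c • oneL2) (volterra z), Lp.coeFn_smul c oneL2, oneL2_ae,
      volterra_ae z] with x e0 e1 e2 e3 e4
    rw [← e0, hc, e1, Pi.add_apply, e2, Pi.smul_apply, e3, e4, smul_eq_mul, mul_one]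
  have heq : EqOn g (fun x => c + ∫ s in (0 : ℝ)..x, z s) (Icc 0 1) :=
    Measure.eqOn_Icc_of_ae_eq volume zero_ne_one hae hg hG
  have hc0 : c = 0 := by
    have := heq (left_mem_Icc.2 zero_le_one)
    simpa [h0] using this.symm
  have hz0 : inner ℝ z oneL2 = 0 := by
    have := heq (right_mem_Icc.2 zero_le_one)
    rw [inner_oneL2]
    simpa [h1, hc0] using this.symm
  exact ⟨hz0, by rw [hc, hc0, zero_smul, zero_add]⟩

end Volterra

/-! ### Superposition operators on `L²(0,1)` -/

section Nemytskii

theorem memLp_of_abs_le_add {f : ℝ → ℝ}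
    (hf : AEStronglyMeasurable f (volume.restrict (Ioo (0 : ℝ) 1))) {α β : ℝ} {u q : L2Unit}
    (h : ∀ᵐ x ∂volume.restrict (Ioo (0 : ℝ) 1), |f x| ≤ α * |u x| + β * |q x|) :
    MemLp f 2 (volume.restrict (Ioo (0 : ℝ) 1)) := by
  refine MemLp.mono' (((Lp.memLp u).abs.const_mul α).add ((Lp.memLp q).abs.const_mul β)) hf ?_
  filter_upwards [h] with x hx using hx

theorem norm_le_of_abs_le_add {f u q : L2Unit} {α β : ℝ} (hα : 0 ≤ α) (hβ : 0 ≤ β)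
    (h : ∀ᵐ x ∂volume.restrict (Ioo (0 : ℝ) 1), |f x| ≤ α * |u x| + β * |q x|) :
    ‖f‖ ≤ α * ‖u‖ + β * ‖q‖ := by
  have h1 : ‖f‖ ≤ ‖α • |u| + β • |q|‖ := by
    refine Lp.norm_le_norm_of_ae_le ?_
    filter_upwards [h, Lp.coeFn_add (α • |u|) (β • |q|), Lp.coeFn_smul α |u|,
      Lp.coeFn_smul β |q|, Lp.coeFn_abs u, Lp.coeFn_abs q] with x e1 e2 e3 e4 e5 e6
    rw [e2, Pi.add_apply, e3, e4, Pi.smul_apply, Pi.smul_apply, e5, e6]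
    exact e1.trans (le_abs_self _)
  refine h1.trans ((norm_add_le _ _).trans_eq ?_)
  rw [norm_smul, norm_smul, norm_abs_eq_norm, norm_abs_eq_norm, Real.norm_of_nonneg hα,
    Real.norm_of_nonneg hβ]

/-- `G` is Lipschitz with constants `α` and `β` in its two arguments. -/
def LipschitzPair (α β : ℝ) (G : ℝ → ℝ → ℝ) : Prop :=
  0 ≤ α ∧ 0 ≤ β ∧ ∀ r s r' s', |G r s - G r' s'| ≤ α * |r - r'| + β * |s - s'|

open Classical in
/-- The superposition operator `(u, q) ↦ G(u, q)` on `L²(0,1)`. -/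
noncomputable def nemytskii (G : ℝ → ℝ → ℝ) (u q : L2Unit) : L2Unit :=
  if h : MemLp (fun x => G (u x) (q x)) 2 (volume.restrict (Ioo (0 : ℝ) 1)) then h.toLp _ else 0

variable {G : ℝ → ℝ → ℝ} {α β : ℝ}

theorem LipschitzPair.continuous (hG : LipschitzPair α β G) :
    Continuous (Function.uncurry G) := by
  refine continuous_iff_continuousAt.2 fun x => ?_
  rw [ContinuousAt, tendsto_iff_norm_sub_tendsto_zero]
  have h1 : Filter.Tendsto (fun y : ℝ × ℝ => α * |y.1 - x.1| + β * |y.2 - x.2|) (nhds x)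
      (nhds 0) := by
    have : Continuous fun y : ℝ × ℝ => α * |y.1 - x.1| + β * |y.2 - x.2| := by fun_prop
    simpa using this.tendsto x
  exact squeeze_zero (fun _ => norm_nonneg _) (fun y => hG.2.2 _ _ _ _) h1

theorem LipschitzPair.memLp (hG : LipschitzPair α β G) (u q : L2Unit) :
    MemLp (fun x => G (u x) (q x)) 2 (volume.restrict (Ioo (0 : ℝ) 1)) := by
  have hm : AEStronglyMeasurable (fun x => G (u x) (q x)) (volume.restrict (Ioo (0 : ℝ) 1)) :=
    hG.continuous.comp_aestronglyMeasurable
      ((Lp.aestronglyMeasurable u).prodMk (Lp.aestronglyMeasurable q))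
  have h1 : MemLp (fun x => G (u x) (q x) - G 0 0) 2 (volume.restrict (Ioo (0 : ℝ) 1)) := by
    refine memLp_of_abs_le_add (α := α) (β := β) (u := u) (q := q)
      (hm.sub aestronglyMeasurable_const) (Filter.Eventually.of_forall fun x => ?_)
    simpa using hG.2.2 (u x) (q x) 0 0
  have h2 := h1.add (memLp_const (G 0 0))
  refine h2.ae_eq (Filter.Eventually.of_forall fun x => ?_)
  simp

theorem LipschitzPair.nemytskii_ae (hG : LipschitzPair α β G) (u q : L2Unit) :
    ∀ᵐ x ∂volume.restrict (Ioo (0 : ℝ) 1), nemytskii G u q x = G (u x) (q x) := by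
  rw [nemytskii, dif_pos (hG.memLp u q)]
  exact (hG.memLp u q).coeFn_toLp

theorem LipschitzPair.norm_nemytskii_sub_le (hG : LipschitzPair α β G) (u q u' q' : L2Unit) :
    ‖nemytskii G u q - nemytskii G u' q'‖ ≤ α * ‖u - u'‖ + β * ‖q - q'‖ := by
  refine norm_le_of_abs_le_add hG.1 hG.2.1 ?_
  filter_upwards [Lp.coeFn_sub (nemytskii G u q) (nemytskii G u' q'), hG.nemytskii_ae u q,
    hG.nemytskii_ae u' q', Lp.coeFn_sub u u', Lp.coeFn_sub q q'] with x e1 e2 e3 e4 e5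
  rw [e1, Pi.sub_apply, e2, e3, e4, e5]
  exact hG.2.2 _ _ _ _

theorem LipschitzPair.continuous_nemytskii (hG : LipschitzPair α β G) :
    Continuous fun y : L2Unit × L2Unit => nemytskii G y.1 y.2 := by
  refine continuous_iff_continuousAt.2 fun x => ?_
  rw [ContinuousAt, tendsto_iff_norm_sub_tendsto_zero]
  have h1 : Filter.Tendsto (fun y : L2Unit × L2Unit => α * ‖y.1 - x.1‖ + β * ‖y.2 - x.2‖) (nhds x)
      (nhds 0) := by
    have : Continuous fun y : L2Unit × L2Unit => α * ‖y.1 - x.1‖ + β * ‖y.2 - x.2‖ := by fun_prop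
    simpa using this.tendsto x
  exact squeeze_zero (fun _ => norm_nonneg _) (fun y => hG.norm_nemytskii_sub_le _ _ _ _) h1

theorem LipschitzPair.norm_nemytskii_le (hG : LipschitzPair α β G) {M : ℝ} (hM : 0 ≤ M)
    (hGM : ∀ r s, |G r s| ≤ M) (u q : L2Unit) : ‖nemytskii G u q‖ ≤ M := by
  refine norm_L2Unit_le hM ?_
  filter_upwards [hG.nemytskii_ae u q] with x hx
  rw [hx]; exact hGM _ _

end Nemytskii

/-! ### Monotonicity of `h`, truncation, and the product rule -/

section Nonlinearities

theorem abs_sub_le_of_abs_deriv_le {f : ℝ → ℝ} {C : ℝ} (hf : Differentiable ℝ f)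
    (hC : ∀ r, |deriv f r| ≤ C) (r s : ℝ) : |f r - f s| ≤ C * |r - s| :=
  Convex.norm_image_sub_le_of_norm_deriv_le (s := univ) (fun x _ => hf x) (fun x _ => hC x)
    convex_univ (mem_univ s) (mem_univ r)

theorem mul_sq_le_of_le_deriv {f : ℝ → ℝ} {c : ℝ} (hf : Differentiable ℝ f)
    (hc : ∀ r, c ≤ deriv f r) (r s : ℝ) : c * (r - s) ^ 2 ≤ (f r - f s) * (r - s) := by
  wlog hrs : s ≤ r generalizing r s
  · have := this s r (le_of_not_ge hrs)
    linarith [show c * (r - s) ^ 2 = c * (s - r) ^ 2 by ring,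
      show (f r - f s) * (r - s) = (f s - f r) * (s - r) by ring]
  have h1 := mul_sub_le_image_sub_of_le_deriv hf hc hrs
  calc c * (r - s) ^ 2 = c * (r - s) * (r - s) := by ring
    _ ≤ _ := mul_le_mul_of_nonneg_right h1 (sub_nonneg.2 hrs)

theorem inner_nemytskii_sub_ge {f : ℝ → ℝ} {c α : ℝ} (hα : LipschitzPair α 0 fun r _ => f r)
    (hc : ∀ r s, c * (r - s) ^ 2 ≤ (f r - f s) * (r - s)) (u v : L2Unit) :
    c * ‖u - v‖ ^ 2 ≤ inner ℝ (nemytskii (fun r _ => f r) u 0 - nemytskii (fun r _ => f r) v 0)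
      (u - v) := by
  rw [← real_inner_self_eq_norm_sq, L2.inner_def, L2.inner_def, ← integral_const_mul]
  refine integral_mono_ae ((L2.integrable_inner _ _).const_mul c) (L2.integrable_inner _ _) ?_
  filter_upwards [Lp.coeFn_sub (nemytskii (fun r _ => f r) u 0) (nemytskii (fun r _ => f r) v 0),
    hα.nemytskii_ae u 0, hα.nemytskii_ae v 0, Lp.coeFn_sub u v] with x e1 e2 e3 e4
  simp only [e1, e4, Pi.sub_apply, e2, e3]
  have := hc (u x) (v x)
  simp only [RCLike.inner_apply, conj_trivial]
  linarith [this, show c * ((u x - v x) * (u x - v x)) = c * (u x - v x) ^ 2 by ring]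

/-- Truncation at level `M`. -/
noncomputable def clip (M r : ℝ) : ℝ := max (-M) (min M r)

theorem clip_eq {M r : ℝ} (h : |r| ≤ M) : clip M r = r := by
  rw [clip, min_eq_right (abs_le.1 h).2, max_eq_right (abs_le.1 h).1]

theorem abs_clip_le {M : ℝ} (hM : 0 ≤ M) (r : ℝ) : |clip M r| ≤ M :=
  abs_le.2 ⟨le_max_left _ _, max_le (by linarith) (min_le_left _ _)⟩

theorem abs_clip_sub_le (M r s : ℝ) : |clip M r - clip M s| ≤ |r - s| :=
  (abs_max_sub_max_le_max _ _ _ _).trans (by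
    rw [sub_self, abs_zero, max_eq_right (abs_nonneg _)]
    refine (abs_min_sub_min_le_max _ _ _ _).trans ?_
    rw [sub_self, abs_zero, max_eq_right (abs_nonneg _)])

/-- Without truncation the Lipschitz constant of `b r * s` in `r` would grow with `|s|`. At a bound
for `p` the truncation does not alter the equation. -/
theorem lipschitzPair_mul_clip {b : ℝ → ℝ} {C M : ℝ} (hM : 0 ≤ M) (hb : ∀ r, |b r| ≤ C)
    (hL : ∀ r s, |b r - b s| ≤ C * |r - s|) :
    LipschitzPair (C * M) C fun r s => b r * clip M s := by
  have hC : 0 ≤ C := (abs_nonneg _).trans (hb 0)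
  refine ⟨by positivity, hC, fun r s r' s' => ?_⟩
  calc |b r * clip M s - b r' * clip M s'|
      = |(b r - b r') * clip M s + b r' * (clip M s - clip M s')| := by ring_nf
    _ ≤ |b r - b r'| * |clip M s| + |b r'| * |clip M s - clip M s'| := by
        rw [← abs_mul, ← abs_mul]; exact abs_add_le _ _
    _ ≤ C * |r - r'| * M + C * |s - s'| := by
        refine add_le_add (mul_le_mul (hL _ _) (abs_clip_le hM s) (abs_nonneg _) (by positivity))
          (mul_le_mul (hb _) (abs_clip_sub_le _ _ _) (abs_nonneg _) hC)
    _ = _ := by ring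

/-- The product rule for `b(v) q` with `v, q ∈ H¹(0,1)` and `q` bounded. -/
theorem exists_isDx_mul {b : ℝ → ℝ} (hb : ContDiff ℝ 1 b) {C M : ℝ} (hbC : ∀ r, |b r| ≤ C)
    (hb' : ∀ r, |deriv b r| ≤ C) (hM : 0 ≤ M) {v vx q qx g : L2Unit} (hv : IsDx v vx)
    (hq : IsDx q qx) (hqM : ∀ᵐ x ∂volume.restrict (Ioo (0 : ℝ) 1), |q x| ≤ M)
    (hg : ∀ᵐ x ∂volume.restrict (Ioo (0 : ℝ) 1), g x = b (v x) * q x) :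
    ∃ gx, IsDx g gx ∧ ‖gx‖ ≤ C * M * ‖vx‖ + C * ‖qx‖ := by
  have hC : 0 ≤ C := (abs_nonneg _).trans (hbC 0)
  obtain ⟨cv, hcv⟩ := IsWeakDeriv.exists_eq_integral zero_lt_one hv (integrable_L2Unit vx)
  obtain ⟨cq, hcq⟩ := IsWeakDeriv.exists_eq_integral zero_lt_one hq (integrable_L2Unit qx)
  set V : ℝ → ℝ := fun x => cv + ∫ s in (0 : ℝ)..x, vx s with hV
  set Q : ℝ → ℝ := fun x => cq + ∫ s in (0 : ℝ)..x, qx s with hQ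
  have hVi := intervalIntegrable_L2Unit vx (x := 0) (y := 1) (by simp) (by simp)
  have hQi := intervalIntegrable_L2Unit qx (x := 0) (y := 1) (by simp) (by simp)
  have hVac : AbsolutelyContinuousOnInterval V 0 1 :=
    AbsolutelyContinuousOnInterval.of_dist_le (K := 1)
      hVi.absolutelyContinuousOnInterval_integral (by simp [hV])
  have hQac : AbsolutelyContinuousOnInterval Q 0 1 :=
    AbsolutelyContinuousOnInterval.of_dist_le (K := 1)
      hQi.absolutelyContinuousOnInterval_integral (by simp [hQ])
  have hbd : Differentiable ℝ b := hb.differentiable (by norm_num)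
  have hbV : AbsolutelyContinuousOnInterval (fun x => b (V x)) 0 1 :=
    AbsolutelyContinuousOnInterval.of_dist_le (K := C) hVac fun x _ y _ =>
      abs_sub_le_of_abs_deriv_le hbd hb' _ _
  -- The candidate derivative uses the continuous representatives `V` and `Q`, along which the
  -- product is absolutely continuous.
  set d : ℝ → ℝ := fun x => deriv b (V x) * vx x * Q x + b (V x) * qx x with hd
  have hVc := hVac.continuousOn
  have hQc := hQac.continuousOn
  rw [uIcc_of_le zero_le_one] at hVc hQc
  have hmV : AEStronglyMeasurable V (volume.restrict (Ioo (0 : ℝ) 1)) :=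
    (hVc.mono Ioo_subset_Icc_self).aestronglyMeasurable measurableSet_Ioo
  have hmQ : AEStronglyMeasurable Q (volume.restrict (Ioo (0 : ℝ) 1)) :=
    (hQc.mono Ioo_subset_Icc_self).aestronglyMeasurable measurableSet_Ioo
  have hdm : AEStronglyMeasurable d (volume.restrict (Ioo (0 : ℝ) 1)) :=
    ((((hb.continuous_deriv le_rfl).comp_aestronglyMeasurable hmV).mul
      (Lp.aestronglyMeasurable vx)).mul hmQ).add
      ((hb.continuous.comp_aestronglyMeasurable hmV).mul (Lp.aestronglyMeasurable qx))
  have hdle : ∀ᵐ x ∂volume.restrict (Ioo (0 : ℝ) 1),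
      |d x| ≤ C * M * |vx x| + C * |qx x| := by
    filter_upwards [hqM, hcq] with x e1 e2
    rw [e2] at e1
    refine (abs_add_le _ _).trans ?_
    rw [abs_mul, abs_mul, abs_mul]
    calc |deriv b (V x)| * |vx x| * |Q x| + |b (V x)| * |qx x|
        ≤ C * |vx x| * M + C * |qx x| := by
          gcongr
          · exact hb' _
          · exact hbC _
      _ = _ := by ring
  have hdL := memLp_of_abs_le_add hdm hdle
  refine ⟨hdL.toLp d, ?_, norm_le_of_abs_le_add (by positivity) hC ?_⟩
  · rw [isDx_iff]
    refine ⟨b (V 0) * Q 0, Lp.ext ?_⟩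
    filter_upwards [hg, hcv, hcq, Lp.coeFn_add ((b (V 0) * Q 0) • oneL2) (volterra (hdL.toLp d)),
      Lp.coeFn_smul (b (V 0) * Q 0) oneL2, oneL2_ae, volterra_ae (hdL.toLp d),
      ae_restrict_mem measurableSet_Ioo] with x e1 e2 e3 e4 e5 e6 e7 hx
    have hx' := Ioo_subset_Icc_self hx
    have hsub : uIcc 0 x ⊆ uIcc (0 : ℝ) 1 := by
      rw [uIcc_of_le hx'.1, uIcc_of_le zero_le_one]; exact Icc_subset_Icc_right hx'.2
    have hFTC : ∫ s in (0 : ℝ)..x, d s = b (V x) * Q x - b (V 0) * Q 0 := by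
      refine ((hbV.fun_mul hQac).mono hsub).integral_eq_sub_of_ae_hasDerivAt ?_
        ((intervalIntegrable_of_integrableOn_Ioo zero_le_one
          (hdL.integrable (by norm_num))).mono_set hsub)
      filter_upwards [hVi.ae_hasDerivAt_integral, hQi.ae_hasDerivAt_integral] with y h1 h2 hy
      have hV' : HasDerivAt V (vx y) y := (h1 (hsub hy) 0 (by simp)).const_add cv
      have hQ' : HasDerivAt Q (qx y) y := (h2 (hsub hy) 0 (by simp)).const_add cq
      exact ((hbd (V y)).hasDerivAt.comp y hV').mul hQ'
    rw [e4, Pi.add_apply, e5, Pi.smul_apply, e6, e7, e1, e2, e3, smul_eq_mul, mul_one,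
      intervalIntegral_congr_L2Unit hdL.coeFn_toLp (by simp) hx', hFTC]
    ring
  · filter_upwards [hdL.coeFn_toLp, hdle] with x e1 e2
    rw [e1]; exact e2

end Nonlinearities

/-! ### Two integral inequalities in time -/

/-- Expand `∫ (‖w‖ - m)² ≥ 0` with `m` the mean of `‖w‖`. -/
theorem sq_norm_integral_le {H : Type*} [NormedAddCommGroup H] [InnerProductSpace ℝ H]
    {w : ℝ → H} {s t : ℝ} (hst : s ≤ t) (hw : IntervalIntegrable w volume s t)
    (hw2 : IntervalIntegrable (fun r => ‖w r‖ ^ 2) volume s t) :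
    ‖∫ r in s..t, w r‖ ^ 2 ≤ (t - s) * ∫ r in s..t, ‖w r‖ ^ 2 := by
  rcases hst.eq_or_lt with rfl | hlt
  · simp
  have hI : ‖∫ r in s..t, w r‖ ≤ ∫ r in s..t, ‖w r‖ :=
    intervalIntegral.norm_integral_le_integral_norm hst
  set I := ∫ r in s..t, ‖w r‖ with hIdef
  set m := I / (t - s) with hm
  have hts : 0 < t - s := sub_pos.2 hlt
  have h0 : 0 ≤ ∫ r in s..t, (‖w r‖ ^ 2 - 2 * m * ‖w r‖ + m ^ 2) :=
    intervalIntegral.integral_nonneg hst fun r _ => by nlinarith [sq_nonneg (‖w r‖ - m)]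
  rw [intervalIntegral.integral_add (hw2.sub (hw.norm.const_mul _)) (by simp),
    intervalIntegral.integral_sub hw2 (hw.norm.const_mul _), intervalIntegral.integral_const_mul,
    intervalIntegral.integral_const, ← hIdef, smul_eq_mul] at h0
  have h1 : I = m * (t - s) := by rw [hm]; field_simp
  calc ‖∫ r in s..t, w r‖ ^ 2 ≤ I ^ 2 := pow_le_pow_left₀ (norm_nonneg _) hI 2
    _ = (t - s) * (m ^ 2 * (t - s)) := by rw [h1]; ring
    _ ≤ _ := by
      gcongr
      have : 2 * m * I = 2 * (m ^ 2 * (t - s)) := by rw [h1]; ring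
      nlinarith

/-- Gronwall applied to the primitive of `y`, which starts at zero; extending `y` continuously
beyond `[0, T]` makes the primitive differentiable at the end points too. -/
theorem eq_zero_of_le_mul_integral {T K : ℝ} {y : ℝ → ℝ} (hT : 0 ≤ T)
    (hy : ContinuousOn y (Icc 0 T)) (hy0 : ∀ t ∈ Icc 0 T, 0 ≤ y t)
    (h : ∀ t ∈ Icc 0 T, y t ≤ K * ∫ s in (0 : ℝ)..t, y s) {t : ℝ} (ht : t ∈ Icc 0 T) : y t = 0 := by
  set Y : ℝ → ℝ := IccExtend hT ((Icc 0 T).domRestrict y) with hY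
  have hYc : Continuous Y := hy.domRestrict.Icc_extend'
  have hYy : ∀ t ∈ Icc 0 T, Y t = y t := fun t ht => IccExtend_of_mem hT _ ht
  have hint : ∀ t ∈ Icc 0 T, ∫ s in (0 : ℝ)..t, y s = ∫ s in (0 : ℝ)..t, Y s := fun t ht => by
    refine intervalIntegral.integral_congr fun s hs => ?_
    rw [uIcc_of_le ht.1] at hs
    exact (hYy s ⟨hs.1, hs.2.trans ht.2⟩).symm
  have hnn : ∀ t ∈ Icc 0 T, 0 ≤ ∫ s in (0 : ℝ)..t, Y s := fun t ht =>
    intervalIntegral.integral_nonneg ht.1 fun s hs => by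
      have hs' : s ∈ Icc 0 T := ⟨hs.1, hs.2.trans ht.2⟩
      rw [hYy s hs']; exact hy0 s hs'
  have hd : ∀ t, HasDerivAt (fun t => ∫ s in (0 : ℝ)..t, Y s) (Y t) t := fun t =>
    (hYc.integral_hasStrictDerivAt 0 t).hasDerivAt
  have h1 := norm_le_gronwallBound_of_norm_deriv_right_le (f := fun t => ∫ s in (0 : ℝ)..t, Y s)
    (f' := Y) (δ := 0) (K := K) (ε := 0) (a := 0) (b := T)
    (fun t _ => (hd t).continuousAt.continuousWithinAt)
    (fun t _ => (hd t).hasDerivWithinAt) (by simp) (fun t ht => by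
      have ht' := Ico_subset_Icc_self ht
      rw [hYy t ht', Real.norm_of_nonneg (hy0 t ht'), Real.norm_of_nonneg (hnn t ht'), add_zero,
        ← hint t ht']
      exact h t ht') t ht
  rw [gronwallBound_ε0_δ0] at h1
  have h2 := norm_le_zero_iff.1 h1
  have h3 := h t ht
  rw [hint t ht, h2, mul_zero] at h3
  exact le_antisymm h3 (hy0 t ht)

/-! ### Existence of a strong solution -/

section Existence

/-- The continuous representative of a function in `W^{1,2}(0,T;H)`. -/
theorem MemW12L2.exists_representative {T : ℝ} (hT : 0 < T) {p : ℝ → L2Unit} (hp : MemW12L2 T p) :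
    ∃ (q : ℝ → L2Unit) (ρ : ℝ → ℝ), (∀ᵐ t ∂volume.restrict (Ioo 0 T), p t = q t) ∧
      ∀ s ∈ Icc 0 T, ∀ t ∈ Icc 0 T, s ≤ t → ‖q t - q s‖ ^ 2 ≤ (t - s) * (ρ t - ρ s) := by
  obtain ⟨-, w, hw, hpw⟩ := hp
  have hwint : IntegrableOn w (Ioo 0 T) := hw.integrable (by norm_num)
  obtain ⟨c, hc⟩ := hpw.exists_eq_integral hT hwint
  -- `ρ` is the accumulated squared norm of the time derivative `w`.
  refine ⟨_, fun t => ∫ s in (0 : ℝ)..t, ‖w s‖ ^ 2, hc, fun s hs t ht hst => ?_⟩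
  have hw2 : IntegrableOn (fun s => ‖w s‖ ^ 2) (Ioo 0 T) := hw.integrable_norm_pow (by norm_num)
  have hi : ∀ {x y : ℝ}, x ∈ Icc 0 T → y ∈ Icc 0 T → IntervalIntegrable w volume x y :=
    fun hx hy => (intervalIntegrable_of_integrableOn_Ioo hT.le hwint).mono_set
      (by rw [uIcc_of_le hT.le]; exact uIcc_subset_Icc hx hy)
  have hi2 : ∀ {x y : ℝ}, x ∈ Icc 0 T → y ∈ Icc 0 T →
      IntervalIntegrable (fun s => ‖w s‖ ^ 2) volume x y :=
    fun hx hy => (intervalIntegrable_of_integrableOn_Ioo hT.le hw2).mono_set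
      (by rw [uIcc_of_le hT.le]; exact uIcc_subset_Icc hx hy)
  have h0 : (0 : ℝ) ∈ Icc 0 T := ⟨le_rfl, hT.le⟩
  rw [add_sub_add_left_eq_sub, intervalIntegral.integral_interval_sub_left (hi h0 ht) (hi h0 hs),
    intervalIntegral.integral_interval_sub_left (hi2 h0 ht) (hi2 h0 hs)]
  exact sq_norm_integral_le hst (hi hs ht) (hi2 hs ht)

theorem memLp_of_bound_Icc {E : Type*} [NormedAddCommGroup E] {T R : ℝ} {f : ℝ → E}
    {p : ℝ≥0∞} (hm : AEStronglyMeasurable f (volume.restrict (Ioo 0 T)))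
    (hR : ∀ t ∈ Icc 0 T, ‖f t‖ ≤ R) : MemLp f p (volume.restrict (Ioo 0 T)) := by
  refine MemLp.of_bound hm R ?_
  filter_upwards [ae_restrict_mem measurableSet_Ioo] with t ht using hR t (Ioo_subset_Icc_self ht)

/-- Measurable selection of the derivative. -/
theorem exists_aestronglyMeasurable_dx {T : ℝ} {f : ℝ → L2Unit}
    (hf : AEStronglyMeasurable f (volume.restrict (Ioo 0 T)))
    (h : ∀ᵐ t ∂volume.restrict (Ioo 0 T), MemH1 (f t)) :
    ∃ g : ℝ → L2Unit, AEStronglyMeasurable g (volume.restrict (Ioo 0 T)) ∧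
      ∀ᵐ t ∂volume.restrict (Ioo 0 T), IsDx (f t) (g t) := by
  have h1 : ∀ t, ∃ y : H1Unit, MemH1 (f t) → H1Unit.toL2 y = f t := by
    intro t
    by_cases ht : MemH1 (f t)
    · obtain ⟨w, hw⟩ := ht
      obtain ⟨y, hy, -⟩ := hw.exists_H1Unit
      exact ⟨y, fun _ => hy⟩
    · exact ⟨0, fun h => absurd h ht⟩
  choose y hy using h1
  have hy' : ∀ᵐ t ∂volume.restrict (Ioo 0 T), f t = H1Unit.toL2 (y t) := by
    filter_upwards [h] with t ht using (hy t ht).symm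
  refine ⟨fun t => H1Unit.dx (y t), ?_, ?_⟩
  · refine H1Unit.dx.continuous.comp_aestronglyMeasurable ?_
    borelize H1Unit
    borelize L2Unit
    have hemb : MeasurableEmbedding H1Unit.toL2 :=
      H1Unit.toL2.continuous.measurableEmbedding H1Unit.toL2_injective
    exact (hemb.aemeasurable_comp_iff.1 (hf.congr hy').aemeasurable).aestronglyMeasurable
  · filter_upwards [hy'] with t ht
    rw [ht]; exact H1Unit.isDx _

theorem exists_strongSolution {T : ℝ} (hT : 0 < T) {h b : ℝ → ℝ}
    (hh : AssumptionA1 h) (hb : AssumptionA2 b)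
    {p : ℝ → L2Unit} (hp_time : MemW12L2 T p) (hp_bdd : MemLinfQ T p) (hp_space : MemLqH1 T 2 p)
    {v₀ : L2Unit} (hv₀ : MemH1 v₀) : ∃ v : ℝ → L2Unit, IsStrongSolution T h b p v₀ v := by
  obtain ⟨hhC, c₁, c₂, hc₁, hc₂, hhb⟩ := hh
  obtain ⟨hbC, d₁, C, hd₁, hC, hbb⟩ := hb
  have hbabs : ∀ r, |b r| ≤ C := fun r => by
    rw [abs_of_nonneg (hd₁.le.trans (hbb r).1)]; exact (hbb r).2.1
  have hbL := abs_sub_le_of_abs_deriv_le (hbC.differentiable (by norm_num)) fun r => (hbb r).2.2.1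
  obtain ⟨-, M', hM'⟩ := hp_bdd
  set M := |M'| with hM
  have hM0 : 0 ≤ M := abs_nonneg _
  have hpM : ∀ᵐ t ∂volume.restrict (Ioo 0 T), ∀ᵐ x ∂volume.restrict (Ioo (0 : ℝ) 1),
      |p t x| ≤ M := by
    filter_upwards [hM'] with t ht
    filter_upwards [ht] with x hx using hx.trans (le_abs_self _)
  obtain ⟨-, px, hpx, hpdx⟩ := hp_space
  obtain ⟨q, ρ, hpq, hqρ⟩ := hp_time.exists_representative hT
  have hG := lipschitzPair_mul_clip hM0 hbabs hbL
  have hGM : ∀ r s, |b r * clip M s| ≤ C * M := fun r s => by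
    rw [abs_mul]; exact mul_le_mul (hbabs r) (abs_clip_le hM0 s) (abs_nonneg _) hC.le
  have hhd := hhC.differentiable (by norm_num)
  have hhL : LipschitzPair c₂ 0 fun r _ => h r := ⟨hc₂.le, le_rfl, fun r s r' s' => by
    rw [zero_mul, add_zero]
    refine abs_sub_le_of_abs_deriv_le hhd (fun r => ?_) r r'
    rw [abs_of_nonneg (hc₁.le.trans (hhb r).1)]; exact (hhb r).2.1⟩
  have hhm := mul_sq_le_of_le_deriv hhd fun r => (hhb r).1
  obtain ⟨v₀x, hv₀x⟩ := hv₀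
  obtain ⟨x₀, hx₀, -⟩ := hv₀x.exists_H1Unit
  -- `B` is built from the representative `q` instead of `p`, since its modulus must hold at every
  -- time and not only almost everywhere.
  obtain ⟨X, w, z, R, hX0, hXR, hXm, hXc, hw, hz, hXw, hXz, heq⟩ :=
    exists_evolution H1Unit.toL2 H1Unit.dx H1Unit.mapsWeakToStrong_toL2 H1Unit.toL2_injective
    H1Unit.norm_sq_le (N := fun u => nemytskii (fun r _ => h r) u 0) (c := c₁) (LN := c₂) hc₁
    (fun u v => by simpa using hhL.norm_nemytskii_sub_le u 0 v 0)
    (fun u v => inner_nemytskii_sub_ge hhL hhm u v) hT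
    (B := fun t u => nemytskii (fun r s => b r * clip M s) u (q t)) (L := C * M) (M := C * M)
    (ρ := fun t => C ^ 2 * ρ t)
    (fun t _ u v => by simpa using hG.norm_nemytskii_sub_le u (q t) v (q t))
    (fun t _ u => hG.norm_nemytskii_le (by positivity) hGM u (q t))
    (fun s hs t ht hst u => by
      have h1 := hG.norm_nemytskii_sub_le u (q t) u (q s)
      rw [sub_self, norm_zero, mul_zero, zero_add] at h1
      calc _ ≤ (C * ‖q t - q s‖) ^ 2 := pow_le_pow_left₀ (norm_nonneg _) h1 2
        _ ≤ C ^ 2 * ((t - s) * (ρ t - ρ s)) := by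
          rw [mul_pow]; exact mul_le_mul_of_nonneg_left (hqρ s hs t ht hst) (sq_nonneg _)
        _ = _ := by ring) x₀
  set v : ℝ → L2Unit := fun t => H1Unit.toL2 (X t) with hv
  set vx : ℝ → L2Unit := fun t => H1Unit.dx (X t) with hvx
  set B : ℝ → L2Unit := fun t => nemytskii (fun r s => b r * clip M s) (v t) (q t) with hB
  have hvdx : ∀ t, IsDx (v t) (vx t) := fun t => H1Unit.isDx (X t)
  have hflux : ∀ᵐ t ∂volume.restrict (Ioo 0 T),
      inner ℝ (z t) oneL2 = 0 ∧ vx t + B t = volterra (z t) := by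
    filter_upwards [heq] with t ht using eq_volterra_of_forall_inner ht
  have hBae : ∀ᵐ t ∂volume.restrict (Ioo 0 T), ∀ᵐ x ∂volume.restrict (Ioo (0 : ℝ) 1),
      B t x = b (v t x) * p t x := by
    filter_upwards [hpM, hpq] with t h1 h2
    filter_upwards [h1, hG.nemytskii_ae (v t) (q t)] with x h3 h4
    rw [hB, h4, ← h2, clip_eq h3]
  have hFdx : ∀ᵐ t ∂volume.restrict (Ioo 0 T), IsDx (vx t + B t) (z t) := by
    filter_upwards [hflux] with t ht
    exact isDx_iff.2 ⟨0, by rw [ht.2, zero_smul, zero_add]⟩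
  have hBdx : ∀ᵐ t ∂volume.restrict (Ioo 0 T), ∃ gx, IsDx (B t) gx ∧
      ‖gx‖ ≤ C * M * ‖vx t‖ + C * ‖px t‖ := by
    filter_upwards [hpM, hpdx, hBae] with t h1 h2 h3
    exact exists_isDx_mul (hbC.of_le (by norm_num)) hbabs (fun r => (hbb r).2.2.1) hM0 (hvdx t) h2
      h1 h3
  have hvm : AEStronglyMeasurable v (volume.restrict (Ioo 0 T)) :=
    H1Unit.toL2.continuous.comp_aestronglyMeasurable hXm
  have hvxm : AEStronglyMeasurable vx (volume.restrict (Ioo 0 T)) :=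
    H1Unit.dx.continuous.comp_aestronglyMeasurable hXm
  have hvp : ∀ r : ℝ≥0∞, MemLp v r (volume.restrict (Ioo 0 T)) := fun r =>
    memLp_of_bound_Icc (R := ‖H1Unit.toL2‖ * R) hvm fun t ht =>
      (H1Unit.toL2.le_opNorm _).trans (mul_le_mul_of_nonneg_left (hXR t ht) (norm_nonneg _))
  have hvxR : ∀ t ∈ Icc 0 T, ‖vx t‖ ≤ ‖H1Unit.dx‖ * R := fun t ht =>
    (H1Unit.dx.le_opNorm _).trans (mul_le_mul_of_nonneg_left (hXR t ht) (norm_nonneg _))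
  have hvxp : ∀ r : ℝ≥0∞, MemLp vx r (volume.restrict (Ioo 0 T)) := fun r =>
    memLp_of_bound_Icc hvxm hvxR
  have hweak : ∀ {g : ℝ → L2Unit} {g₀ : L2Unit} {f : ℝ → L2Unit},
      MemLp f 2 (volume.restrict (Ioo 0 T)) →
      (∀ t ∈ Icc 0 T, g t = g₀ + ∫ s in (0 : ℝ)..t, f s) → IsWeakDeriv 0 T g f := by
    intro g g₀ f hf hg
    refine (isWeakDeriv_integral hT.le (hf.integrable (by norm_num)) g₀).congr ?_
      (Filter.Eventually.of_forall fun _ => rfl)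
    filter_upwards [ae_restrict_mem measurableSet_Ioo] with t ht
      using (hg t (Ioo_subset_Icc_self ht)).symm
  refine ⟨v, ⟨⟨hvp 2, w, hw, hweak hw hXw⟩,
    ⟨hvp ∞, vx, hvxp ∞, Filter.Eventually.of_forall hvdx⟩, ⟨hvp 2, vx, ?_⟩, ?_, ?_⟩⟩
  -- Here `∂ₓ v` is the flux minus `b(v) p`: the flux has derivative `z`, the product has one by the
  -- product rule, and the norm bound is square integrable in time.
  · have hH2 : ∀ᵐ t ∂volume.restrict (Ioo 0 T), ∃ gx, IsDx (vx t) gx ∧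
        ‖gx‖ ≤ ‖z t‖ + (C * M * ‖vx t‖ + C * ‖px t‖) := by
      filter_upwards [hFdx, hBdx] with t h1 ⟨gx, h2, h3⟩
      have h4 := h1.sub h2
      rw [add_sub_cancel_right] at h4
      exact ⟨_, h4, (norm_sub_le _ _).trans (add_le_add le_rfl h3)⟩
    -- The second derivative was found separately at each time, so measurability in `t` needs a
    -- selection; uniqueness of derivatives transfers the bound to it.
    obtain ⟨y, hym, hy⟩ := exists_aestronglyMeasurable_dx hvxm (by
      filter_upwards [hH2] with t ⟨gx, h1, _⟩ using ⟨gx, h1⟩)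
    refine ⟨y, hvxp 2, ?_, ?_⟩
    · refine MemLp.mono' (hz.norm.add (((hvxp 2).norm.const_mul (C * M)).add
        (hpx.norm.const_mul C))) hym ?_
      filter_upwards [hH2, hy] with t ⟨gx, h1, h2⟩ h3
      rw [h3.unique h1]; exact h2
    · filter_upwards [hy] with t ht using ⟨hvdx t, ht⟩
  -- The same `z` serves as `∂ₓ F` and as `∂ₜ h(v)`, so the equation holds by reflexivity.
  · refine ⟨vx, fun t => vx t + B t, z, fun t => nemytskii (fun r _ => h r) (v t) 0, z,
      Filter.Eventually.of_forall hvdx, ?_, hFdx, ?_, hweak hz hXz,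
      Filter.Eventually.of_forall fun t => Filter.Eventually.of_forall fun x => rfl, ?_⟩
    · filter_upwards [hBae] with t ht
      filter_upwards [ht, Lp.coeFn_add (vx t) (B t)] with x h1 h2
      rw [h2, Pi.add_apply, h1]
    · exact Filter.Eventually.of_forall fun t => hhL.nemytskii_ae (v t) 0
    · filter_upwards [hflux] with t ht
      rw [ht.2]; exact hasBoundaryValues_volterra ht.1
  · exact ⟨v, hXc, Filter.Eventually.of_forall fun _ => rfl, by simp only [hv, hX0, hx₀]⟩

end Existence

/-! ### Uniqueness -/

section Uniqueness

theorem eqOn_Icc_of_ae_restrict_Ioo {E : Type*} [TopologicalSpace E] [T2Space E] {T : ℝ}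
    (hT : 0 < T) {f g : ℝ → E} (hf : ContinuousOn f (Icc 0 T)) (hg : ContinuousOn g (Icc 0 T))
    (h : ∀ᵐ t ∂volume.restrict (Ioo 0 T), f t = g t) : EqOn f g (Icc 0 T) := by
  rw [Measure.restrict_congr_set Ioo_ae_eq_Icc] at h
  exact Measure.eqOn_Icc_of_ae_eq volume hT.ne h hf hg

/-- What a strong solution provides for the uniqueness argument: the flux `F` is the time
derivative of the primitive of `h(v)`, and the mass is conserved. -/
theorem IsStrongSolution.exists_flux {T : ℝ} {h b : ℝ → ℝ} {p : ℝ → L2Unit}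
    {v₀ : L2Unit} {v : ℝ → L2Unit} (hv : IsStrongSolution T h b p v₀ v) {α β γ K : ℝ}
    {G : ℝ → ℝ → ℝ} (hN : LipschitzPair γ 0 fun r _ => h r) (hG : LipschitzPair α β G)
    (hGK : ∀ r s, |G r s| ≤ K) (hpm : AEStronglyMeasurable p (volume.restrict (Ioo 0 T)))
    (hGp : ∀ᵐ t ∂volume.restrict (Ioo 0 T), ∀ᵐ x ∂volume.restrict (Ioo (0 : ℝ) 1),
      ∀ r, G r (p t x) = b r * p t x) :
    ∃ vx F : ℝ → L2Unit, (∀ᵐ t ∂volume.restrict (Ioo 0 T), IsDx (v t) (vx t)) ∧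
      (∀ᵐ t ∂volume.restrict (Ioo 0 T), F t = vx t + nemytskii G (v t) (p t)) ∧
      IntegrableOn F (Ioo 0 T) ∧
      IsWeakDeriv 0 T (fun t => volterra (nemytskii (fun r _ => h r) (v t) 0)) F ∧
      IsWeakDeriv 0 T (fun t => inner ℝ (nemytskii (fun r _ => h r) (v t) 0) oneL2) 0 := by
  obtain ⟨hvp, vx', hvx', hvdx'⟩ := hv.memLinfH1
  obtain ⟨vx, F, Fx, hu, hut, h1, h2, h3, h4, h5, h6, h7⟩ := hv.equation
  have hFeq : ∀ᵐ t ∂volume.restrict (Ioo 0 T), F t = vx t + nemytskii G (v t) (p t) := by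
    filter_upwards [h2, hGp] with t e1 e2
    refine Lp.ext ?_
    filter_upwards [e1, e2, Lp.coeFn_add (vx t) (nemytskii G (v t) (p t)),
      hG.nemytskii_ae (v t) (p t)] with x k1 k2 k3 k4
    rw [k1, k3, Pi.add_apply, k4, k2]
  have hK : 0 ≤ K := (abs_nonneg _).trans (hGK 0 0)
  have hut' : ∀ᵐ t ∂volume.restrict (Ioo 0 T), inner ℝ (hut t) oneL2 = 0 ∧
      F t = volterra (hut t) := by
    filter_upwards [h3, h6, h7] with t e1 e2 e3
    have e4 : hut t = Fx t := Lp.ext e2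
    rw [e4]
    exact e1.eq_volterra_of_hasBoundaryValues e3
  have hu' : ∀ᵐ t ∂volume.restrict (Ioo 0 T), hu t = nemytskii (fun r _ => h r) (v t) 0 := by
    filter_upwards [h4] with t e1
    refine Lp.ext ?_
    filter_upwards [e1, hN.nemytskii_ae (v t) 0] with x k1 k2
    rw [k1, k2]
  refine ⟨vx, F, h1, hFeq, ?_, ?_, ?_⟩
  · have i1 : IntegrableOn vx' (Ioo 0 T) := hvx'.integrable le_top
    have i2 : IntegrableOn (fun t => nemytskii G (v t) (p t)) (Ioo 0 T) := by
      refine (MemLp.of_bound (p := 1) ?_ K (Filter.Eventually.of_forall fun t =>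
        hG.norm_nemytskii_le hK hGK _ _)).integrable le_rfl
      exact hG.continuous_nemytskii.comp_aestronglyMeasurable
        (hvp.aestronglyMeasurable.prodMk hpm)
    refine (Integrable.add i1 i2).congr ?_
    filter_upwards [hFeq, h1, hvdx'] with t e1 e2 e3
    rw [Pi.add_apply, e1, e3.unique e2]
  -- `V` is bounded, so it commutes with `∂ₜ`; the no-flux condition gives `V (∂ₓ F) = F`.
  · refine (h5.map volterra).congr ?_ ?_
    · filter_upwards [hu'] with t e1; rw [e1]
    · filter_upwards [hut'] with t e1 using e1.2.symm
  · refine (h5.map (innerSL ℝ oneL2)).congr ?_ ?_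
    · filter_upwards [hu'] with t e1
      rw [e1, innerSL_apply_apply, real_inner_comm]
    · filter_upwards [hut'] with t e1
      rw [innerSL_apply_apply, real_inner_comm]; exact e1.1

theorem IsStrongSolution.unique {T : ℝ} (hT : 0 < T) {h b : ℝ → ℝ}
    (hh : AssumptionA1 h) (hb : AssumptionA2 b) {p : ℝ → L2Unit} (hp_bdd : MemLinfQ T p)
    {v₀ : L2Unit} {v w : ℝ → L2Unit} (hv : IsStrongSolution T h b p v₀ v)
    (hw : IsStrongSolution T h b p v₀ w) : ∀ᵐ t ∂volume.restrict (Ioo 0 T), v t = w t := by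
  obtain ⟨hhC, c₁, c₂, hc₁, hc₂, hhb⟩ := hh
  obtain ⟨hbC, d₁, C, hd₁, hC, hbb⟩ := hb
  have hbabs : ∀ r, |b r| ≤ C := fun r => by
    rw [abs_of_nonneg (hd₁.le.trans (hbb r).1)]; exact (hbb r).2.1
  have hbL := abs_sub_le_of_abs_deriv_le (hbC.differentiable (by norm_num)) fun r => (hbb r).2.2.1
  obtain ⟨hpm, M', hM'⟩ := hp_bdd
  set M := |M'| with hM
  have hM0 : 0 ≤ M := abs_nonneg _
  have hG := lipschitzPair_mul_clip hM0 hbabs hbL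
  have hGM : ∀ r s, |b r * clip M s| ≤ C * M := fun r s => by
    rw [abs_mul]; exact mul_le_mul (hbabs r) (abs_clip_le hM0 s) (abs_nonneg _) hC.le
  have hGp : ∀ᵐ t ∂volume.restrict (Ioo 0 T), ∀ᵐ x ∂volume.restrict (Ioo (0 : ℝ) 1),
      ∀ r, b r * clip M (p t x) = b r * p t x := by
    filter_upwards [hM'] with t ht
    filter_upwards [ht] with x hx r
    rw [clip_eq (hx.trans (le_abs_self _))]
  have hhd := hhC.differentiable (by norm_num)
  have hhL : LipschitzPair c₂ 0 fun r _ => h r := ⟨hc₂.le, le_rfl, fun r s r' s' => by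
    rw [zero_mul, add_zero]
    refine abs_sub_le_of_abs_deriv_le hhd (fun r => ?_) r r'
    rw [abs_of_nonneg (hc₁.le.trans (hhb r).1)]; exact (hhb r).2.1⟩
  have hmono := inner_nemytskii_sub_ge hhL (mul_sq_le_of_le_deriv hhd fun r => (hhb r).1)
  obtain ⟨vx, F, hvx, hF, hFi, hFd, hFm⟩ := hv.exists_flux hhL hG hGM hpm hGp
  obtain ⟨wx, E, hwx, hE, hEi, hEd, hEm⟩ := hw.exists_flux hhL hG hGM hpm hGp
  obtain ⟨vc, hvc, hvvc, hvc0⟩ := hv.initial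
  obtain ⟨wc, hwc, hwwc, hwc0⟩ := hw.initial
  set N : L2Unit → L2Unit := fun u => nemytskii (fun r _ => h r) u 0 with hNdef
  have hNc : Continuous N := hhL.continuous_nemytskii.comp
    (by fun_prop : Continuous fun u : L2Unit => (u, (0 : L2Unit)))
  set D : ℝ → L2Unit := fun t => N (vc t) - N (wc t) with hD
  have hDc : ContinuousOn D (Icc 0 T) :=
    (hNc.comp_continuousOn hvc).sub (hNc.comp_continuousOn hwc)
  have hD0 : D 0 = 0 := by simp [hD, hvc0, hwc0]
  have h0 : (0 : ℝ) ∈ Icc 0 T := ⟨le_rfl, hT.le⟩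
  have hfi : IntegrableOn (fun t => F t - E t) (Ioo 0 T) := Integrable.sub hFi hEi
  have hfii := intervalIntegrable_of_integrableOn_Ioo hT.le hfi
  have hIc : ContinuousOn (fun t => ∫ s in (0 : ℝ)..t, (F s - E s)) (Icc 0 T) := by
    have := hfii.absolutelyContinuousOnInterval_integral.continuousOn
    rwa [uIcc_of_le hT.le] at this
  -- The constant of integration vanishes because both solutions start at `v₀`; this is read off
  -- from the continuous representatives.
  have hint : ∀ t ∈ Icc 0 T, volterra (D t) = 0 + ∫ s in (0 : ℝ)..t, (F s - E s) := by
    obtain ⟨c, hc⟩ := (hFd.sub hEd).exists_eq_integral hT hfi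
    have h1 : EqOn (fun t => volterra (D t)) (fun t => c + ∫ s in (0 : ℝ)..t, (F s - E s))
        (Icc 0 T) := by
      refine eqOn_Icc_of_ae_restrict_Ioo hT (volterra.continuous.comp_continuousOn hDc)
        (continuousOn_const.add hIc) ?_
      filter_upwards [hc, hvvc, hwwc] with t e1 e2 e3
      rw [← e1, hD, map_sub, ← e2, ← e3]
    have h2 := h1 h0
    simp only [hD0, map_zero, intervalIntegral.integral_same, add_zero] at h2
    rw [h2]
    exact h1
  have hmean : ∀ t ∈ Icc 0 T, inner ℝ (D t) oneL2 = 0 := by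
    obtain ⟨c, hc⟩ := ae_const_of_isWeakDeriv_zero hT ((hFm.sub hEm).congr (g' := 0)
      (Filter.Eventually.of_forall fun _ => rfl) (Filter.Eventually.of_forall fun t => sub_self _))
    have h1 : EqOn (fun t => inner ℝ (D t) oneL2) (fun _ => c) (Icc 0 T) := by
      refine eqOn_Icc_of_ae_restrict_Ioo hT (hDc.inner continuousOn_const) continuousOn_const ?_
      filter_upwards [hc, hvvc, hwwc] with t e1 e2 e3
      rw [← e1, hD, inner_sub_left, ← e2, ← e3]
    intro t ht
    have h2 := h1 h0
    simp only [hD0, inner_zero_left] at h2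
    exact (h1 ht).trans h2.symm
  -- The diffusive part contributes at most `-2 c₁ ‖v - w‖²`, by `V + V† = 1 ⊗ 1`, mean zero and
  -- monotonicity of `h`. Young's inequality uses it to absorb the drift difference, leaving only
  -- `‖V D‖²`.
  have hdiss : ∀ᵐ t ∂volume.restrict (Ioo 0 T), 2 * inner ℝ (volterra (D t)) (F t - E t)
      ≤ (C * M) ^ 2 / (2 * c₁) * ‖volterra (D t)‖ ^ 2 := by
    filter_upwards [hvx, hwx, hF, hE, hvvc, hwwc, ae_restrict_mem measurableSet_Ioo]
      with t e1 e2 e3 e4 e5 e6 ht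
    have hm := hmean t (Ioo_subset_Icc_self ht)
    have e7 : D t = N (v t) - N (w t) := by rw [hD, e5, e6]
    obtain ⟨a, ha⟩ := isDx_iff.1 (e1.sub e2)
    have e8 : inner ℝ (volterra (D t)) (vx t - wx t) = -inner ℝ (D t) (v t - w t) := by
      have k1 := inner_volterra_add (D t) (vx t - wx t)
      rw [hm, zero_mul] at k1
      rw [ha, inner_add_right, inner_smul_right, hm, mul_zero, zero_add]
      linarith
    have e9 := hmono (v t) (w t)
    change _ ≤ inner ℝ (N (v t) - N (w t)) (v t - w t) at e9
    rw [← e7] at e9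
    have e10 : F t - E t = (vx t - wx t)
        + (nemytskii (fun r s => b r * clip M s) (v t) (p t)
          - nemytskii (fun r s => b r * clip M s) (w t) (p t)) := by
      rw [e3, e4]; abel
    have e11 : inner ℝ (volterra (D t)) (nemytskii (fun r s => b r * clip M s) (v t) (p t)
          - nemytskii (fun r s => b r * clip M s) (w t) (p t))
        ≤ ‖volterra (D t)‖ * (C * M * ‖v t - w t‖) := by
      refine (real_inner_le_norm _ _).trans (mul_le_mul_of_nonneg_left ?_ (norm_nonneg _))
      simpa using hG.norm_nemytskii_sub_le (v t) (p t) (w t) (p t)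
    rw [e10, inner_add_right, e8]
    have e12 : 0 ≤ (C * M * ‖volterra (D t)‖ - 2 * c₁ * ‖v t - w t‖) ^ 2 / (2 * c₁) := by
      positivity
    have e13 : (C * M * ‖volterra (D t)‖ - 2 * c₁ * ‖v t - w t‖) ^ 2 / (2 * c₁)
        = (C * M) ^ 2 / (2 * c₁) * ‖volterra (D t)‖ ^ 2
          - 2 * (‖volterra (D t)‖ * (C * M * ‖v t - w t‖)) + 2 * (c₁ * ‖v t - w t‖ ^ 2) := by
      field_simp; ring
    linarith
  have hVc : ContinuousOn (fun t => volterra (D t)) (Icc 0 T) :=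
    volterra.continuous.comp_continuousOn hDc
  have hzero : ∀ t ∈ Icc 0 T, ‖volterra (D t)‖ ^ 2 = 0 := fun t ht => by
    refine eq_zero_of_le_mul_integral (T := T) (K := (C * M) ^ 2 / (2 * c₁))
      (y := fun t => ‖volterra (D t)‖ ^ 2) hT.le (hVc.norm.pow 2) (fun _ _ => by positivity)
      (fun t ht => ?_) ht
    have hsub : uIcc 0 t ⊆ Icc 0 T := by rw [uIcc_of_le ht.1]; exact Icc_subset_Icc_right ht.2
    have h1 := norm_sq_integral_eq hT.le hfi 0 ht
    rw [← hint t ht, norm_zero, zero_pow two_ne_zero, zero_add] at h1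
    rw [h1, ← intervalIntegral.integral_const_mul]
    have h2 : ∫ s in (0 : ℝ)..t, 2 * inner ℝ (0 + ∫ r in (0 : ℝ)..s, (F r - E r)) (F s - E s)
        = ∫ s in (0 : ℝ)..t, 2 * inner ℝ (volterra (D s)) (F s - E s) := by
      refine intervalIntegral.integral_congr fun s hs => ?_
      rw [hint s (hsub hs)]
    rw [h2]
    refine intervalIntegral.integral_mono_ae_restrict ht.1 ?_ ?_ ?_
    · exact ((hfii.mono_set (by rwa [uIcc_of_le hT.le])).inner_of_continuousOn
        (hVc.mono hsub)).const_mul 2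
    · exact ((((hVc.mono hsub).norm.pow 2).intervalIntegrable).const_mul _)
    · rw [← Measure.restrict_congr_set Ioo_ae_eq_Icc]
      exact ae_restrict_of_ae_restrict_of_subset (Ioo_subset_Ioo_right ht.2) hdiss
  filter_upwards [hvvc, hwwc, ae_restrict_mem measurableSet_Ioo] with t e1 e2 ht
  have ht' := Ioo_subset_Icc_self ht
  have h1 : volterra (D t) = 0 := norm_eq_zero.1 (pow_eq_zero_iff two_ne_zero |>.1 (hzero t ht'))
  -- `V` is injective because a weak derivative is unique.
  have h2 : D t = 0 :=
    (isDx_iff.2 ⟨0, by rw [h1, zero_smul, zero_add]⟩ : IsDx 0 (D t)).unique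
      (isDx_iff.2 ⟨0, by rw [map_zero, zero_smul, zero_add]⟩)
  have h3 := hmono (vc t) (wc t)
  change _ ≤ inner ℝ (D t) (vc t - wc t) at h3
  rw [h2, inner_zero_left] at h3
  have h4 : ‖vc t - wc t‖ ^ 2 ≤ 0 := by
    by_contra! hlt
    nlinarith
  rw [e1, e2]
  exact sub_eq_zero.1 (norm_eq_zero.1
    (pow_eq_zero_iff two_ne_zero |>.1 (le_antisymm h4 (sq_nonneg _))))

end Uniqueness

theorem theorem1 (T : ℝ) (hT : 0 < T) (h b : ℝ → ℝ)
    (hh : AssumptionA1 h) (hb : AssumptionA2 b)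
    (p : ℝ → L2Unit) (hp_time : MemW12L2 T p) (hp_bdd : MemLinfQ T p) (hp_space : MemLqH1 T 2 p)
    (v₀ : L2Unit) (hv₀ : MemH1 v₀) :
    (∃ v : ℝ → L2Unit, IsStrongSolution T h b p v₀ v) ∧
      ∀ v w : ℝ → L2Unit, IsStrongSolution T h b p v₀ v → IsStrongSolution T h b p v₀ w →
        ∀ᵐ t ∂(volume.restrict (Ioo 0 T)), v t = w t :=
  ⟨exists_strongSolution hT hh hb hp_time hp_bdd hp_space hv₀,
    fun _ _ hv hw => hv.unique hT hh hb hp_bdd hw⟩
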